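/- Coordinates on $\mathbb{R}^{n+1}$ are $z=(x,\rho)$, $x\in\mathbb{R}^n$, with dual variables $\zeta=(\xi,\eta)$, and $\mathbb{H}_-=\{\rho<0\}$. Let $k\le -1$ be real and let $A=Op(a)$, $$Af(z)=\frac{1}{(2\pi)^{n+1}}\int a(z,\zeta)\,\widehat f(\zeta)\,e^{iz\cdot\zeta}\,d\zeta,$$ be a pseudodifferential operator on $\mathbb{R}^{n+1}$ with symbol $a$ of order $k$ (type $(1,0)$, estimates locally uniform in $z$). Functions $f$ on $\mathbb{H}_-$ are extended by zero, so that $\widehat f(\zeta)=\int_{\mathbb{H}_-}f(z)e^{-iz\cdot\zeta}\,dz$. Assume that: (i) for all $(x,\rho,\xi)$ the function $\eta\mapsto a(x,\rho,\xi,\eta)$ extends to a meromorphic function on the Riemann sphere (i.e. a rational function of $\eta$), whose poles in $\mathbb{C}$, counted with multiplicity, are among finitely many $q_1(x,\rho,\xi),\dots,q_N(x,\rho,\xi)$, with $N$ fixed; (ii) each $q_i$ is a symbol of order $1$ in $\xi$, depending on the parameters $(x,\rho)$, and $\operatorname{Im} q_i$ is elliptic of order $1$: for every compact $K\subset\mathbb{R}^{n+1}$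 there are $c>0$ and $R$ with $|\operatorname{Im} q_i(x,\rho,\xi)|\ge c(1+|\xi|)$ for $(x,\rho)\in K$, $|\xi|\ge R$; (iii) for each $\rho$ and $i$, $\operatorname{Res}_{\eta=q_i}a$ is a symbol of order $k+1$ on $\mathbb{R}^n$, with estimates locally uniform in $\rho$. For $\sigma\ge 0$ let $W^\sigma(\mathbb{H}_-)$ be the space of restrictions to $\mathbb{H}_-$ of elements of $W^\sigma(\mathbb{R}^{n+1})$ with the quotient norm; for $\sigma<0$ and $f\in L^2(\mathbb{H}_-)$ let $\|f\|_{W^\sigma(\mathbb{H}_-)}$ be the $W^\sigma(\mathbb{R}^{n+1})$-norm of the extension of $f$ by zero. Then for all $s\ge 0$ one has $\|Af\|_{W^s_{loc}(\mathbb{H}_-)}\lesssim\|f\|_{W^{s+k}(\mathbb{H}_-)}$ for $f\in W^s(\mathbb{H}_-)$, locally up to the boundary: for every $\chi\in C_c^\infty(\mathbb{R}^{n+1})$ there is a constant $C$ (depending only on $n,k,a,s,\chi$) such that for every $f\in W^s(\mathbb{H}_-)$ the restriction of $\chi Af$ to $\mathbb{H}_-$ lies in $W^s(\mathbb{H}_-)$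 and $$\|\chi Af\|_{W^s(\mathbb{H}_-)}\le C\,\|f\|_{W^{s+k}(\mathbb{H}_-)}.$$ -/

import Mathlib

open MeasureTheory Filter Topology FourierTransform
open scoped ContDiff ENNReal NNReal

noncomputable section

/-- `ℝ^{n+1}` with coordinates `z = (x, ρ)`; the last coordinate is `ρ`. -/
abbrev RSpace (n : ℕ) : Type := EuclideanSpace ℝ (Fin (n + 1))

/-- `ℝ^n`, the space of the tangential variables `x` and of their dual variables `ξ`. -/
abbrev RTan (n : ℕ) : Type := EuclideanSpace ℝ (Fin n)

/-- The point `(x, ρ)` of `ℝ^{n+1}`; also used for the covector `(ξ, η)`. -/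
def joinLast {n : ℕ} (x : RTan n) (r : ℝ) : RSpace n :=
  WithLp.toLp 2 (Fin.snoc (α := fun _ => ℝ) (fun i => x i) r)

/-- The open lower half-space `{(x, ρ) : ρ < 0}`. -/
def lowerHalf (n : ℕ) : Set (RSpace n) := {z | z (Fin.last n) < 0}

/-- `L²` of the lower half-space. -/
abbrev L2Half (n : ℕ) : Type := Lp ℂ 2 ((volume : Measure (RSpace n)).restrict (lowerHalf n))

/-- `L²` of the whole space. -/
abbrev L2Full (n : ℕ) : Type := Lp ℂ 2 (volume : Measure (RSpace n))

theorem measurableSet_lowerHalf (n : ℕ) : MeasurableSet (lowerHalf n) := by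
  have h : IsOpen (lowerHalf n) :=
    isOpen_lt (by fun_prop : Continuous fun z : RSpace n => z (Fin.last n)) continuous_const
  exact h.measurableSet

theorem memLp_zeroExt {n : ℕ} (f : L2Half n) :
    MemLp ((lowerHalf n).indicator (f : RSpace n → ℂ)) 2 volume :=
  (memLp_indicator_iff_restrict (measurableSet_lowerHalf n)).2 (Lp.memLp f)

/-- Extension by zero, `L²(ℍ₋) → L²(ℝ^{n+1})`. -/
def zeroExt {n : ℕ} (f : L2Half n) : L2Full n := (memLp_zeroExt f).toLp _

/-- The norm of `W^σ(ℝ^{n+1})`, with value `∞` outside this space. The frequency dual to `z` is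
`2πv`, where `v` is the variable of Mathlib's Fourier transform. -/
def sobolevNorm {n : ℕ} (σ : ℝ) (U : L2Full n) : ℝ≥0∞ :=
  (∫⁻ v : RSpace n, ENNReal.ofReal ((1 + ‖(2 * Real.pi) • v‖ ^ 2) ^ σ) *
    ‖(𝓕 U : L2Full n) v‖ₑ ^ 2) ^ (1 / 2 : ℝ)

/-- The norm of `W^σ(ℍ₋)` on functions of `L²(ℍ₋)`, with value `∞` outside `W^σ(ℍ₋)`.
For `σ ≥ 0` it is the norm of the space of restrictions of elements of `W^σ(ℝ^{n+1})` (the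
infimum over all extensions). For `σ < 0` it is the `W^σ(ℝ^{n+1})`-norm of the extension by zero
(equivalently, the norm of the dual of `W^{-σ}(ℍ₋)`). -/
def halfNorm {n : ℕ} (σ : ℝ) (f : L2Half n) : ℝ≥0∞ :=
  if 0 ≤ σ then
    ⨅ (U : L2Full n) (_ : (U : RSpace n → ℂ) =ᵐ[volume.restrict (lowerHalf n)] f), sobolevNorm σ U
  else sobolevNorm σ (zeroExt f)

/-- A family `(a_t)` indexed by `t ∈ T` of symbols of order `m` and type `(1,0)`, with symbol
estimates that are uniform in `t ∈ T` and locally uniform in the base variable. -/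
def IsSymbolFamily {ι X Y : Type*} [NormedAddCommGroup X] [NormedSpace ℝ X]
    [NormedAddCommGroup Y] [NormedSpace ℝ Y] (m : ℝ) (T : Set ι) (a : ι → X → Y → ℂ) : Prop :=
  (∀ t ∈ T, ContDiff ℝ ∞ (fun p : X × Y => a t p.1 p.2)) ∧
  ∀ (K : Set X), IsCompact K → ∀ i j : ℕ, ∃ C : ℝ, ∀ t ∈ T, ∀ z ∈ K, ∀ ζ : Y,
    ‖iteratedFDeriv ℝ i (fun z' => iteratedFDeriv ℝ j (fun ζ' => a t z' ζ') ζ) z‖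
      ≤ C * (1 + ‖ζ‖) ^ (m - j)

/-- A symbol of order `m` and type `(1,0)`, base variable in `X` and frequency in `Y`. -/
def IsSymbol {X Y : Type*} [NormedAddCommGroup X] [NormedSpace ℝ X]
    [NormedAddCommGroup Y] [NormedSpace ℝ Y] (m : ℝ) (a : X → Y → ℂ) : Prop :=
  IsSymbolFamily m (Set.univ : Set Unit) (fun _ => a)

/-- Ellipticity of order `m`: locally uniformly in the base variable, `|b(z, ζ)| ≥ c (1 + |ζ|)^m`
for `|ζ|` large. -/
def IsEllipticOfOrder {X Y : Type*} [NormedAddCommGroup X] [NormedAddCommGroup Y]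
    (m : ℝ) (b : X → Y → ℝ) : Prop :=
  ∀ K : Set X, IsCompact K → ∃ c > 0, ∃ R : ℝ, ∀ z ∈ K, ∀ ζ : Y, R ≤ ‖ζ‖ →
    c * (1 + ‖ζ‖) ^ m ≤ |b z ζ|

/-- The residue of `g` at `c`: the common value of `(2πi)⁻¹ ∮ g` over all small circles about `c`
(for `g` meromorphic at `c`). -/
def residue (g : ℂ → ℂ) (c : ℂ) : ℂ :=
  limUnder (𝓝[>] (0 : ℝ)) fun r : ℝ => (2 * Real.pi * Complex.I)⁻¹ * ∮ w in C(c, r), g w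

/-- `g` is meromorphic on the Riemann sphere (that is, rational), and its poles in `ℂ` are among
`q 0, …, q (N - 1)`, listed with multiplicity. -/
def IsMeromorphicWithPoles {N : ℕ} (g : ℂ → ℂ) (q : Fin N → ℂ) : Prop :=
  Meromorphic g ∧ MeromorphicAt (fun w => g w⁻¹) 0 ∧
  ∀ c : ℂ, ((-((Finset.univ.filter fun i => q i = c).card : ℤ) : ℤ) : WithTop ℤ)
    ≤ meromorphicOrderAt g c

/-- The hypothesis on the symbol `a(z, ζ)`, `z = (x, ρ)`, `ζ = (ξ, η)`, of the operator: a symbol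
of order `k`, meromorphic in `η` (with extension `b(z, ξ, ·)`), with poles `q_i(z, ξ)` that are
symbols of order `1` in `ξ` with elliptic imaginary parts, and whose residues at these poles are,
for each `ρ`, symbols of order `k + 1` on `ℝ^n`, locally uniformly in `ρ`. -/
def HasEllipticPoles (n : ℕ) (k : ℝ) (a : RSpace n → RSpace n → ℂ) : Prop :=
  IsSymbol k a ∧
  ∃ (N : ℕ) (q : Fin N → RSpace n → RTan n → ℂ) (b : RSpace n → RTan n → ℂ → ℂ),
    (∀ z ξ, ∀ η : ℝ, b z ξ (η : ℂ) = a z (joinLast ξ η)) ∧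
    (∀ z ξ, IsMeromorphicWithPoles (b z ξ) (fun i => q i z ξ)) ∧
    (∀ i, IsSymbol 1 (q i)) ∧
    (∀ i, IsEllipticOfOrder 1 (fun z ξ => (q i z ξ).im)) ∧
    (∀ i, ∀ L : Set ℝ, IsCompact L →
      IsSymbolFamily (k + 1) L (fun (r : ℝ) (x ξ : RTan n) =>
        residue (b (joinLast x r) ξ) (q i (joinLast x r) ξ)))

/-- The distribution `A F`, `F ∈ L²(ℝ^{n+1})`, evaluated at the test function `φ`, where
`A F(z) = (2π)^{-(n+1)} ∫ a(z, ζ) F̂(ζ) e^{i z·ζ} dζ` with `F̂(ζ) = ∫ F(z) e^{-i z·ζ} dz`;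
here `ζ = 2πv`. The `z`-integration against `φ` is done first: its result decreases rapidly
in `v`, so that the `v`-integral converges absolutely. -/
def opPairing {n : ℕ} (a : RSpace n → RSpace n → ℂ) (F : L2Full n) (φ : RSpace n → ℂ) : ℂ :=
  ∫ v : RSpace n, (𝓕 F : L2Full n) v *
    ∫ z : RSpace n, φ z * a z ((2 * Real.pi) • v) *
      Complex.exp (2 * Real.pi * Complex.I * (inner ℝ z v : ℝ))

/-- `u ∈ L²(ℍ₋)` is the restriction to `ℍ₋` of the distribution `χ · A f`, where `A = Op(a)` acts
on the extension of `f` by zero. -/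
def IsCutoffImage {n : ℕ} (a : RSpace n → RSpace n → ℂ) (χ : RSpace n → ℂ) (f u : L2Half n) :
    Prop :=
  ∀ φ : RSpace n → ℂ, ContDiff ℝ ∞ φ → HasCompactSupport φ → tsupport φ ⊆ lowerHalf n →
    opPairing a (zeroExt f) (fun z => χ z * φ z) = ∫ z in lowerHalf n, u z * φ z

end

/-! Write `Λ = 1 + |ξ|`. On the whole space, `χ Op(a)` maps `W^{s+k}` to `W^s`: on the Fourier side
its kernel is `𝓕 (b v) (θ - v)`, where `b` is the cut-off symbol. Smoothness in `z` makes this decay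
rapidly in `θ - v`, so Peetre's and Young's inequalities suffice (`exists_op_image`). Only
`z`-derivatives of the symbol enter. For `s + k < 0` this finishes the proof, since the norm of `f`
is then that of its zero extension.

For `s + k ≥ 0` the zero extension of `f` need not lie in `W^{s+k}`. Take any extension `F` in that
space and write `f = F - g`, with `g` supported in the upper half-space. The term `A F` is covered
by the whole-space bound; what remains is `A g` on the lower half-space, and here rationality in `η`
is decisive.

As `k < 0`, the product `a ∏ (η - q_i)` is a polynomial in `η` of degree less than `N`, and this
yields the expansion (`IsRationalSymbol.exists_expansion`) `a = ∑_{j<m} (η - iΛ)^{-(j+1)} c_j(z, ξ)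
+ (η - iΛ)^{-m} r`, with `c_j = O(Λ^{k+j+1})` and `r = O(Λ^{k+m})` uniformly in `η`. The pole `iΛ`
lies in the upper half-plane, so the kernel of `(η - iΛ)^{-j}` propagates only towards larger `ρ`.
The terms of the sum therefore send `g` to functions that vanish on the lower half-space
(`fourier_tangential_eq_zero`, `HasEllipticPoles.exists_reduced_symbol`).

For `m ≥ s` the remainder satisfies `|η - iΛ|^{-m} Λ^{k+m} (1 + |ζ|^2)^{s/2} ≤ Λ^{s+k}`
(`reducedWeight_le`), so only a tangential Sobolev norm of `g` is needed. Tangential multipliers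
preserve both half-spaces, so the two parts of `F` are orthogonal in such a norm. The norm of `g` is
thus at most that of `F`, hence at most the full `W^{s+k}` norm (`lintegral_tangentialWeight_le`).
The infimum over `F` gives the quotient norm, because the image does not depend on `F`
(`IsCutoffImage.unique`). -/

open MeasureTheory Filter Topology FourierTransform
open scoped ContDiff ENNReal NNReal

noncomputable section

/-! ### Families of smooth functions with weighted derivative bounds -/

section DerivBound

variable {ι E : Type*} [NormedAddCommGroup E] [NormedSpace ℝ E]

/-- Every member of the family `f` is smooth, and on `K` its derivatives of each order are bounded
by the weight `w`, uniformly over the parameters in `S`. -/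
def DerivBound (K : Set E) (S : Set ι) (w : ι → ℝ) (f : ι → E → ℂ) : Prop :=
  (∀ p, ContDiff ℝ ∞ (f p)) ∧
    ∀ i : ℕ, ∃ C : ℝ, ∀ p ∈ S, ∀ z ∈ K, ‖iteratedFDeriv ℝ i (f p) z‖ ≤ C * w p

variable {K : Set E} {S : Set ι} {w w' : ι → ℝ} {f g : ι → E → ℂ}

theorem DerivBound.mono (hf : DerivBound K S w f) {S' : Set ι} (hS : S' ⊆ S) {A : ℝ}
    (hw : ∀ p ∈ S', 0 ≤ w p) (h : ∀ p ∈ S', w p ≤ A * w' p) : DerivBound K S' w' f := by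
  refine ⟨hf.1, fun i => ?_⟩
  obtain ⟨C, hC⟩ := hf.2 i
  refine ⟨|C| * A, fun p hp z hz => (hC p (hS hp) z hz).trans ?_⟩
  calc C * w p ≤ |C| * w p := mul_le_mul_of_nonneg_right (le_abs_self C) (hw p hp)
    _ ≤ |C| * (A * w' p) := mul_le_mul_of_nonneg_left (h p hp) (abs_nonneg C)
    _ = |C| * A * w' p := by ring

theorem DerivBound.add (hf : DerivBound K S w f) (hg : DerivBound K S w g) :
    DerivBound K S w (fun p z => f p z + g p z) := by
  refine ⟨fun p => (hf.1 p).add (hg.1 p), fun i => ?_⟩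
  obtain ⟨C, hC⟩ := hf.2 i
  obtain ⟨D, hD⟩ := hg.2 i
  refine ⟨C + D, fun p hp z hz => ?_⟩
  have h1 : iteratedFDeriv ℝ i (fun z => f p z + g p z) z
      = iteratedFDeriv ℝ i (f p) z + iteratedFDeriv ℝ i (g p) z :=
    iteratedFDeriv_add_apply ((hf.1 p).contDiffAt.of_le (mod_cast le_top))
      ((hg.1 p).contDiffAt.of_le (mod_cast le_top))
  rw [h1]
  calc _ ≤ _ := norm_add_le _ _
    _ ≤ C * w p + D * w p := add_le_add (hC p hp z hz) (hD p hp z hz)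
    _ = _ := by ring

theorem DerivBound.mul (hf : DerivBound K S w f) (hg : DerivBound K S w' g) :
    DerivBound K S (fun p => w p * w' p) (fun p z => f p z * g p z) := by
  refine ⟨fun p => (hf.1 p).mul (hg.1 p), fun i => ?_⟩
  choose C hC using hf.2
  choose D hD using hg.2
  refine ⟨∑ l ∈ Finset.range (i + 1), (i.choose l : ℝ) * C l * D (i - l), fun p hp z hz => ?_⟩
  refine (norm_iteratedFDeriv_mul_le (hf.1 p) (hg.1 p) z (mod_cast le_top)).trans ?_
  rw [Finset.sum_mul]
  refine Finset.sum_le_sum fun l _ => ?_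
  have h1 := hC l p hp z hz
  have h2 := hD (i - l) p hp z hz
  have h3 : ‖iteratedFDeriv ℝ l (f p) z‖ * ‖iteratedFDeriv ℝ (i - l) (g p) z‖
      ≤ (C l * w p) * (D (i - l) * w' p) :=
    mul_le_mul h1 h2 (norm_nonneg _) ((norm_nonneg _).trans h1)
  calc _ = (i.choose l : ℝ) *
        (‖iteratedFDeriv ℝ l (f p) z‖ * ‖iteratedFDeriv ℝ (i - l) (g p) z‖) := by ring
    _ ≤ (i.choose l : ℝ) * ((C l * w p) * (D (i - l) * w' p)) :=
        mul_le_mul_of_nonneg_left h3 (Nat.cast_nonneg _)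
    _ = _ := by ring

theorem DerivBound.const {c : ι → ℂ} {A : ℝ} (h : ∀ p ∈ S, ‖c p‖ ≤ A * w p) :
    DerivBound K S w (fun p _ => c p) := by
  refine ⟨fun p => contDiff_const, fun i => ?_⟩
  rcases Nat.eq_zero_or_pos i with rfl | hi
  · exact ⟨A, fun p hp z _ => by simpa using h p hp⟩
  · refine ⟨0, fun p hp z _ => ?_⟩
    rw [iteratedFDeriv_const_of_ne hi.ne']
    simp

theorem DerivBound.sum {J : Type*} (s : Finset J) {F : J → ι → E → ℂ}
    (h : ∀ j ∈ s, DerivBound K S w (F j)) :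
    DerivBound K S w (fun p z => ∑ j ∈ s, F j p z) := by
  classical
  induction s using Finset.induction_on with
  | empty =>
    simp only [Finset.sum_empty]
    exact DerivBound.const (A := 0) (by simp)
  | insert j s hj ih =>
    simp only [Finset.sum_insert hj]
    exact (h j (Finset.mem_insert_self _ _)).add
      (ih fun l hl => h l (Finset.mem_insert_of_mem hl))

theorem DerivBound.prod {J : Type*} (s : Finset J) {F : J → ι → E → ℂ}
    (h : ∀ j ∈ s, DerivBound K S w (F j)) :
    DerivBound K S (fun p => w p ^ s.card) (fun p z => ∏ j ∈ s, F j p z) := by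
  classical
  induction s using Finset.induction_on with
  | empty =>
    simp only [Finset.prod_empty, Finset.card_empty, pow_zero]
    exact DerivBound.const (A := 1) (by simp)
  | insert j s hj ih =>
    simp only [Finset.prod_insert hj, Finset.card_insert_of_notMem hj, pow_succ']
    exact (h j (Finset.mem_insert_self _ _)).mul
      (ih fun l hl => h l (Finset.mem_insert_of_mem hl))

theorem DerivBound.comp_param {κ : Type*} (hf : DerivBound K S w f) (φ : κ → ι) {S' : Set κ}
    (hφ : Set.MapsTo φ S' S) : DerivBound K S' (fun p => w (φ p)) (fun p => f (φ p)) := by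
  refine ⟨fun p => hf.1 _, fun i => ?_⟩
  obtain ⟨C, hC⟩ := hf.2 i
  exact ⟨C, fun p hp => hC _ (hφ hp)⟩

/-- Derivative bounds for the solution `f` of `f = h + e f` with `e` small. -/
theorem norm_iteratedFDeriv_le_of_eq_add_mul {f h e : E → ℂ} (hf : ContDiff ℝ ∞ f)
    (hh : ContDiff ℝ ∞ h) (he : ContDiff ℝ ∞ e) (heq : ∀ z, f z = h z + e z * f z) {z : E}
    {i : ℕ} {B : ℝ} (hB : ∀ l ≤ i, ‖iteratedFDeriv ℝ l h z‖ ≤ B)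
    (hs : ∀ l ≤ i, ‖iteratedFDeriv ℝ l e z‖ ≤ (1 / 2) ^ (i + 1)) {l : ℕ} (hl : l ≤ i) :
    ‖iteratedFDeriv ℝ l f z‖ ≤ 2 * B := by
  obtain ⟨m, hm, hmax⟩ := Finset.exists_max_image (Finset.range (i + 1))
    (fun l => ‖iteratedFDeriv ℝ l f z‖) ⟨0, by simp⟩
  set M := ‖iteratedFDeriv ℝ m f z‖ with hM
  have hmi : m ≤ i := Nat.lt_succ_iff.1 (Finset.mem_range.1 hm)
  have h1 : iteratedFDeriv ℝ m f z
      = iteratedFDeriv ℝ m h z + iteratedFDeriv ℝ m (fun z => e z * f z) z := by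
    have : f = fun z => h z + e z * f z := funext heq
    conv_lhs => rw [this]
    exact iteratedFDeriv_add_apply (hh.contDiffAt.of_le (mod_cast le_top))
      ((he.mul hf).contDiffAt.of_le (mod_cast le_top))
  -- The binomial coefficients in Leibniz' formula add up to `2 ^ m ≤ 2 ^ i`, so the smallness `(1 /
  -- 2) ^ (i + 1)` leaves `M / 2`, which is absorbed into the maximal derivative norm `M`.
  have h2 : ‖iteratedFDeriv ℝ m (fun z => e z * f z) z‖ ≤ M / 2 := by
    refine (norm_iteratedFDeriv_mul_le he hf z (mod_cast le_top)).trans ?_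
    calc _ ≤ ∑ j ∈ Finset.range (m + 1), (m.choose j : ℝ) * ((1 / 2) ^ (i + 1) * M) := by
          refine Finset.sum_le_sum fun j hj => ?_
          have hj' : j ≤ m := Nat.lt_succ_iff.1 (Finset.mem_range.1 hj)
          rw [mul_assoc]
          refine mul_le_mul_of_nonneg_left ?_ (Nat.cast_nonneg _)
          refine mul_le_mul (hs j (hj'.trans hmi)) ?_ (norm_nonneg _) (by positivity)
          exact hmax (m - j) (Finset.mem_range.2 (by omega))
      _ = 2 ^ m * ((1 / 2) ^ (i + 1) * M) := by
          rw [← Finset.sum_mul]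
          congr 1
          exact_mod_cast Nat.sum_range_choose m
      _ ≤ 2 ^ i * ((1 / 2) ^ (i + 1) * M) := by
          have : (0 : ℝ) ≤ (1 / 2) ^ (i + 1) * M := by positivity
          gcongr
          norm_num
      _ = M / 2 := by
          rw [pow_succ, ← mul_assoc, ← mul_assoc, ← mul_pow]
          norm_num
          ring
  have h3 : M ≤ B + M / 2 := by
    calc M = _ := by rw [hM, h1]
      _ ≤ _ := (norm_add_le _ _).trans (add_le_add (hB m hmi) h2)
  have h4 := hmax l (Finset.mem_range.2 (by omega))
  linarith

end DerivBound

/-! ### Symbols that are rational in the last frequency variable -/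

section Rational

variable {X E : Type*} [NormedAddCommGroup E] [NormedSpace ℝ E]

/-- As `DerivBound`, for parameters `(ξ, η)` with `|η| ≥ T Λ(ξ)`, where `T` may depend on the order
of the derivative. -/
def LargeDerivBound (K : Set E) (Λ : X → ℝ) (w : X × ℝ → ℝ) (f : X × ℝ → E → ℂ) : Prop :=
  (∀ p, ContDiff ℝ ∞ (f p)) ∧ ∀ i : ℕ, ∃ C T : ℝ, ∀ p : X × ℝ, T * Λ p.1 ≤ |p.2| →
    ∀ z ∈ K, ‖iteratedFDeriv ℝ i (f p) z‖ ≤ C * w p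

variable {K : Set E} {Λ : X → ℝ}

/-- The absorption argument at order `n` involves all lower orders at once, hence needs one constant
and one threshold for all of them. -/
theorem exists_uniform_bound {P : ℕ → ℝ → ℝ → Prop}
    (hmono : ∀ i C T C' T', C ≤ C' → T ≤ T' → P i C T → P i C' T')
    (h : ∀ i, ∃ C T, P i C T) (n : ℕ) : ∃ C T, 0 ≤ C ∧ 1 ≤ T ∧ ∀ i ≤ n, P i C T := by
  choose C T hCT using h
  refine ⟨∑ i ∈ Finset.range (n + 1), |C i|, 1 + ∑ i ∈ Finset.range (n + 1), |T i|,
    by positivity, by simp only [le_add_iff_nonneg_right]; positivity, fun i hi => ?_⟩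
  have hi' : i ∈ Finset.range (n + 1) := Finset.mem_range.2 (by omega)
  refine hmono i _ _ _ _ ?_ ?_ (hCT i)
  · exact (le_abs_self _).trans (Finset.single_le_sum (f := fun i => |C i|)
      (fun _ _ => abs_nonneg _) hi')
  · have := Finset.single_le_sum (f := fun i => |T i|) (fun _ _ => abs_nonneg _) hi'
    have h2 := le_abs_self (T i)
    linarith

/-- Division by `η - q` gains a factor `|η|` where `|η|` is much larger than `Λ`: there `q / η` is
small with its derivatives, and `f = η⁻¹ (f (η - q)) + (q / η) f` can be solved for `f` by
absorption. -/
theorem LargeDerivBound.of_mul_sub (hΛ : ∀ ξ, 1 ≤ Λ ξ) {w : X × ℝ → ℝ} (hw : ∀ p, 0 ≤ w p)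
    {f : X × ℝ → E → ℂ} {q : X → E → ℂ} (hf : ∀ p, ContDiff ℝ ∞ (f p))
    (hq : DerivBound K Set.univ Λ q)
    (h : LargeDerivBound K Λ (fun p => w p * |p.2|)
      (fun p z => f p z * ((p.2 : ℂ) - q p.1 z))) :
    LargeDerivBound K Λ w f := by
  refine ⟨hf, fun i => ?_⟩
  obtain ⟨C, T, hC0, hT1, hCT⟩ := exists_uniform_bound (P := fun i C T => ∀ p : X × ℝ,
    T * Λ p.1 ≤ |p.2| → ∀ z ∈ K,
      ‖iteratedFDeriv ℝ i (fun z => f p z * ((p.2 : ℂ) - q p.1 z)) z‖ ≤ C * (w p * |p.2|))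
    (by
      intro i C T C' T' hC hT hP p hp z hz
      refine (hP p ((mul_le_mul_of_nonneg_right hT (zero_le_one.trans (hΛ _))).trans hp) z
        hz).trans ?_
      exact mul_le_mul_of_nonneg_right hC (mul_nonneg (hw p) (abs_nonneg _))) h.2 i
  -- The threshold is a dummy here: the bounds on `q` hold for every `ξ`.
  obtain ⟨D, -, hD0, -, hD⟩ := exists_uniform_bound (P := fun i D _ => ∀ ξ, ∀ z ∈ K,
    ‖iteratedFDeriv ℝ i (q ξ) z‖ ≤ D * Λ ξ)
    (by
      intro i C T C' T' hC _ hP ξ z hz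
      exact (hP ξ z hz).trans (mul_le_mul_of_nonneg_right hC (zero_le_one.trans (hΛ _))))
    (fun i => by
      obtain ⟨D, hD⟩ := hq.2 i
      exact ⟨D, 0, fun ξ z hz => hD ξ (Set.mem_univ _) z hz⟩) i
  -- The second threshold forces the derivatives of `q / η` up to order `i` below `(1 / 2) ^ (i +
  -- 1)`.
  refine ⟨2 * C, max T (D * 2 ^ (i + 1)), fun p hp z hz => ?_⟩
  have hΛp : 0 < Λ p.1 := zero_lt_one.trans_le (hΛ _)
  have hp1 : T * Λ p.1 ≤ |p.2| :=
    (mul_le_mul_of_nonneg_right (le_max_left _ _) hΛp.le).trans hp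
  have hp2 : D * 2 ^ (i + 1) * Λ p.1 ≤ |p.2| :=
    (mul_le_mul_of_nonneg_right (le_max_right _ _) hΛp.le).trans hp
  have hη : 0 < |p.2| := (mul_pos (zero_lt_one.trans_le hT1) hΛp).trans_le hp1
  have hη' : (p.2 : ℂ) ≠ 0 := by
    have := abs_pos.1 hη
    exact_mod_cast this
  have hnη : ‖((p.2 : ℂ))⁻¹‖ = |p.2|⁻¹ := by simp
  have hqs : ContDiff ℝ ∞ (q p.1) := hq.1 _
  have hscale : ∀ (u : E → ℂ), ContDiff ℝ ∞ u → ∀ l, ‖iteratedFDeriv ℝ l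
      (fun z => ((p.2 : ℂ))⁻¹ * u z) z‖ = |p.2|⁻¹ * ‖iteratedFDeriv ℝ l u z‖ := by
    intro u hu l
    have : iteratedFDeriv ℝ l (fun z => ((p.2 : ℂ))⁻¹ • u z) z
        = ((p.2 : ℂ))⁻¹ • iteratedFDeriv ℝ l u z :=
      iteratedFDeriv_const_smul_apply' (hu.contDiffAt.of_le (mod_cast le_top))
    simp only [smul_eq_mul] at this
    rw [this, norm_smul, hnη]
  have key := norm_iteratedFDeriv_le_of_eq_add_mul (f := f p)
    (h := fun z => ((p.2 : ℂ))⁻¹ * (f p z * ((p.2 : ℂ) - q p.1 z)))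
    (e := fun z => ((p.2 : ℂ))⁻¹ * q p.1 z) (z := z) (i := i) (B := C * w p) (hf p)
    (contDiff_const.mul (h.1 p)) (contDiff_const.mul hqs)
    (by intro z; field_simp; ring)
    (by
      intro l hl
      rw [hscale _ (h.1 p)]
      calc _ ≤ |p.2|⁻¹ * (C * (w p * |p.2|)) :=
            mul_le_mul_of_nonneg_left (hCT l hl p hp1 z hz) (by positivity)
        _ = C * w p := by field_simp)
    (by
      intro l hl
      rw [hscale _ hqs]
      have h1 := hD l hl p.1 z hz
      rw [inv_mul_le_iff₀ hη]
      refine h1.trans ?_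
      calc D * Λ p.1 = (D * 2 ^ (i + 1) * Λ p.1) * (1 / 2) ^ (i + 1) := by
            rw [one_div, inv_pow]; field_simp
        _ ≤ _ := mul_le_mul_of_nonneg_right hp2 (by positivity)) (le_refl i)
  linarith

theorem LargeDerivBound.of_mul_prod (hΛ : ∀ ξ, 1 ≤ Λ ξ) {J : Type*} (s : Finset J)
    {q : J → X → E → ℂ} (hq : ∀ j ∈ s, DerivBound K Set.univ Λ (q j)) {w : X × ℝ → ℝ}
    (hw : ∀ p, 0 ≤ w p) {f : X × ℝ → E → ℂ} (hf : ∀ p, ContDiff ℝ ∞ (f p))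
    (h : LargeDerivBound K Λ (fun p => w p * |p.2| ^ s.card)
      (fun p z => f p z * ∏ j ∈ s, ((p.2 : ℂ) - q j p.1 z))) :
    LargeDerivBound K Λ w f := by
  classical
  induction s using Finset.induction_on generalizing f w with
  | empty => simpa using h
  | insert j s hj ih =>
    have hs : ∀ l ∈ s, DerivBound K Set.univ Λ (q l) :=
      fun l hl => hq l (Finset.mem_insert_of_mem hl)
    refine ih hs hw hf (LargeDerivBound.of_mul_sub (q := q j) hΛ
      (fun p => mul_nonneg (hw p) (by positivity)) (fun p => (hf p).mul
        (contDiff_prod fun l hl => contDiff_const.sub ((hs l hl).1 _)))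
      (hq j (Finset.mem_insert_self _ _)) ?_)
    simp only [Finset.card_insert_of_notMem hj, Finset.prod_insert hj] at h
    have e1 : (fun p : X × ℝ => w p * |p.2| ^ (s.card + 1))
        = fun p => w p * |p.2| ^ s.card * |p.2| := by funext p; ring
    have e2 : (fun (p : X × ℝ) z => f p z * (((p.2 : ℂ) - q j p.1 z) *
        ∏ l ∈ s, ((p.2 : ℂ) - q l p.1 z)))
        = fun p z => f p z * (∏ l ∈ s, ((p.2 : ℂ) - q l p.1 z)) * ((p.2 : ℂ) - q j p.1 z) := by
      funext p z; ring
    rwa [e1, e2] at h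

end Rational

/-! ### Rational symbols: numerator coefficients, uniform bounds, expansion in powers of `(η -
iΛ)⁻¹` -/

section RationalSymbol

variable {X E : Type*} {N : ℕ}

/-- The coefficient of `η ^ l` in the polynomial `a ∏ (η - q_i)`, by Lagrange interpolation. -/
def numeratorCoeff (Λ : X → ℝ) (q : Fin N → X → E → ℂ) (a : X × ℝ → E → ℂ) (l : ℕ) (ξ : X)
    (z : E) : ℂ :=
  ((Λ ξ : ℂ) ^ l)⁻¹ * ∑ i ∈ Finset.range N,
    (Lagrange.basis (Finset.range N) (fun i : ℕ => (i : ℂ)) i).coeff l *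
      (a (ξ, Λ ξ * i) z * ∏ m, (((Λ ξ * i : ℝ) : ℂ) - q m ξ z))

variable {K : Set E} {Λ : X → ℝ} {q : Fin N → X → E → ℂ} {κ : ℝ} {a : X × ℝ → E → ℂ}

/-- The rescaled polynomial `P(Λ X)` has degree less than `N`, so its values at `0, …, N - 1`
determine it. Its coefficients thus inherit smoothness and bounds from `a` at the sample points `η =
Λ i`. -/
theorem coeff_eq_numeratorCoeff {ξ : X} {z : E} (hΛ : Λ ξ ≠ 0) {P : Polynomial ℂ}
    (hd : P.degree < N)
    (hP : ∀ η : ℝ, a (ξ, η) z * ∏ m, ((η : ℂ) - q m ξ z) = P.eval (η : ℂ)) (l : ℕ) :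
    P.coeff l = numeratorCoeff Λ q a l ξ z := by
  have hΛ' : (Λ ξ : ℂ) ≠ 0 := by exact_mod_cast hΛ
  set R : Polynomial ℂ := P.comp (Polynomial.C (Λ ξ : ℂ) * Polynomial.X) with hR
  have hcoeff : ∀ l, R.coeff l = P.coeff l * (Λ ξ : ℂ) ^ l := fun l =>
    Polynomial.comp_C_mul_X_coeff
  have hRd : R.degree < (Finset.range N).card := by
    rw [Finset.card_range, Polynomial.degree_lt_iff_coeff_zero]
    intro m hm
    rw [hcoeff, (Polynomial.degree_lt_iff_coeff_zero _ _).1 hd m hm, zero_mul]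
  have hinj : Set.InjOn (fun i : ℕ => (i : ℂ)) (Finset.range N : Set ℕ) :=
    Nat.cast_injective.injOn
  have hint := Lagrange.eq_interpolate_of_eval_eq (r := fun i : ℕ =>
    a (ξ, Λ ξ * i) z * ∏ m, (((Λ ξ * i : ℝ) : ℂ) - q m ξ z)) hinj hRd (by
      intro i _
      rw [hP, hR]
      simp)
  have h2 := hcoeff l
  rw [hint, Lagrange.interpolate_apply, Polynomial.finsetSum_coeff] at h2
  simp only [Polynomial.coeff_C_mul] at h2
  rw [numeratorCoeff]
  rw [eq_inv_mul_iff_mul_eq₀ (pow_ne_zero _ hΛ'), mul_comm, ← h2]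
  exact Finset.sum_congr rfl fun i _ => mul_comm _ _

variable [TopologicalSpace X] [NormedAddCommGroup E] [NormedSpace ℝ E]

/-- Symbols of order `κ` (with respect to the weight `Λ` of the tangential frequency) whose product
with `∏ (η - q_i)` is a polynomial of degree less than `N` in the normal frequency `η`; the bounds
are required for `|η| ≤ T Λ` only. -/
structure IsRationalSymbol (K : Set E) (Λ : X → ℝ) (q : Fin N → X → E → ℂ) (κ : ℝ)
    (a : X × ℝ → E → ℂ) : Prop where
  bound : ∀ T : ℝ, DerivBound K {p | |p.2| ≤ T * Λ p.1} (fun p => Λ p.1 ^ κ) a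
  poly : ∀ ξ z, ∃ P : Polynomial ℂ, P.degree < N ∧
    ∀ η : ℝ, a (ξ, η) z * ∏ m, ((η : ℂ) - q m ξ z) = P.eval (η : ℂ)
  cont : Continuous fun x : (X × ℝ) × E => a x.1 x.2

theorem IsRationalSymbol.eq_sum (ha : IsRationalSymbol K Λ q κ a) (hΛ : ∀ ξ, 1 ≤ Λ ξ) (ξ : X)
    (z : E) (η : ℝ) : a (ξ, η) z * ∏ m, ((η : ℂ) - q m ξ z)
      = ∑ l ∈ Finset.range N, numeratorCoeff Λ q a l ξ z * (η : ℂ) ^ l := by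
  obtain ⟨P, hd, hP⟩ := ha.poly ξ z
  rw [hP]
  have hΛ0 : Λ ξ ≠ 0 := (zero_lt_one.trans_le (hΛ ξ)).ne'
  -- The sum is taken one term too far because `natDegree < N` fails for `N = 0`; the extra
  -- coefficient vanishes.
  rw [Polynomial.eval_eq_sum_range' (n := N + 1)
    (Nat.lt_succ_of_le (Polynomial.natDegree_le_of_degree_le hd.le)), Finset.sum_range_succ,
    (Polynomial.degree_lt_iff_coeff_zero _ _).1 hd N le_rfl, zero_mul, add_zero]
  exact Finset.sum_congr rfl fun l _ => by rw [coeff_eq_numeratorCoeff hΛ0 hd hP]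

/-- The samples lie in `|η| ≤ i Λ`, where `a` has order `κ`; the `N` factors `η - q_m` contribute
order `N`, and the rescaling removes order `l`. -/
theorem IsRationalSymbol.derivBound_numeratorCoeff (ha : IsRationalSymbol K Λ q κ a)
    (hΛ : ∀ ξ, 1 ≤ Λ ξ) (hq : ∀ m, DerivBound K Set.univ Λ (q m)) (l : ℕ) :
    DerivBound K Set.univ (fun ξ => Λ ξ ^ (κ + N - l)) (numeratorCoeff Λ q a l) := by
  have hΛ0 : ∀ ξ, 0 < Λ ξ := fun ξ => zero_lt_one.trans_le (hΛ ξ)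
  have h1 : ∀ i ∈ Finset.range N, DerivBound K Set.univ (fun ξ => Λ ξ ^ (κ + N)) fun ξ z =>
      (Lagrange.basis (Finset.range N) (fun i : ℕ => (i : ℂ)) i).coeff l *
      (a (ξ, Λ ξ * i) z * ∏ m, (((Λ ξ * i : ℝ) : ℂ) - q m ξ z)) := by
    intro i _
    have ha' : DerivBound K Set.univ (fun ξ => Λ ξ ^ κ) fun ξ z => a (ξ, Λ ξ * i) z :=
      (ha.bound i).comp_param (fun ξ : X => (ξ, Λ ξ * i)) (by
        intro ξ _
        simp only [Set.mem_ofPred_eq, abs_mul, abs_of_pos (hΛ0 ξ), Nat.abs_cast]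
        exact (mul_comm _ _).le)
    have hp := DerivBound.prod (K := K) (S := Set.univ) (w := Λ) Finset.univ
      (F := fun (m : Fin N) (ξ : X) (z : E) => ((Λ ξ * i : ℝ) : ℂ) - q m ξ z) (by
        intro m _
        have hneg : DerivBound K Set.univ Λ fun ξ z => (-1 : ℂ) * q m ξ z :=
          ((DerivBound.const (K := K) (S := Set.univ) (w := fun _ : X => (1 : ℝ))
            (c := fun _ => (-1 : ℂ)) (A := 1) (by simp)).mul (hq m)).mono (A := 1) subset_rfl
            (fun p _ => by simpa using (hΛ0 p).le) (fun p _ => by simp)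
        have hc : DerivBound K Set.univ Λ fun (ξ : X) (_ : E) => ((Λ ξ * i : ℝ) : ℂ) :=
          DerivBound.const (A := i) (by
            intro ξ _
            rw [Complex.norm_real, norm_mul, Real.norm_of_nonneg (hΛ0 ξ).le]
            simp [mul_comm])
        simpa [sub_eq_add_neg] using hc.add hneg)
    have hb := (DerivBound.const (K := K) (S := Set.univ) (w := fun _ : X => (1 : ℝ))
      (c := fun _ => (Lagrange.basis (Finset.range N) (fun i : ℕ => (i : ℂ)) i).coeff l)
      (A := ‖(Lagrange.basis (Finset.range N) (fun i : ℕ => (i : ℂ)) i).coeff l‖)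
      (by simp)).mul (ha'.mul hp)
    refine hb.mono (A := 1) subset_rfl (fun ξ _ => ?_) fun ξ _ => ?_
    · have := hΛ0 ξ; positivity
    · rw [Real.rpow_add (hΛ0 ξ), Real.rpow_natCast]
      simp
  have h2 := (DerivBound.const (K := K) (S := Set.univ) (w := fun ξ : X => Λ ξ ^ (-(l : ℝ)))
    (c := fun ξ => ((Λ ξ : ℂ) ^ l)⁻¹) (A := 1) (by
      intro ξ _
      rw [Real.rpow_neg (hΛ0 ξ).le, Real.rpow_natCast]
      simp [abs_of_pos (hΛ0 ξ)])).mul (DerivBound.sum (Finset.range N) h1)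
  refine h2.mono (A := 1) subset_rfl (fun ξ _ => ?_) fun ξ _ => ?_
  · have := hΛ0 ξ; positivity
  · rw [one_mul, ← Real.rpow_add (hΛ0 ξ)]
    exact (congrArg _ (by ring)).le

theorem IsRationalSymbol.continuous_numeratorCoeff (ha : IsRationalSymbol K Λ q κ a)
    (hΛ : ∀ ξ, 1 ≤ Λ ξ) (hΛc : Continuous Λ)
    (hqc : ∀ m, Continuous fun x : X × E => q m x.1 x.2) (l : ℕ) :
    Continuous fun x : X × E => numeratorCoeff Λ q a l x.1 x.2 := by
  have hc : Continuous fun x : X × E => (Λ x.1 : ℂ) := by fun_prop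
  have hai : ∀ i : ℕ, Continuous fun x : X × E => a (x.1, Λ x.1 * i) x.2 := fun i =>
    ha.cont.comp (f := fun x : X × E => ((x.1, Λ x.1 * i), x.2)) (by fun_prop)
  unfold numeratorCoeff
  refine ((hc.pow l).inv₀ fun x => pow_ne_zero _ ?_).mul (continuous_finsetSum _ fun i _ =>
    continuous_const.mul ((hai i).mul (continuous_finsetProd _ fun m _ =>
      Continuous.sub (by fun_prop) (hqc m))))
  have := (zero_lt_one.trans_le (hΛ x.1)).ne'
  exact Complex.ofReal_ne_zero.2 this

/-- The bounds on a rational symbol for `|η| ≤ T Λ` imply the same bound for all `η`. -/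
theorem IsRationalSymbol.derivBound_univ (ha : IsRationalSymbol K Λ q κ a) (hΛ : ∀ ξ, 1 ≤ Λ ξ)
    (hq : ∀ m, DerivBound K Set.univ Λ (q m)) :
    DerivBound K Set.univ (fun p : X × ℝ => Λ p.1 ^ κ) a := by
  have hΛ0 : ∀ ξ, 0 < Λ ξ := fun ξ => zero_lt_one.trans_le (hΛ ξ)
  have hs : ∀ p, ContDiff ℝ ∞ (a p) := (ha.bound 0).1
  have hlarge : LargeDerivBound K Λ (fun p => Λ p.1 ^ κ) a := by
    refine LargeDerivBound.of_mul_prod hΛ Finset.univ (fun m _ => hq m)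
      (fun p => (Real.rpow_pos_of_pos (hΛ0 _) _).le) hs ⟨fun p => (hs p).mul
        (contDiff_prod fun l _ => contDiff_const.sub ((hq l).1 _)), fun i => ?_⟩
    -- For `|η| ≥ Λ` each monomial obeys `Λ^{N-l} |η|^l ≤ |η|^N`, so the numerator is `O(Λ^κ
    -- |η|^N)`; dividing by the `N` linear factors costs exactly `|η|^N`.
    have hsum : DerivBound K {p : X × ℝ | Λ p.1 ≤ |p.2|}
        (fun p => Λ p.1 ^ κ * |p.2| ^ (Finset.univ : Finset (Fin N)).card)
        (fun p z => a p z * ∏ m, ((p.2 : ℂ) - q m p.1 z)) := by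
      have : (fun (p : X × ℝ) z => a p z * ∏ m, ((p.2 : ℂ) - q m p.1 z)) = fun p z =>
          ∑ l ∈ Finset.range N, numeratorCoeff Λ q a l p.1 z * (p.2 : ℂ) ^ l := by
        ext p z
        exact ha.eq_sum hΛ p.1 z p.2
      rw [this]
      refine DerivBound.sum _ fun l hl => ?_
      have hl' : l ≤ N := (Finset.mem_range.1 hl).le
      have h1 := (((ha.derivBound_numeratorCoeff hΛ hq l).comp_param
        (fun p : X × ℝ => p.1) (S' := {p : X × ℝ | Λ p.1 ≤ |p.2|}) (fun _ _ => trivial)).mul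
        (DerivBound.const (K := K) (w := fun p : X × ℝ => |p.2| ^ l)
          (c := fun p : X × ℝ => (p.2 : ℂ) ^ l) (A := 1) (by intro p _; simp)))
      refine h1.mono (A := 1) subset_rfl (fun p _ => ?_) fun p hp => ?_
      · have := hΛ0 p.1; positivity
      · have hp' : Λ p.1 ≤ |p.2| := hp
        rw [one_mul, Finset.card_univ, Fintype.card_fin]
        have e1 : Λ p.1 ^ (κ + N - l) = Λ p.1 ^ κ * Λ p.1 ^ (N - l) := by
          rw [← Real.rpow_natCast _ (N - l), ← Real.rpow_add (hΛ0 _), Nat.cast_sub hl']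
          congr 1; ring
        rw [e1, mul_assoc]
        refine mul_le_mul_of_nonneg_left ?_ (Real.rpow_pos_of_pos (hΛ0 _) _).le
        calc Λ p.1 ^ (N - l) * |p.2| ^ l ≤ |p.2| ^ (N - l) * |p.2| ^ l := by
              gcongr; exact (hΛ0 _).le
          _ = |p.2| ^ N := by rw [← pow_add]; congr 1; omega
    obtain ⟨C, hC⟩ := hsum.2 i
    exact ⟨C, 1, fun p hp z hz => hC p (by simpa using hp) z hz⟩
  refine ⟨hs, fun i => ?_⟩
  -- The threshold `T` depends on the order of the derivative; the hypothesis for bounded `η / Λ` is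
  -- available for every `T` and covers the rest.
  obtain ⟨C, T, hCT⟩ := hlarge.2 i
  obtain ⟨D, hD⟩ := (ha.bound T).2 i
  refine ⟨max C D, fun p _ z hz => ?_⟩
  have hw : 0 ≤ Λ p.1 ^ κ := (Real.rpow_pos_of_pos (hΛ0 _) _).le
  rcases le_total (T * Λ p.1) |p.2| with h | h
  · exact (hCT p h z hz).trans (mul_le_mul_of_nonneg_right (le_max_left _ _) hw)
  · exact (hD p h z hz).trans (mul_le_mul_of_nonneg_right (le_max_right _ _) hw)

/-- The leading numerator coefficient, the limit of `η a` as `η → ∞`. -/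
def leadCoeff (Λ : X → ℝ) (q : Fin N → X → E → ℂ) (a : X × ℝ → E → ℂ) : X → E → ℂ :=
  numeratorCoeff Λ q a (N - 1)

/-- The numerator of the remainder in `a = (leadCoeff + remainder) / (η - i Λ)`. -/
def expansionRemainder (Λ : X → ℝ) (q : Fin N → X → E → ℂ) (a : X × ℝ → E → ℂ) (p : X × ℝ)
    (z : E) : ℂ :=
  ((p.2 : ℂ) - Complex.I * Λ p.1) * a p z - leadCoeff Λ q a p.1 z

theorem IsRationalSymbol.derivBound_leadCoeff (ha : IsRationalSymbol K Λ q κ a)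
    (hΛ : ∀ ξ, 1 ≤ Λ ξ) (hq : ∀ m, DerivBound K Set.univ Λ (q m)) :
    DerivBound K Set.univ (fun ξ => Λ ξ ^ (κ + 1)) (leadCoeff Λ q a) := by
  have hΛ0 : ∀ ξ, 0 < Λ ξ := fun ξ => zero_lt_one.trans_le (hΛ ξ)
  refine (ha.derivBound_numeratorCoeff hΛ hq (N - 1)).mono (A := 1) subset_rfl
    (fun ξ _ => (Real.rpow_pos_of_pos (hΛ0 _) _).le) fun ξ _ => ?_
  rw [one_mul]
  -- Truncated subtraction: for `N = 0` the exponent on the left is only `κ`, so an inequality with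
  -- `Λ ≥ 1` replaces equality of exponents.
  refine Real.rpow_le_rpow_of_exponent_le (hΛ ξ) ?_
  have h : N ≤ (N - 1) + 1 := by omega
  have h' : (N : ℝ) ≤ ((N - 1 : ℕ) : ℝ) + 1 := by exact_mod_cast h
  linarith

/-- With `Q = ∏ (X - q_m)`, the new numerator is `(X - iΛ) P - P_{N-1} Q`. As `Q` is monic, the
terms of degree `N` cancel, so the class is preserved with the same denominators and the order rises
by one. -/
theorem IsRationalSymbol.expansionRemainder (ha : IsRationalSymbol K Λ q κ a)
    (hΛ : ∀ ξ, 1 ≤ Λ ξ) (hΛc : Continuous Λ) (hq : ∀ m, DerivBound K Set.univ Λ (q m))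
    (hqc : ∀ m, Continuous fun x : X × E => q m x.1 x.2) :
    IsRationalSymbol K Λ q (κ + 1) (expansionRemainder Λ q a) := by
  have hΛ0 : ∀ ξ, 0 < Λ ξ := fun ξ => zero_lt_one.trans_le (hΛ ξ)
  refine ⟨fun T => ?_, fun ξ z => ?_, ?_⟩
  · have h1 : DerivBound K {p : X × ℝ | |p.2| ≤ T * Λ p.1} (fun p => Λ p.1)
        (fun p _ => (p.2 : ℂ) - Complex.I * Λ p.1) := by
      refine DerivBound.const (A := T + 1) fun p hp => ?_
      refine (norm_sub_le _ _).trans ?_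
      have hp' : |p.2| ≤ T * Λ p.1 := hp
      simp only [Complex.norm_real, Real.norm_eq_abs, norm_mul, Complex.norm_I, one_mul,
        abs_of_pos (hΛ0 p.1)]
      linarith
    have h2 := (h1.mul (ha.bound T)).mono (A := 1) (w' := fun p => Λ p.1 ^ (κ + 1)) subset_rfl
      (fun p _ => by have := hΛ0 p.1; positivity)
      (fun p _ => by rw [Real.rpow_add (hΛ0 _), Real.rpow_one, one_mul, mul_comm])
    have h3 := ((DerivBound.const (K := K) (S := {p : X × ℝ | |p.2| ≤ T * Λ p.1})
      (w := fun _ => (1 : ℝ)) (c := fun _ => (-1 : ℂ)) (A := 1) (by simp)).mul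
        ((ha.derivBound_leadCoeff hΛ hq).comp_param (fun p : X × ℝ => p.1)
        (S' := {p : X × ℝ | |p.2| ≤ T * Λ p.1}) (fun _ _ => trivial)))
    simp only [one_mul, neg_mul] at h3
    unfold _root_.expansionRemainder
    simpa only [sub_eq_add_neg] using h2.add h3
  · obtain ⟨P, hd, hP⟩ := ha.poly ξ z
    set Q : Polynomial ℂ := ∏ m, (Polynomial.X - Polynomial.C (q m ξ z)) with hQ
    have hQm : Q.Monic := Polynomial.monic_prod_of_monic _ _ fun m _ =>
      Polynomial.monic_X_sub_C _
    have hQd : Q.natDegree = N := by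
      rw [hQ, Polynomial.natDegree_prod_of_monic _ _ fun m _ => Polynomial.monic_X_sub_C _]
      simp
    have hc : leadCoeff Λ q a ξ z = P.coeff (N - 1) :=
      (coeff_eq_numeratorCoeff (hΛ0 ξ).ne' hd hP _).symm
    refine ⟨(Polynomial.X - Polynomial.C (Complex.I * Λ ξ)) * P
      - Polynomial.C (P.coeff (N - 1)) * Q, ?_, fun η => ?_⟩
    · have hPc := (Polynomial.degree_lt_iff_coeff_zero _ _).1 hd
      rcases Nat.eq_zero_or_pos N with hN | hN
      · have : P = 0 := by
          ext l
          rw [hPc l (by omega)]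
          simp
        rw [this]
        simp
      · rw [Polynomial.degree_lt_iff_coeff_zero]
        intro m hm
        rw [Polynomial.coeff_sub, sub_mul, Polynomial.coeff_sub, Polynomial.coeff_C_mul,
          Polynomial.coeff_C_mul, hPc m hm]
        obtain ⟨m, rfl⟩ : ∃ m', m = m' + 1 := ⟨m - 1, by omega⟩
        rw [Polynomial.coeff_X_mul]
        rcases hm.eq_or_lt with h | h
        · have : Q.coeff (m + 1) = 1 := by rw [← h, ← hQd]; exact hQm
          rw [this, h]
          simp
        · rw [hPc m (by omega), Polynomial.coeff_eq_zero_of_natDegree_lt (by omega : _ < m + 1)]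
          simp
    · have hQe : Q.eval (η : ℂ) = ∏ m, ((η : ℂ) - q m ξ z) := by
        rw [hQ, Polynomial.eval_prod]
        simp
      simp only [Polynomial.eval_sub, Polynomial.eval_mul, Polynomial.eval_X, Polynomial.eval_C,
        ← hP, hQe, _root_.expansionRemainder, hc]
      ring
  · have h := ha.continuous_numeratorCoeff hΛ hΛc hqc (N - 1)
    have h2 := h.comp (f := fun x : (X × ℝ) × E => (x.1.1, x.2)) (by fun_prop)
    unfold _root_.expansionRemainder
    refine Continuous.sub (Continuous.mul (by fun_prop) ha.cont) h2

/-- Finite expansion of a rational symbol in powers of `(η - i Λ)⁻¹`. -/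
theorem IsRationalSymbol.exists_expansion (ha : IsRationalSymbol K Λ q κ a)
    (hΛ : ∀ ξ, 1 ≤ Λ ξ) (hΛc : Continuous Λ) (hq : ∀ m, DerivBound K Set.univ Λ (q m))
    (hqc : ∀ m, Continuous fun x : X × E => q m x.1 x.2) (m : ℕ) :
    ∃ (c : ℕ → X → E → ℂ) (r : X × ℝ → E → ℂ),
      (∀ j : ℕ, DerivBound K Set.univ (fun ξ => Λ ξ ^ (κ + (j + 1))) (c j)) ∧
      (∀ j, Continuous fun x : X × E => c j x.1 x.2) ∧
      DerivBound K Set.univ (fun p : X × ℝ => Λ p.1 ^ (κ + m)) r ∧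
      (Continuous fun x : (X × ℝ) × E => r x.1 x.2) ∧
      ∀ (p : X × ℝ) z, a p z
        = ∑ j ∈ Finset.range m, (((p.2 : ℂ) - Complex.I * Λ p.1) ^ (j + 1))⁻¹ * c j p.1 z
          + (((p.2 : ℂ) - Complex.I * Λ p.1) ^ m)⁻¹ * r p z := by
  -- Iterating the remainder unrolls the identity `A j = (η - iΛ)⁻¹ (leadCoeff (A j) + A (j + 1))`.
  set A : ℕ → X × ℝ → E → ℂ := fun j => (_root_.expansionRemainder Λ q)^[j] a with hA
  have hAs : ∀ j, A (j + 1) = _root_.expansionRemainder Λ q (A j) := fun j =>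
    Function.iterate_succ_apply' _ _ _
  have hAr : ∀ j : ℕ, IsRationalSymbol K Λ q (κ + j) (A j) := by
    intro j
    induction j with
    | zero => simpa [hA] using ha
    | succ j ih =>
      rw [hAs]
      have := ih.expansionRemainder hΛ hΛc hq hqc
      push_cast
      rwa [← add_assoc]
  refine ⟨fun j => leadCoeff Λ q (A j), A m, fun j => ?_, fun j =>
    (hAr j).continuous_numeratorCoeff hΛ hΛc hqc _, (hAr m).derivBound_univ hΛ hq, (hAr m).cont,
    fun p z => ?_⟩
  · have := (hAr j).derivBound_leadCoeff hΛ hq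
    rwa [add_assoc] at this
  · have hy : (p.2 : ℂ) - Complex.I * Λ p.1 ≠ 0 := by
      intro h
      have := congrArg Complex.im h
      simp at this
      exact (zero_lt_one.trans_le (hΛ p.1)).ne' this
    have hstep : ∀ j, A j p z = ((p.2 : ℂ) - Complex.I * Λ p.1)⁻¹
        * (leadCoeff Λ q (A j) p.1 z + A (j + 1) p z) := by
      intro j
      rw [hAs, _root_.expansionRemainder, eq_inv_mul_iff_mul_eq₀ hy]
      ring
    induction m with
    | zero => simp [hA]
    | succ m ih =>
      rw [ih, hstep m, Finset.sum_range_succ, pow_succ, mul_inv]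
      ring

end RationalSymbol

/-! ### Rational functions with prescribed poles -/

/-- An entire function of polynomial growth is a polynomial. -/
theorem exists_polynomial_of_entire {F : ℂ → ℂ} (hF : Differentiable ℂ F) {C R₀ : ℝ} {n : ℕ}
    (hb : ∀ w, R₀ ≤ ‖w‖ → ‖F w‖ ≤ C * ‖w‖ ^ n) : ∃ P : Polynomial ℂ, ∀ w, F w = P.eval w := by
  -- Cauchy's estimates on circles of radius `R → ∞` kill the Taylor coefficients beyond order `n`.
  have hz : ∀ l, n < l → iteratedDeriv l F 0 = 0 := by
    intro l hl
    have h1 : ∀ R : ℝ, 0 < R → R₀ ≤ R →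
        ‖iteratedDeriv l F 0‖ ≤ l.factorial * C * (R ^ (l - n))⁻¹ := by
      intro R hR hR0
      have := Complex.norm_iteratedDeriv_le_of_forall_mem_sphere_norm_le (f := F) (c := 0)
        (C := C * R ^ n) l hR hF.diffContOnCl (by
          intro z hz
          rw [mem_sphere_zero_iff_norm] at hz
          rw [← hz]
          exact hb z (by rw [hz]; exact hR0))
      refine this.trans_eq ?_
      have e : R ^ l = R ^ n * R ^ (l - n) := by rw [← pow_add]; congr 1; omega
      rw [e]
      field_simp
    have h2 : Tendsto (fun R : ℝ => l.factorial * C * (R ^ (l - n))⁻¹) atTop (𝓝 0) := by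
      have := (tendsto_inv_atTop_zero.comp (tendsto_pow_atTop (α := ℝ) (n := l - n)
        (by omega))).const_mul (l.factorial * C)
      simpa using this
    have h3 : ‖iteratedDeriv l F 0‖ ≤ 0 := ge_of_tendsto h2 (by
      filter_upwards [eventually_gt_atTop 0, eventually_ge_atTop R₀] with R h h'
      exact h1 R h h')
    exact norm_le_zero_iff.1 h3
  refine ⟨∑ l ∈ Finset.range (n + 1),
    Polynomial.C ((l.factorial : ℂ)⁻¹ * iteratedDeriv l F 0) * Polynomial.X ^ l, fun w => ?_⟩
  rw [← Complex.taylorSeries_eq_of_entire' (c := 0) (z := w) hF, Polynomial.eval_finsetSum,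
    tsum_eq_sum (s := Finset.range (n + 1))]
  · simp
  · intro l hl
    rw [hz l (by simpa using hl)]
    simp

/-- A polynomial that is `o(η ^ N)` on the real axis has degree less than `N`. -/
theorem degree_lt_of_tendsto_zero {P : Polynomial ℂ} {N : ℕ}
    (h : Tendsto (fun η : ℝ => ((η : ℂ) ^ N)⁻¹ * P.eval (η : ℂ)) atTop (𝓝 0)) : P.degree < N := by
  by_contra hd
  rw [not_lt] at hd
  have hP : P ≠ 0 := by rintro rfl; simp at hd
  have hN : N ≤ P.natDegree := Polynomial.le_natDegree_of_coe_le_degree hd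
  have hinv : Tendsto (fun η : ℝ => ((η : ℂ))⁻¹) atTop (𝓝 0) := by
    have := (Complex.continuous_ofReal.tendsto 0).comp (tendsto_inv_atTop_zero (𝕜 := ℝ))
    simpa [Function.comp_def] using this
  -- The reversed polynomial at `η⁻¹` equals `η^{-deg P} P(η)`. It tends to the leading coefficient,
  -- yet to `0` by hypothesis when `N ≤ deg P`.
  have h1 : Tendsto (fun η : ℝ => P.reverse.eval ((η : ℂ))⁻¹) atTop (𝓝 (P.reverse.eval 0)) :=
    (P.reverse.continuous.tendsto 0).comp hinv
  have h2 : Tendsto (fun η : ℝ => ((η : ℂ))⁻¹ ^ (P.natDegree - N) *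
      (((η : ℂ) ^ N)⁻¹ * P.eval (η : ℂ))) atTop (𝓝 (0 ^ (P.natDegree - N) * 0)) :=
    (hinv.pow _).mul h
  have h3 : P.reverse.eval 0 = 0 ^ (P.natDegree - N) * 0 := by
    refine tendsto_nhds_unique h1 (h2.congr' ?_)
    filter_upwards [eventually_gt_atTop 0] with η hη
    have hη' : (η : ℂ) ≠ 0 := by exact_mod_cast hη.ne'
    let := invertibleOfNonzero hη'
    have : P.reverse.eval (⅟(η : ℂ)) * (η : ℂ) ^ P.natDegree = P.eval (η : ℂ) :=
      Polynomial.eval₂_reverse_mul_pow (RingHom.id ℂ) ((η : ℂ)) P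
    rw [invOf_eq_inv] at this
    have e : (η : ℂ) ^ P.natDegree = (η : ℂ) ^ (P.natDegree - N) * (η : ℂ) ^ N := by
      rw [← pow_add]; congr 1; omega
    rw [← this, e, inv_pow]
    set x := P.reverse.eval ((η : ℂ))⁻¹
    field_simp
  rw [mul_zero, ← Polynomial.coeff_zero_eq_eval_zero, Polynomial.coeff_zero_reverse] at h3
  exact hP (Polynomial.leadingCoeff_eq_zero.1 h3)

/-- The zeros of the product, counted with multiplicity, compensate the largest pole order allowed
at `c`. -/
theorem meromorphicOrderAt_mul_prod_nonneg {N : ℕ} {g : ℂ → ℂ} {q : Fin N → ℂ}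
    (h : IsMeromorphicWithPoles g q) (c : ℂ) :
    0 ≤ meromorphicOrderAt (fun w => g w * ∏ m, (w - q m)) c := by
  have h1 : ∀ m, meromorphicOrderAt (fun w => w - q m) c
      = ((if q m = c then 1 else 0 : ℤ) : WithTop ℤ) := by
    intro m
    split_ifs with hm
    · rw [← hm]; exact meromorphicOrderAt_id_sub_const
    · have ha : AnalyticAt ℂ (fun w => w - q m) c := by fun_prop
      rw [WithTop.coe_zero, ← tendsto_ne_zero_iff_meromorphicOrderAt_eq_zero ha.meromorphicAt]
      exact ⟨c - q m, sub_ne_zero.2 (Ne.symm hm),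
        ha.continuousAt.tendsto.mono_left nhdsWithin_le_nhds⟩
  have h2 : meromorphicOrderAt (fun w => ∏ m, (w - q m)) c
      = (((Finset.univ.filter fun i => q i = c).card : ℤ) : WithTop ℤ) := by
    rw [meromorphicOrderAt_fun_prod (fun m _ => by fun_prop), Finset.sum_congr rfl fun m _ => h1 m]
    rw [← WithTop.coe_sum, Finset.sum_boole]
  rw [fun_meromorphicOrderAt_mul (h.1 c) (by fun_prop), h2]
  calc (0 : WithTop ℤ) = ((-((Finset.univ.filter fun i => q i = c).card : ℤ) : ℤ) : WithTop ℤ)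
        + (((Finset.univ.filter fun i => q i = c).card : ℤ) : WithTop ℤ) := by
        rw [← WithTop.coe_add]; simp
    _ ≤ _ := by gcongr; exact h.2.2 c

/-- After multiplication by `∏ (w - q m)` all singularities are removable, so the normal form is
entire. A meromorphic singularity at infinity means polynomial growth, hence a polynomial; decay
along the real axis bounds its degree. A meromorphic function may carry arbitrary values at isolated
points, which is why continuity on the real axis is needed for equality there. -/
theorem IsMeromorphicWithPoles.exists_polynomial {N : ℕ} {g : ℂ → ℂ} {q : Fin N → ℂ}
    (h : IsMeromorphicWithPoles g q) (hc : Continuous fun η : ℝ => g η)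
    (h0 : Tendsto (fun η : ℝ => g η) atTop (𝓝 0)) :
    ∃ P : Polynomial ℂ, P.degree < N ∧ ∀ η : ℝ, g η * ∏ m, ((η : ℂ) - q m) = P.eval (η : ℂ) := by
  set f : ℂ → ℂ := fun w => g w * ∏ m, (w - q m) with hf
  have hfm : MeromorphicOn f Set.univ := fun w _ => (h.1 w).fun_mul (by fun_prop)
  set F := toMeromorphicNFOn f Set.univ with hFdef
  have hFa : ∀ w, AnalyticAt ℂ F w := by
    intro w
    rw [← (meromorphicNFOn_toMeromorphicNFOn f Set.univ
      (Set.mem_univ w)).meromorphicOrderAt_nonneg_iff_analyticAt,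
      meromorphicOrderAt_toMeromorphicNFOn hfm (Set.mem_univ w)]
    exact meromorphicOrderAt_mul_prod_nonneg h w
  have hFf : ∀ w, F =ᶠ[𝓝[≠] w] f := fun w =>
    hfm.toMeromorphicNFOn_eq_self_on_nhdsNE (Set.mem_univ w)
  have hFd : Differentiable ℂ F := fun w => (hFa w).differentiableAt
  have hinf : MeromorphicAt (fun w => f w⁻¹) 0 := by
    refine h.2.1.fun_mul ?_
    have hi : MeromorphicAt (fun w : ℂ => w⁻¹) 0 := (MeromorphicAt.id 0).inv
    fun_prop
  -- Near infinity `f` is analytic, so passing to the normal form changes no value there.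
  have hlarge : ∀ᶠ w in 𝓝[≠] (0 : ℂ), F w⁻¹ = f w⁻¹ := by
    filter_upwards [hinf.eventually_analyticAt, self_mem_nhdsWithin] with w hw hw0
    have hw0' : w ≠ 0 := hw0
    have h1 : ContinuousAt f w⁻¹ := by
      have h2 : ContinuousAt (fun v : ℂ => v⁻¹) w⁻¹ := continuousAt_inv₀ (inv_ne_zero hw0')
      have h3 : ContinuousAt (fun w => f w⁻¹) (w⁻¹)⁻¹ := by
        rw [inv_inv]; exact hw.continuousAt
      have h4 := ContinuousAt.comp (f := fun v : ℂ => v⁻¹) (x := w⁻¹) h3 h2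
      simpa [Function.comp_def] using h4
    exact ((hFa _).continuousAt.eventuallyEq_nhds_iff_eventuallyEq_nhdsNE h1).1
      (hFf _) |>.eq_of_nhds
  obtain ⟨n, hn⟩ := hinf
  have hbd : ∃ C R₀ : ℝ, ∀ w, R₀ ≤ ‖w‖ → ‖F w‖ ≤ C * ‖w‖ ^ n := by
    -- By meromorphy at infinity some `w ^ n * f w⁻¹` is analytic at `0`, hence bounded nearby: this
    -- is the growth bound of degree `n`.
    have h1 : ∀ᶠ w in 𝓝[≠] (0 : ℂ), ‖(w - 0) ^ n • f w⁻¹‖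
        ≤ ‖((0 : ℂ) - 0) ^ n • f (0 : ℂ)⁻¹‖ + 1 :=
      (hn.continuousAt.norm.eventually_le_const (lt_add_one _)).filter_mono nhdsWithin_le_nhds
    set C := ‖((0 : ℂ) - 0) ^ n • f (0 : ℂ)⁻¹‖ + 1
    obtain ⟨ε, hε, hε'⟩ := Metric.mem_nhdsWithin_iff.1 (h1.and hlarge)
    refine ⟨C, ε⁻¹ + 1, fun w hw => ?_⟩
    have hwpos : 0 < ‖w‖ := lt_of_lt_of_le (by positivity) hw
    have hw0 : w ≠ 0 := norm_pos_iff.1 hwpos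
    have hm : w⁻¹ ∈ Metric.ball (0 : ℂ) ε ∩ {0}ᶜ := by
      refine ⟨?_, by simpa using hw0⟩
      rw [mem_ball_zero_iff, norm_inv]
      exact inv_lt_of_inv_lt₀ hε (by linarith)
    obtain ⟨h2, h3⟩ := hε' hm
    rw [inv_inv] at h2 h3
    rw [h3]
    rw [sub_zero, norm_smul, norm_pow, norm_inv, inv_pow, inv_mul_le_iff₀ (by positivity)] at h2
    linarith
  obtain ⟨C, R₀, hC⟩ := hbd
  obtain ⟨P, hP⟩ := exists_polynomial_of_entire hFd hC
  have hreal : ∀ η : ℝ, f η = P.eval (η : ℂ) := by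
    intro η
    rw [← hP]
    have h1 : (fun η : ℝ => F η) =ᶠ[𝓝[≠] η] fun η => f η := by
      have : Tendsto (fun η : ℝ => (η : ℂ)) (𝓝[≠] η) (𝓝[≠] (η : ℂ)) :=
        Complex.continuous_ofReal.continuousAt.continuousWithinAt.tendsto_nhdsWithin
          fun x hx => by simpa using hx
      exact this.eventually (hFf η)
    have h2 : ContinuousAt (fun η : ℝ => F η) η :=
      (hFd.continuous.comp Complex.continuous_ofReal).continuousAt
    have h3 : ContinuousAt (fun η : ℝ => f η) η := by
      refine (hc.mul ?_).continuousAt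
      fun_prop
    exact ((h2.eventuallyEq_nhds_iff_eventuallyEq_nhdsNE h3).1 h1).eq_of_nhds.symm
  refine ⟨P, degree_lt_of_tendsto_zero ?_, hreal⟩
  have hinv : Tendsto (fun η : ℝ => ((η : ℂ))⁻¹) atTop (𝓝 0) := by
    have := (Complex.continuous_ofReal.tendsto 0).comp (tendsto_inv_atTop_zero (𝕜 := ℝ))
    simpa [Function.comp_def] using this
  have hp : Tendsto (fun η : ℝ => ∏ m : Fin N, (1 - q m * ((η : ℂ))⁻¹)) atTop (𝓝 1) := by
    have := tendsto_finsetProd (Finset.univ : Finset (Fin N)) fun m _ =>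
      (tendsto_const_nhds (x := (1 : ℂ))).sub (hinv.const_mul (q m))
    simpa using this
  have := h0.mul hp
  rw [zero_mul] at this
  refine this.congr' ?_
  filter_upwards [eventually_gt_atTop 0] with η hη
  have hη' : (η : ℂ) ≠ 0 := by exact_mod_cast hη.ne'
  rw [← hreal, hf]
  have : ∏ m : Fin N, ((η : ℂ) - q m) = (η : ℂ) ^ N * ∏ m : Fin N, (1 - q m * ((η : ℂ))⁻¹) := by
    have e : (η : ℂ) ^ N = ∏ _m : Fin N, (η : ℂ) := by simp
    rw [e, ← Finset.prod_mul_distrib]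
    refine Finset.prod_congr rfl fun m _ => ?_
    field_simp
  simp only [this]
  field_simp

/-! ### The Fourier transform on `L²` -/

section FourierL2

variable {V : Type*} [NormedAddCommGroup V] [InnerProductSpace ℝ V] [FiniteDimensional ℝ V]
  [MeasurableSpace V] [BorelSpace V]

theorem integral_fourier_mul_schwartz (F : Lp ℂ 2 (volume : Measure V)) (φ : SchwartzMap V ℂ) :
    ∫ x, (𝓕 F : Lp ℂ 2 (volume : Measure V)) x * φ x
      = ∫ x, F x * (𝓕 φ : SchwartzMap V ℂ) x := by
  have h := congrArg (fun T : TemperedDistribution V ℂ => T φ)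
    (Lp.fourier_toTemperedDistribution_eq F)
  simp only [TemperedDistribution.fourier_apply, Lp.toTemperedDistribution_apply,
    smul_eq_mul] at h
  simp only [mul_comm _ (φ _), mul_comm _ ((𝓕 φ : SchwartzMap V ℂ) _)]
  exact h.symm

theorem continuous_integral_Lp_mul {α : Type*} [MeasurableSpace α] {μ : Measure α}
    (G : Lp ℂ 2 μ) : Continuous fun F : Lp ℂ 2 μ => ∫ x, F x * G x ∂μ := by
  have h : (fun F : Lp ℂ 2 μ => ∫ x, F x * G x ∂μ)
      = fun F => inner ℂ ((Lp.memLp G).star.toLp _) F := by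
    funext F
    rw [L2.inner_def]
    refine integral_congr_ae ?_
    filter_upwards [(Lp.memLp G).star.coeFn_toLp] with x hx
    rw [hx]
    simp [RCLike.inner_apply]
  rw [h]
  fun_prop

/-- Both sides are continuous in `F` for the `L²` norm, so density reduces the claim to Schwartz
functions. -/
theorem integral_fourier_mul (F G : Lp ℂ 2 (volume : Measure V)) :
    ∫ x, (𝓕 F : Lp ℂ 2 (volume : Measure V)) x * G x
      = ∫ x, F x * (𝓕 G : Lp ℂ 2 (volume : Measure V)) x := by
  refine DenseRange.induction_on (p := fun F : Lp ℂ 2 (volume : Measure V) =>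
    ∫ x, (𝓕 F : Lp ℂ 2 (volume : Measure V)) x * G x
      = ∫ x, F x * (𝓕 G : Lp ℂ 2 (volume : Measure V)) x)
    (SchwartzMap.denseRange_toLpCLM (F := ℂ) (p := 2) (μ := (volume : Measure V))
      ENNReal.ofNat_ne_top) F ?_ ?_
  · exact isClosed_eq ((continuous_integral_Lp_mul G).comp
      (Lp.fourierTransformₗᵢ V ℂ).continuous) (continuous_integral_Lp_mul _)
  · intro f
    have h := integral_fourier_mul_schwartz G f
    have h1 : (𝓕 (SchwartzMap.toLpCLM ℝ ℂ 2 (volume : Measure V) f) :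
        Lp ℂ 2 (volume : Measure V)) = (𝓕 f : SchwartzMap V ℂ).toLp 2 :=
      SchwartzMap.toLp_fourier_eq f
    rw [h1]
    have e1 : ∫ x, ((𝓕 f : SchwartzMap V ℂ).toLp 2 : Lp ℂ 2 (volume : Measure V)) x * G x
        = ∫ x, G x * (𝓕 f : SchwartzMap V ℂ) x := by
      refine integral_congr_ae ?_
      filter_upwards [(𝓕 f : SchwartzMap V ℂ).coeFn_toLp 2 volume] with x hx
      rw [hx, mul_comm]
    have e2 : ∫ x, (SchwartzMap.toLpCLM ℝ ℂ 2 (volume : Measure V) f) x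
        * (𝓕 G : Lp ℂ 2 (volume : Measure V)) x
        = ∫ x, (𝓕 G : Lp ℂ 2 (volume : Measure V)) x * f x := by
      refine integral_congr_ae ?_
      filter_upwards [f.coeFn_toLp 2 volume] with x hx
      rw [mul_comm]
      congr 1
    rw [e1, e2, h]

theorem integral_fourier_mul_eq_of_integrable {f g : V → ℂ} (hf : Integrable f)
    (hg : Integrable g) : ∫ ξ, 𝓕 f ξ * g ξ = ∫ x, f x * 𝓕 g x := by
  have := VectorFourier.integral_fourierIntegral_smul_eq_flip (L := innerₗ V)
      Real.continuous_fourierChar continuous_inner hf hg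
  rw [flip_innerₗ] at this
  exact this

theorem continuous_fourier_of_integrable {f : V → ℂ} (hf : Integrable f) : Continuous (𝓕 f) :=
  VectorFourier.fourierIntegral_continuous Real.continuous_fourierChar
    (by exact continuous_inner) hf

theorem integral_fourier_toLp_mul_eq {f : V → ℂ} (hf : Integrable f) (hf2 : MemLp f 2)
    (φ : SchwartzMap V ℂ) :
    ∫ x, (𝓕 (hf2.toLp f) : Lp ℂ 2 (volume : Measure V)) x * φ x = ∫ x, 𝓕 f x * φ x := by
  rw [integral_fourier_mul_schwartz (hf2.toLp f) φ,
    integral_fourier_mul_eq_of_integrable hf (φ.integrable (μ := volume)), SchwartzMap.fourier_coe]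
  refine integral_congr_ae ?_
  filter_upwards [hf2.coeFn_toLp] with x hx
  rw [hx]

theorem ae_eq_of_integral_mul_schwartz_eq {f g : V → ℂ} (hf : LocallyIntegrable f volume)
    (hg : LocallyIntegrable g volume)
    (h : ∀ φ : SchwartzMap V ℂ, ∫ x, f x * φ x = ∫ x, g x * φ x) : f =ᵐ[volume] g := by
  have key : ∀ᵐ x, (f - g) x = 0 := by
    refine ae_eq_zero_of_integral_contDiff_smul_eq_zero (hf.sub hg) fun φ hφ hφc => ?_
    have h1 : HasCompactSupport (fun x => (φ x : ℂ)) :=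
      hφc.comp_left (g := fun r : ℝ => (r : ℂ)) Complex.ofReal_zero
    have h2 : ContDiff ℝ ∞ (fun x => (φ x : ℂ)) := Complex.ofRealCLM.contDiff.comp hφ
    have h3 : ∫ x, f x * (φ x : ℂ) = ∫ x, g x * (φ x : ℂ) := by
      have := h (h1.toSchwartzMap h2)
      simpa using this
    have i1 := hf.integrable_smul_left_of_hasCompactSupport hφ.continuous hφc
    have i2 := hg.integrable_smul_left_of_hasCompactSupport hφ.continuous hφc
    simp only [Pi.sub_apply, smul_sub]
    rw [integral_sub i1 i2, sub_eq_zero]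
    simp only [Complex.real_smul]
    simp only [mul_comm (f _), mul_comm (g _)] at h3
    exact h3
  filter_upwards [key] with x hx
  exact sub_eq_zero.1 hx

theorem fourier_toLp_ae_eq {f : V → ℂ} (hf : Integrable f) (hf2 : MemLp f 2) :
    (𝓕 (hf2.toLp f) : Lp ℂ 2 (volume : Measure V)) =ᵐ[volume] 𝓕 f :=
  ae_eq_of_integral_mul_schwartz_eq ((Lp.memLp _).locallyIntegrable (by norm_num))
    (continuous_fourier_of_integrable hf).locallyIntegrable
    (integral_fourier_toLp_mul_eq hf hf2)

end FourierL2

/-! ### Convolution estimates -/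

section Young

variable {V : Type*} [NormedAddCommGroup V] [InnerProductSpace ℝ V] [FiniteDimensional ℝ V]
  [MeasurableSpace V] [BorelSpace V]

theorem lintegral_mul_sq_le {α : Type*} [MeasurableSpace α] (μ : Measure α) {f g : α → ℝ≥0∞}
    (hf : AEMeasurable f μ) (hg : AEMeasurable g μ) :
    (∫⁻ x, f x * g x ∂μ) ^ 2 ≤ (∫⁻ x, f x ^ 2 ∂μ) * ∫⁻ x, g x ^ 2 ∂μ := by
  have h := ENNReal.lintegral_mul_le_Lp_mul_Lq μ Real.HolderConjugate.two_two hf hg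
  simp only [Pi.mul_apply, ENNReal.rpow_ofNat] at h
  calc _ ≤ ((∫⁻ x, f x ^ 2 ∂μ) ^ (1 / 2 : ℝ) * (∫⁻ x, g x ^ 2 ∂μ) ^ (1 / 2 : ℝ)) ^ 2 := by
        gcongr
    _ = _ := by
        rw [mul_pow, ← ENNReal.rpow_ofNat, ← ENNReal.rpow_ofNat, ← ENNReal.rpow_mul,
          ← ENNReal.rpow_mul]
        norm_num

/-- Young's inequality `‖κ * h‖₂ ≤ ‖κ‖₁ ‖h‖₂`. -/
theorem lintegral_convolution_sq_le {κ h : V → ℝ≥0∞} (hκ : Measurable κ) (hh : Measurable h) :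
    ∫⁻ x, (∫⁻ v, κ (x - v) * h v) ^ 2 ≤ (∫⁻ u, κ u) ^ 2 * ∫⁻ v, h v ^ 2 := by
  have h1 : ∀ x : V, (∫⁻ v, κ (x - v) * h v) ^ 2
      ≤ (∫⁻ u, κ u) * ∫⁻ v, κ (x - v) * h v ^ 2 := by
    intro x
    have hm : Measurable fun v => κ (x - v) := hκ.comp (measurable_const.sub measurable_id)
    have hs : ∀ a : ℝ≥0∞, a ^ (1 / 2 : ℝ) * a ^ (1 / 2 : ℝ) = a := by
      intro a
      rw [← ENNReal.rpow_add_of_nonneg _ _ (by norm_num) (by norm_num)]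
      norm_num
    -- Cauchy–Schwarz after splitting `κ = κ^{1/2} κ^{1/2}`, so that one factor integrates to
    -- `‖κ‖₁`.
    have := lintegral_mul_sq_le volume (f := fun v => κ (x - v) ^ (1 / 2 : ℝ))
      (g := fun v => κ (x - v) ^ (1 / 2 : ℝ) * h v) (hm.pow_const _).aemeasurable
      ((hm.pow_const _).mul hh).aemeasurable
    simp only [← mul_assoc, hs, mul_pow] at this
    simp only [sq, hs] at this ⊢
    rwa [lintegral_sub_left_eq_self (fun v => κ v) x] at this
  calc _ ≤ ∫⁻ x, (∫⁻ u, κ u) * ∫⁻ v, κ (x - v) * h v ^ 2 := lintegral_mono h1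
    _ = (∫⁻ u, κ u) * ∫⁻ x, ∫⁻ v, κ (x - v) * h v ^ 2 := by
        rw [lintegral_const_mul]
        refine Measurable.lintegral_prod_right' (f := fun p : V × V => κ (p.1 - p.2) * h p.2 ^ 2) ?_
        exact (hκ.comp (measurable_fst.sub measurable_snd)).mul
          ((hh.comp measurable_snd).pow_const _)
    _ = (∫⁻ u, κ u) * ∫⁻ v, ∫⁻ x, κ (x - v) * h v ^ 2 := by
        rw [lintegral_lintegral_swap]
        exact ((hκ.comp (measurable_fst.sub measurable_snd)).mul
          ((hh.comp measurable_snd).pow_const _)).aemeasurable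
    _ = (∫⁻ u, κ u) * ∫⁻ v, (∫⁻ u, κ u) * h v ^ 2 := by
        congr 1
        refine lintegral_congr fun v => ?_
        have hm : Measurable fun x => κ (x - v) := hκ.comp (measurable_id.sub measurable_const)
        rw [lintegral_mul_const _ hm]
        congr 1
        exact lintegral_sub_right_eq_self (fun u => κ u) v
    _ = _ := by
        rw [lintegral_const_mul _ (hh.pow_const _)]
        ring

end Young

/-! ### Boundedness of pseudodifferential operators with compactly supported symbols -/

section SobolevWeight

variable {V : Type*} [NormedAddCommGroup V] [InnerProductSpace ℝ V]

/-- Peetre's inequality for the Sobolev weight. -/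
theorem sobolevWeight_le (θ v : V) {s : ℝ} (hs : 0 ≤ s) {m : ℕ} (hm : s ≤ m) :
    (1 + ‖(2 * Real.pi) • θ‖ ^ 2) ^ (s / 2) ≤
      (2 * (2 * Real.pi) ^ 2) ^ (s / 2) * (1 + ‖θ - v‖) ^ m *
        (1 + ‖(2 * Real.pi) • v‖ ^ 2) ^ (s / 2) := by
  have hpi : (1 : ℝ) ≤ 2 * Real.pi := by linarith [Real.pi_gt_three]
  set u := ‖θ - v‖ with hu
  have hu0 : 0 ≤ u := norm_nonneg _
  have h1 : ‖θ‖ ≤ u + ‖v‖ := by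
    calc ‖θ‖ = ‖(θ - v) + v‖ := by rw [sub_add_cancel]
      _ ≤ _ := norm_add_le _ _
  have h2 : 1 + ‖(2 * Real.pi) • θ‖ ^ 2 ≤
      2 * (2 * Real.pi) ^ 2 * (1 + u) ^ 2 * (1 + ‖(2 * Real.pi) • v‖ ^ 2) := by
    rw [norm_smul, norm_smul, Real.norm_of_nonneg (by linarith)]
    set t := 2 * Real.pi
    have ht0 : 0 ≤ t := by linarith
    have e1 : (t * ‖θ‖) ^ 2 ≤ (t * u + t * ‖v‖) ^ 2 := by
      rw [← mul_add]
      gcongr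
    have e2 : 1 + (t * u) ^ 2 ≤ t ^ 2 * (1 + u) ^ 2 := by nlinarith
    have e3 : 0 ≤ (t * ‖v‖) ^ 2 := by positivity
    nlinarith [sq_nonneg (t * u - t * ‖v‖), mul_nonneg (sub_nonneg.2 e2) e3,
      mul_nonneg (sq_nonneg (t * u)) e3]
  calc _ ≤ (2 * (2 * Real.pi) ^ 2 * (1 + u) ^ 2 * (1 + ‖(2 * Real.pi) • v‖ ^ 2)) ^ (s / 2) := by
        gcongr
    _ = (2 * (2 * Real.pi) ^ 2) ^ (s / 2) * (1 + u) ^ s *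
          (1 + ‖(2 * Real.pi) • v‖ ^ 2) ^ (s / 2) := by
        rw [Real.mul_rpow (by positivity) (by positivity),
          Real.mul_rpow (by positivity) (by positivity)]
        congr 2
        rw [← Real.rpow_natCast, ← Real.rpow_mul (by positivity)]
        congr 1
        push_cast
        ring
    _ ≤ _ := by
        gcongr
        rw [← Real.rpow_natCast]
        exact Real.rpow_le_rpow_of_exponent_le (by linarith) hm

/-- The integrable weight `(1 + |u|)^{-(d+1)}`, `d` the dimension. -/
def decayKernel (u : V) : ℝ := (1 + ‖u‖) ^ (-((Module.finrank ℝ V : ℝ) + 1))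

theorem decayKernel_nonneg (u : V) : 0 ≤ decayKernel u := by
  unfold decayKernel; positivity

theorem measurable_decayKernel [MeasurableSpace V] [BorelSpace V] : Measurable (decayKernel : V → ℝ) := by
  unfold decayKernel
  exact (measurable_const.add measurable_norm).pow_const _

theorem one_le_sobolevWeight {s : ℝ} (hs : 0 ≤ s) (θ : V) :
    1 ≤ ENNReal.ofReal ((1 + ‖(2 * Real.pi) • θ‖ ^ 2) ^ (s / 2)) := by
  rw [ENNReal.one_le_ofReal]
  exact Real.one_le_rpow (by simp only [le_add_iff_nonneg_right]; positivity) (by positivity)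

theorem ofReal_sobolevWeight_sq (s : ℝ) (θ : V) :
    ENNReal.ofReal ((1 + ‖(2 * Real.pi) • θ‖ ^ 2) ^ (s / 2)) ^ 2
      = ENNReal.ofReal ((1 + ‖(2 * Real.pi) • θ‖ ^ 2) ^ s) := by
  rw [← ENNReal.ofReal_pow (by positivity), ← Real.rpow_natCast, ← Real.rpow_mul (by positivity)]
  congr 2
  push_cast
  ring

end SobolevWeight

section OperatorBound

variable {V : Type*} [NormedAddCommGroup V] [InnerProductSpace ℝ V] [FiniteDimensional ℝ V]
  [MeasurableSpace V] [BorelSpace V] {K : Set V} {w : V → ℝ} {b : V → V → ℂ}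

theorem iteratedFDeriv_eq_zero_of_notMem {E : Type*} [NormedAddCommGroup E] [NormedSpace ℝ E]
    {K : Set E} (hK : IsClosed K) {f : E → ℂ} (hf : ∀ z, z ∉ K → f z = 0) (i : ℕ) {z : E}
    (hz : z ∉ K) : iteratedFDeriv ℝ i f z = 0 := by
  have h1 : tsupport f ⊆ K :=
    closure_minimal (fun x hx => by by_contra h; exact hx (hf x h)) hK
  by_contra h
  exact hz (h1 (support_iteratedFDeriv_subset (𝕜 := ℝ) i h))

theorem integral_norm_iteratedFDeriv_le (hK : IsCompact K) {f : V → ℂ}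
    (hf : ∀ z, z ∉ K → f z = 0) {j : ℕ} {C : ℝ}
    (hC : ∀ z, ‖iteratedFDeriv ℝ j f z‖ ≤ C) :
    ∫ z, ‖iteratedFDeriv ℝ j f z‖ ≤ C * (volume : Measure V).real K := by
  have h0 : ∀ z, z ∉ K → ‖iteratedFDeriv ℝ j f z‖ = 0 := fun z hz => by
    rw [iteratedFDeriv_eq_zero_of_notMem hK.isClosed hf j hz, norm_zero]
  rw [← setIntegral_eq_integral_of_forall_compl_eq_zero h0]
  refine (le_abs_self _).trans ?_
  rw [← Real.norm_eq_abs]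
  exact norm_setIntegral_le_of_norm_le_const hK.measure_lt_top (fun z _ => by
    rw [norm_norm]; exact hC z)

/-- Decay in `θ` is paid for by `z`-derivatives; the common compact support turns sup bounds on them
into `L¹` bounds, linearly in the weight. -/
theorem pow_mul_norm_fourier_le (hb : DerivBound Set.univ Set.univ w b) (hK : IsCompact K)
    (hsupp : ∀ v z, z ∉ K → b v z = 0) (n : ℕ) :
    ∃ C : ℝ, ∀ v θ, ‖θ‖ ^ n * ‖𝓕 (b v) θ‖ ≤ C * w v := by
  choose C hC using hb.2
  refine ⟨2 ^ n * ∑ p ∈ Finset.range 1 ×ˢ Finset.range (n + 1),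
    C p.2 * (volume : Measure V).real K, fun v θ => ?_⟩
  have hcs : HasCompactSupport (b v) := HasCompactSupport.intro hK (hsupp v)
  have h := Real.pow_mul_norm_iteratedFDeriv_fourier_le (K := ⊤) (N := ⊤) (f := b v) (hb.1 v)
    (fun k m _ _ => by
      refine Continuous.integrable_of_hasCompactSupport ?_ ?_
      · exact (continuous_norm.pow k).mul
          ((hb.1 v).continuous_iteratedFDeriv (mod_cast le_top)).norm
      · exact (hcs.iteratedFDeriv m).norm.mul_left) (k := 0) (n := n) (by simp) (by simp) θ
  rw [norm_iteratedFDeriv_zero] at h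
  refine h.trans ?_
  rw [mul_assoc (2 ^ n : ℝ), Finset.sum_mul]
  simp only [pow_zero, one_mul, CharP.cast_eq_zero, mul_zero, zero_add]
  gcongr with p hp
  have hp0 : p.1 = 0 := by
    have := (Finset.mem_product.1 hp).1
    simpa using this
  rw [hp0]
  simp only [pow_zero, one_mul]
  refine (integral_norm_iteratedFDeriv_le hK (hsupp v) fun z =>
    hC p.2 v trivial z trivial).trans_eq ?_
  ring

theorem one_add_pow_mul_norm_fourier_le (hb : DerivBound Set.univ Set.univ w b)
    (hK : IsCompact K) (hsupp : ∀ v z, z ∉ K → b v z = 0) (n : ℕ) :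
    ∃ C : ℝ, ∀ v θ, (1 + ‖θ‖) ^ n * ‖𝓕 (b v) θ‖ ≤ C * w v := by
  obtain ⟨C₀, h₀⟩ := pow_mul_norm_fourier_le hb hK hsupp 0
  obtain ⟨C₁, h₁⟩ := pow_mul_norm_fourier_le hb hK hsupp n
  refine ⟨2 ^ (n - 1) * (C₀ + C₁), fun v θ => ?_⟩
  have h2 := h₀ v θ
  have h3 := h₁ v θ
  rw [pow_zero, one_mul] at h2
  calc _ ≤ 2 ^ (n - 1) * (1 ^ n + ‖θ‖ ^ n) * ‖𝓕 (b v) θ‖ := by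
        gcongr
        exact add_pow_le zero_le_one (norm_nonneg _) n
    _ = 2 ^ (n - 1) * (‖𝓕 (b v) θ‖ + ‖θ‖ ^ n * ‖𝓕 (b v) θ‖) := by rw [one_pow]; ring
    _ ≤ 2 ^ (n - 1) * (C₀ * w v + C₁ * w v) := by gcongr
    _ = _ := by ring

theorem lintegral_decayKernel_lt_top : ∫⁻ u : V, ENNReal.ofReal (decayKernel u) < ⊤ :=
  finite_integral_one_add_norm (lt_add_one _)

theorem integrable_decayKernel : Integrable (decayKernel : V → ℝ) :=
  integrable_one_add_norm (lt_add_one _)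

/-- Peetre's inequality moves the weight from `θ` to `v` at the cost of `(1 + |θ - v|)^m`. Decay of
order `m + d + 1`, with `d` the dimension, pays this and leaves an integrable convolution kernel. -/
theorem exists_fourier_kernel_le (hb : DerivBound Set.univ Set.univ w b) (hK : IsCompact K)
    (hsupp : ∀ v z, z ∉ K → b v z = 0) {s : ℝ} (hs : 0 ≤ s) {W : V → ℝ} {A : ℝ}
    (hw : ∀ v, 0 ≤ w v) (hW0 : ∀ v, 0 ≤ W v)
    (hW : ∀ v, w v * (1 + ‖(2 * Real.pi) • v‖ ^ 2) ^ (s / 2) ≤ A * W v) :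
    ∃ C : ℝ≥0, ∀ v θ, (1 + ‖(2 * Real.pi) • θ‖ ^ 2) ^ (s / 2) * ‖𝓕 (b v) (θ - v)‖
      ≤ C * (decayKernel (θ - v) * W v) := by
  obtain ⟨m, hm⟩ := exists_nat_ge s
  obtain ⟨C, hC⟩ := one_add_pow_mul_norm_fourier_le hb hK hsupp (m + (Module.finrank ℝ V + 1))
  set c := (2 * (2 * Real.pi) ^ 2) ^ (s / 2) with hc
  have hc0 : 0 ≤ c := by positivity
  refine ⟨(c * |C| * |A|).toNNReal, fun v θ => ?_⟩
  rw [Real.coe_toNNReal _ (by positivity)]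
  set u := ‖θ - v‖ with hu
  set B := ‖𝓕 (b v) (θ - v)‖ with hB
  have hu1 : 0 < 1 + u := by positivity
  have h1 : (1 + u) ^ m * B ≤ |C| * w v * decayKernel (θ - v) := by
    have h2 := hC v (θ - v)
    rw [← hu, ← hB, pow_add] at h2
    have h3 : decayKernel (θ - v) = ((1 + u) ^ (Module.finrank ℝ V + 1))⁻¹ := by
      rw [decayKernel, ← hu, Real.rpow_neg hu1.le, ← Real.rpow_natCast]
      push_cast
      rfl
    rw [h3, le_mul_inv_iff₀ (by positivity)]
    calc _ = (1 + u) ^ m * (1 + u) ^ (Module.finrank ℝ V + 1) * B := by ring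
      _ ≤ C * w v := h2
      _ ≤ _ := mul_le_mul_of_nonneg_right (le_abs_self _) (hw v)
  have hdk := decayKernel_nonneg (θ - v)
  calc _ ≤ c * (1 + u) ^ m * (1 + ‖(2 * Real.pi) • v‖ ^ 2) ^ (s / 2) * B := by
        gcongr
        exact sobolevWeight_le θ v hs hm
    _ = c * ((1 + u) ^ m * B) * (1 + ‖(2 * Real.pi) • v‖ ^ 2) ^ (s / 2) := by ring
    _ ≤ c * (|C| * w v * decayKernel (θ - v)) * (1 + ‖(2 * Real.pi) • v‖ ^ 2) ^ (s / 2) := by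
        gcongr
    _ = c * |C| * decayKernel (θ - v) * (w v * (1 + ‖(2 * Real.pi) • v‖ ^ 2) ^ (s / 2)) := by ring
    _ ≤ c * |C| * decayKernel (θ - v) * (|A| * W v) :=
        mul_le_mul_of_nonneg_left
          ((hW v).trans (mul_le_mul_of_nonneg_right (le_abs_self _) (hW0 v))) (by positivity)
    _ = _ := by ring

end OperatorBound

/-! ### The operator on the Fourier side -/

section OperatorFourier

variable {V : Type*} [NormedAddCommGroup V] [InnerProductSpace ℝ V] [FiniteDimensional ℝ V]
  [MeasurableSpace V] [BorelSpace V] {K : Set V} {w : V → ℝ} {b : V → V → ℂ}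

/-- The Fourier transform of `Op(b) F`, where `f` is the Fourier transform of `F`. -/
def opFourier (b : V → V → ℂ) (f : V → ℂ) (θ : V) : ℂ := ∫ v, f v * 𝓕 (b v) (θ - v)

theorem stronglyMeasurable_fourier_kernel (hbc : Continuous fun p : V × V => b p.1 p.2) :
    StronglyMeasurable fun p : V × V => 𝓕 (b p.2) (p.1 - p.2) := by
  have h : StronglyMeasurable fun p : (V × V) × V =>
      Real.fourierChar (-(inner ℝ p.2 (p.1.1 - p.1.2))) • b p.1.2 p.2 := by
    refine Continuous.stronglyMeasurable ?_
    have h1 : Continuous fun p : (V × V) × V => b p.1.2 p.2 :=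
      hbc.comp (f := fun p : (V × V) × V => (p.1.2, p.2)) (by fun_prop)
    have h2 : Continuous fun p : (V × V) × V =>
        (Real.fourierChar (-(inner ℝ p.2 (p.1.1 - p.1.2))) : Circle) :=
      Real.continuous_fourierChar.comp (by fun_prop)
    exact h2.smul h1
  exact h.integral_prod_right'

theorem fourier_modulate (f : V → ℂ) (v θ : V) :
    𝓕 (fun z => f z * Complex.exp (2 * Real.pi * Complex.I * (inner ℝ z v : ℝ))) θ
      = 𝓕 f (θ - v) := by
  rw [Real.fourier_eq', Real.fourier_eq']
  refine integral_congr_ae (Eventually.of_forall fun z => ?_)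
  simp only [smul_eq_mul]
  rw [mul_comm (f z), ← mul_assoc, ← Complex.exp_add, inner_sub_right]
  congr 2
  push_cast
  ring

theorem integral_fourier_kernel_mul (hK : IsCompact K) (hsupp : ∀ v z, z ∉ K → b v z = 0)
    (hbc : Continuous fun p : V × V => b p.1 p.2) (φ : SchwartzMap V ℂ) (v : V) :
    ∫ θ, 𝓕 (b v) (θ - v) * (𝓕⁻ φ : SchwartzMap V ℂ) θ
      = ∫ z, b v z * φ z * Complex.exp (2 * Real.pi * Complex.I * (inner ℝ z v : ℝ)) := by
  have hbv : Continuous (b v) := hbc.comp (f := fun z => (v, z)) (by fun_prop)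
  have h1 : Integrable fun z =>
      b v z * Complex.exp (2 * Real.pi * Complex.I * (inner ℝ z v : ℝ)) := by
    refine Continuous.integrable_of_hasCompactSupport (hbv.mul (by fun_prop)) ?_
    exact (HasCompactSupport.intro hK (hsupp v)).mul_right
  have h2 := integral_fourier_mul_eq_of_integrable h1
    ((𝓕⁻ φ : SchwartzMap V ℂ).integrable (μ := volume))
  simp only [fourier_modulate] at h2
  rw [h2]
  have h3 : 𝓕 ((𝓕⁻ φ : SchwartzMap V ℂ) : V → ℂ) = φ := by
    rw [← SchwartzMap.fourier_coe, FourierTransform.fourier_fourierInv_eq]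
  rw [h3]
  refine integral_congr_ae (Eventually.of_forall fun z => ?_)
  simp only
  ring

theorem enorm_opFourier_kernel_le {s : ℝ} {W : V → ℝ} {C : ℝ≥0}
    (hC : ∀ v θ, (1 + ‖(2 * Real.pi) • θ‖ ^ 2) ^ (s / 2) * ‖𝓕 (b v) (θ - v)‖
      ≤ C * (decayKernel (θ - v) * W v)) (f : V → ℂ) (v θ : V) :
    ENNReal.ofReal ((1 + ‖(2 * Real.pi) • θ‖ ^ 2) ^ (s / 2)) * ‖f v * 𝓕 (b v) (θ - v)‖ₑ
      ≤ C * (ENNReal.ofReal (decayKernel (θ - v)) * (ENNReal.ofReal (W v) * ‖f v‖ₑ)) := by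
  have h := ENNReal.ofReal_le_ofReal (hC v θ)
  rw [ENNReal.ofReal_mul (by positivity), ENNReal.ofReal_mul (by positivity),
    ENNReal.ofReal_mul (decayKernel_nonneg _), ENNReal.ofReal_coe_nnreal,
    ofReal_norm] at h
  rw [enorm_mul]
  calc _ = ENNReal.ofReal ((1 + ‖(2 * Real.pi) • θ‖ ^ 2) ^ (s / 2)) * ‖𝓕 (b v) (θ - v)‖ₑ
        * ‖f v‖ₑ := by ring
    _ ≤ C * (ENNReal.ofReal (decayKernel (θ - v)) * ENNReal.ofReal (W v)) * ‖f v‖ₑ := by gcongr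
    _ = _ := by ring

/-- The majorant of the Fourier transform of `Op(b) F` in the weighted `L²` estimate. -/
def opMajorant (W : V → ℝ) (f : V → ℂ) (θ : V) : ℝ≥0∞ :=
  ∫⁻ v, ENNReal.ofReal (decayKernel (θ - v)) * (ENNReal.ofReal (W v) * ‖f v‖ₑ)

theorem lintegral_opMajorant_sq_le {W : V → ℝ} (hW : Measurable W) {f : V → ℂ}
    (hf : StronglyMeasurable f) :
    ∫⁻ θ, opMajorant W f θ ^ 2 ≤ (∫⁻ u : V, ENNReal.ofReal (decayKernel u)) ^ 2
      * ∫⁻ v, (ENNReal.ofReal (W v) * ‖f v‖ₑ) ^ 2 :=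
  lintegral_convolution_sq_le measurable_decayKernel.ennreal_ofReal
    (hW.ennreal_ofReal.mul hf.enorm)

theorem measurable_opMajorant {W : V → ℝ} (hW : Measurable W) {f : V → ℂ}
    (hf : StronglyMeasurable f) : Measurable (opMajorant W f) := by
  refine Measurable.lintegral_prod_right' (f := fun p : V × V =>
    ENNReal.ofReal (decayKernel (p.1 - p.2)) * (ENNReal.ofReal (W p.2) * ‖f p.2‖ₑ)) ?_
  exact ((measurable_decayKernel.comp (measurable_fst.sub measurable_snd)).ennreal_ofReal).mul
    ((hW.ennreal_ofReal.mul hf.enorm).comp measurable_snd)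

theorem lintegral_opFourier_kernel_le {s : ℝ} {W : V → ℝ} {C : ℝ≥0}
    (hC : ∀ v θ, (1 + ‖(2 * Real.pi) • θ‖ ^ 2) ^ (s / 2) * ‖𝓕 (b v) (θ - v)‖
      ≤ C * (decayKernel (θ - v) * W v)) (f : V → ℂ) (θ : V) :
    ENNReal.ofReal ((1 + ‖(2 * Real.pi) • θ‖ ^ 2) ^ (s / 2)) * ∫⁻ v, ‖f v * 𝓕 (b v) (θ - v)‖ₑ
      ≤ C * opMajorant W f θ := by
  rw [opMajorant, ← lintegral_const_mul' _ _ ENNReal.ofReal_ne_top,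
    ← lintegral_const_mul' _ _ ENNReal.coe_ne_top]
  exact lintegral_mono fun v => enorm_opFourier_kernel_le hC f v θ

theorem memLp_two_of_lintegral_lt_top {α : Type*} [MeasurableSpace α] {μ : Measure α} {f : α → ℂ}
    (hf : AEStronglyMeasurable f μ) (h : ∫⁻ x, ‖f x‖ₑ ^ 2 ∂μ < ⊤) : MemLp f 2 μ := by
  refine ⟨hf, ?_⟩
  rw [eLpNorm_lt_top_iff_lintegral_rpow_enorm_lt_top (by norm_num) (by norm_num)]
  simpa using h

theorem lintegral_enorm_sq_lt_top {α : Type*} [MeasurableSpace α] {μ : Measure α} {f : α → ℂ}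
    (hf : MemLp f 2 μ) : ∫⁻ x, ‖f x‖ₑ ^ 2 ∂μ < ⊤ := by
  have := (eLpNorm_lt_top_iff_lintegral_rpow_enorm_lt_top (by norm_num) (by norm_num)).1 hf.2
  simpa using this

theorem stronglyMeasurable_opFourier (hbc : Continuous fun p : V × V => b p.1 p.2) {f : V → ℂ}
    (hf : StronglyMeasurable f) : StronglyMeasurable (opFourier b f) := by
  have h : StronglyMeasurable fun p : V × V => f p.2 * 𝓕 (b p.2) (p.1 - p.2) :=
    (hf.comp_measurable measurable_snd).mul (stronglyMeasurable_fourier_kernel hbc)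
  exact h.integral_prod_right'

/-- This is Fubini's theorem. Absolute convergence follows from Cauchy–Schwarz between the
square-integrable majorant and the Schwartz function. -/
theorem integral_opFourier_mul (hK : IsCompact K) (hsupp : ∀ v z, z ∉ K → b v z = 0)
    (hbc : Continuous fun p : V × V => b p.1 p.2) {s : ℝ} (hs : 0 ≤ s) {W : V → ℝ} {C : ℝ≥0}
    (hWm : Measurable W)
    (hC : ∀ v θ, (1 + ‖(2 * Real.pi) • θ‖ ^ 2) ^ (s / 2) * ‖𝓕 (b v) (θ - v)‖
      ≤ C * (decayKernel (θ - v) * W v)) {f : V → ℂ} (hf : StronglyMeasurable f)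
    (hfW : ∫⁻ v, (ENNReal.ofReal (W v) * ‖f v‖ₑ) ^ 2 < ⊤) (φ : SchwartzMap V ℂ) :
    ∫ θ, opFourier b f θ * (𝓕⁻ φ : SchwartzMap V ℂ) θ
      = ∫ v, f v * ∫ z, b v z * φ z * Complex.exp (2 * Real.pi * Complex.I *
        (inner ℝ z v : ℝ)) := by
  set ψ : SchwartzMap V ℂ := 𝓕⁻ φ with hψ
  have hker : StronglyMeasurable fun p : V × V => f p.2 * 𝓕 (b p.2) (p.1 - p.2) :=
    (hf.comp_measurable measurable_snd).mul (stronglyMeasurable_fourier_kernel hbc)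
  have hint : Integrable (fun p : V × V => f p.2 * 𝓕 (b p.2) (p.1 - p.2) * ψ p.1)
      (volume.prod volume) := by
    have hm : StronglyMeasurable fun p : V × V => f p.2 * 𝓕 (b p.2) (p.1 - p.2) * ψ p.1 :=
      hker.mul (ψ.continuous.comp continuous_fst).stronglyMeasurable
    refine ⟨hm.aestronglyMeasurable, ?_⟩
    rw [hasFiniteIntegral_iff_enorm, lintegral_prod _ hm.enorm.aemeasurable]
    have h1 : ∀ θ, ∫⁻ v, ‖f v * 𝓕 (b v) (θ - v) * ψ θ‖ₑ ≤ C * (opMajorant W f θ * ‖ψ θ‖ₑ) := by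
      intro θ
      simp only [enorm_mul _ (ψ θ)]
      rw [lintegral_mul_const' _ _ enorm_ne_top, ← mul_assoc]
      gcongr
      refine le_trans ?_ (lintegral_opFourier_kernel_le hC f θ)
      exact le_mul_of_one_le_left zero_le (one_le_sobolevWeight hs θ)
    refine (lintegral_mono h1).trans_lt ?_
    rw [lintegral_const_mul' _ _ ENNReal.coe_ne_top]
    refine ENNReal.mul_lt_top ENNReal.coe_lt_top ?_
    have h2 := lintegral_mul_sq_le volume (measurable_opMajorant hWm hf).aemeasurable
      (ψ.continuous.enorm.measurable.aemeasurable)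
    have h3 : (∫⁻ θ, opMajorant W f θ ^ 2) * ∫⁻ θ, ‖ψ θ‖ₑ ^ 2 < ⊤ := by
      refine ENNReal.mul_lt_top ((lintegral_opMajorant_sq_le hWm hf).trans_lt ?_)
        (lintegral_enorm_sq_lt_top (ψ.memLp 2 volume))
      exact ENNReal.mul_lt_top (ENNReal.pow_lt_top lintegral_decayKernel_lt_top) hfW
    have h4 := h2.trans_lt h3
    rw [lt_top_iff_ne_top] at h4 ⊢
    intro h5
    simp [h5] at h4
  calc _ = ∫ θ, ∫ v, f v * 𝓕 (b v) (θ - v) * ψ θ := by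
        refine integral_congr_ae (Eventually.of_forall fun θ => ?_)
        simp only [opFourier]
        rw [integral_mul_const]
    _ = ∫ v, ∫ θ, f v * 𝓕 (b v) (θ - v) * ψ θ := integral_integral_swap hint
    _ = _ := by
        refine integral_congr_ae (Eventually.of_forall fun v => ?_)
        simp only [mul_assoc (f v)]
        rw [integral_const_mul, integral_fourier_kernel_mul hK hsupp hbc φ v]

end OperatorFourier

/-- Weighted `L²` boundedness of the operator with the compactly supported symbol `b`. -/
theorem exists_op_image {n : ℕ} {K : Set (RSpace n)} {w : RSpace n → ℝ}
    {b : RSpace n → RSpace n → ℂ} (hb : DerivBound Set.univ Set.univ w b) (hK : IsCompact K)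
    (hsupp : ∀ v z, z ∉ K → b v z = 0)
    (hbc : Continuous fun p : RSpace n × RSpace n => b p.1 p.2) {s : ℝ} (hs : 0 ≤ s)
    {W : RSpace n → ℝ} {A : ℝ} (hw : ∀ v, 0 ≤ w v) (hWm : Measurable W) (hW0 : ∀ v, 0 ≤ W v)
    (hW : ∀ v, w v * (1 + ‖(2 * Real.pi) • v‖ ^ 2) ^ (s / 2) ≤ A * W v) :
    ∃ C : ℝ≥0, ∀ F : L2Full n,
      ∫⁻ v, (ENNReal.ofReal (W v) * ‖(𝓕 F : L2Full n) v‖ₑ) ^ 2 < ⊤ →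
      ∃ U : L2Full n,
        (∀ φ : RSpace n → ℂ, ContDiff ℝ ∞ φ → HasCompactSupport φ →
          ∫ v, (𝓕 F : L2Full n) v * ∫ z, b v z * φ z *
            Complex.exp (2 * Real.pi * Complex.I * (inner ℝ z v : ℝ)) = ∫ z, U z * φ z) ∧
        sobolevNorm s U ≤
          C * (∫⁻ v, (ENNReal.ofReal (W v) * ‖(𝓕 F : L2Full n) v‖ₑ) ^ 2) ^ (1 / 2 : ℝ) := by
  obtain ⟨C, hC⟩ := exists_fourier_kernel_le hb hK hsupp hs hw hW0 hW
  set I := ∫⁻ u : RSpace n, ENNReal.ofReal (decayKernel u) with hI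
  have hItop : I < ⊤ := lintegral_decayKernel_lt_top
  refine ⟨C * I.toNNReal, fun F hF => ?_⟩
  set f : RSpace n → ℂ := ((𝓕 F : L2Full n) : RSpace n → ℂ) with hf
  have hfm : StronglyMeasurable f := Lp.stronglyMeasurable _
  have hle : ∀ θ, ENNReal.ofReal ((1 + ‖(2 * Real.pi) • θ‖ ^ 2) ^ (s / 2)) * ‖opFourier b f θ‖ₑ
      ≤ C * opMajorant W f θ := fun θ =>
    (mul_le_mul_right (enorm_integral_le_lintegral_enorm _) _).trans
      (lintegral_opFourier_kernel_le hC f θ)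
  have hle2 : ∫⁻ θ, (ENNReal.ofReal ((1 + ‖(2 * Real.pi) • θ‖ ^ 2) ^ (s / 2)) *
      ‖opFourier b f θ‖ₑ) ^ 2
      ≤ (C * I) ^ 2 * ∫⁻ v, (ENNReal.ofReal (W v) * ‖f v‖ₑ) ^ 2 := by
    calc _ ≤ ∫⁻ θ, (C * opMajorant W f θ) ^ 2 := lintegral_mono fun θ => pow_le_pow_left' (hle θ) 2
      _ = C ^ 2 * ∫⁻ θ, opMajorant W f θ ^ 2 := by
          simp only [mul_pow]
          rw [lintegral_const_mul' _ _ (by simp)]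
      _ ≤ C ^ 2 * (I ^ 2 * ∫⁻ v, (ENNReal.ofReal (W v) * ‖f v‖ₑ) ^ 2) := by
          gcongr
          exact lintegral_opMajorant_sq_le hWm hfm
      _ = _ := by ring
  -- Since `s ≥ 0` the weight is at least `1`, so the weighted bound contains plain `L²` membership.
  have hmem : MemLp (opFourier b f) 2 := by
    refine memLp_two_of_lintegral_lt_top
      (stronglyMeasurable_opFourier hbc hfm).aestronglyMeasurable ?_
    refine lt_of_le_of_lt ?_ (hle2.trans_lt (ENNReal.mul_lt_top
      (ENNReal.pow_lt_top (ENNReal.mul_lt_top ENNReal.coe_lt_top hItop)) hF))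
    refine lintegral_mono fun θ => ?_
    gcongr
    exact le_mul_of_one_le_left zero_le (one_le_sobolevWeight hs θ)
  set U : L2Full n := 𝓕⁻ (hmem.toLp _) with hU
  have hFU : (𝓕 U : L2Full n) = hmem.toLp _ := FourierTransform.fourier_fourierInv_eq _
  refine ⟨U, fun φ hφ hφc => ?_, ?_⟩
  · set Φ : SchwartzMap (RSpace n) ℂ := hφc.toSchwartzMap hφ with hΦ
    have hΦφ : ∀ z, Φ z = φ z := fun z => rfl
    have h1 := integral_opFourier_mul hK hsupp hbc hs hWm hC hfm hF Φ
    simp only [hΦφ] at h1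
    rw [← h1]
    have h2 := integral_fourier_mul_schwartz U (𝓕⁻ Φ : SchwartzMap (RSpace n) ℂ)
    rw [hFU, FourierTransform.fourier_fourierInv_eq] at h2
    simp only [hΦφ] at h2
    rw [← h2]
    refine integral_congr_ae ?_
    filter_upwards [hmem.coeFn_toLp] with θ hθ
    rw [hθ]
  · rw [sobolevNorm, hFU]
    calc _ = (∫⁻ θ, (ENNReal.ofReal ((1 + ‖(2 * Real.pi) • θ‖ ^ 2) ^ (s / 2)) *
          ‖opFourier b f θ‖ₑ) ^ 2) ^ (1 / 2 : ℝ) := by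
          congr 1
          refine lintegral_congr_ae ?_
          filter_upwards [hmem.coeFn_toLp] with θ hθ
          rw [hθ, mul_pow, ofReal_sobolevWeight_sq]
      _ ≤ ((C * I) ^ 2 * ∫⁻ v, (ENNReal.ofReal (W v) * ‖f v‖ₑ) ^ 2) ^ (1 / 2 : ℝ) := by
          gcongr
      _ = _ := by
          rw [ENNReal.mul_rpow_of_nonneg _ _ (by norm_num), ← ENNReal.rpow_ofNat,
            ← ENNReal.rpow_mul]
          norm_num
          rw [ENNReal.coe_toNNReal hItop.ne]

/-! ### The splitting `ℝ^{n+1} = ℝ^n × ℝ` -/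

section Split

variable {n : ℕ}

/-- The tangential part `x` of `z = (x, ρ)`. -/
def tanPart (z : RSpace n) : RTan n := WithLp.toLp 2 fun i => z i.castSucc

@[simp] theorem joinLast_castSucc (x : RTan n) (r : ℝ) (i : Fin n) :
    joinLast x r i.castSucc = x i := by
  simp [joinLast]

@[simp] theorem joinLast_last (x : RTan n) (r : ℝ) : joinLast x r (Fin.last n) = r := by
  simp [joinLast]

@[simp] theorem tanPart_apply (z : RSpace n) (i : Fin n) : tanPart z i = z i.castSucc := rfl

@[simp] theorem tanPart_joinLast (x : RTan n) (r : ℝ) : tanPart (joinLast x r) = x := by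
  ext i; simp

@[simp] theorem joinLast_tanPart (z : RSpace n) : joinLast (tanPart z) (z (Fin.last n)) = z := by
  ext i
  refine Fin.lastCases ?_ (fun i => ?_) i <;> simp

theorem continuous_tanPart : Continuous (tanPart : RSpace n → RTan n) := by
  unfold tanPart
  refine (PiLp.continuous_toLp 2 _).comp ?_
  fun_prop

theorem continuous_joinLast : Continuous fun p : RTan n × ℝ => joinLast p.1 p.2 := by
  unfold joinLast
  refine (PiLp.continuous_toLp 2 _).comp (continuous_pi fun i => ?_)
  refine Fin.lastCases ?_ (fun i => ?_) i
  · simpa using continuous_snd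
  · simp only [Fin.snoc_castSucc]
    fun_prop

theorem inner_joinLast (x : RTan n) (r : ℝ) (v : RSpace n) :
    inner ℝ (joinLast x r) v = inner ℝ x (tanPart v) + r * v (Fin.last n) := by
  simp [PiLp.inner_apply, Fin.sum_univ_castSucc, mul_comm]

theorem norm_sq_eq_tanPart (z : RSpace n) : ‖z‖ ^ 2 = ‖tanPart z‖ ^ 2 + z (Fin.last n) ^ 2 := by
  simp [EuclideanSpace.norm_sq_eq, Fin.sum_univ_castSucc]

theorem norm_tanPart_le (z : RSpace n) : ‖tanPart z‖ ≤ ‖z‖ := by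
  have h := norm_sq_eq_tanPart z
  exact le_of_sq_le_sq (by nlinarith [sq_nonneg (z (Fin.last n))]) (norm_nonneg _)

theorem abs_last_le_norm (z : RSpace n) : |z (Fin.last n)| ≤ ‖z‖ := by
  have h := norm_sq_eq_tanPart z
  exact le_of_sq_le_sq (by rw [sq_abs]; nlinarith [sq_nonneg ‖tanPart z‖]) (norm_nonneg _)

theorem tanPart_smul (c : ℝ) (z : RSpace n) : tanPart (c • z) = c • tanPart z := by
  ext i; simp

/-- `(x, ρ) ↦ z` as a measurable equivalence. -/
def joinLastEquiv (n : ℕ) : RTan n × ℝ ≃ᵐ RSpace n where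
  toFun p := joinLast p.1 p.2
  invFun z := (tanPart z, z (Fin.last n))
  left_inv p := by simp
  right_inv z := by simp
  measurable_toFun := continuous_joinLast.measurable
  measurable_invFun := (continuous_tanPart.prodMk (by fun_prop)).measurable

theorem measurePreserving_joinLast :
    MeasurePreserving (fun p : RTan n × ℝ => joinLast p.1 p.2) volume volume := by
  have h1 : MeasurePreserving (Prod.map WithLp.ofLp id : RTan n × ℝ → (Fin n → ℝ) × ℝ)
      volume volume :=
    (PiLp.volume_preserving_ofLp (Fin n)).prod (MeasurePreserving.id volume)
  have h2 : MeasurePreserving (Prod.swap : (Fin n → ℝ) × ℝ → ℝ × (Fin n → ℝ)) volume volume :=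
    Measure.measurePreserving_swap
  have h3 := (volume_preserving_piFinSuccAbove (fun _ : Fin (n + 1) => ℝ) (Fin.last n)).symm
  have h4 := (PiLp.volume_preserving_toLp (Fin (n + 1))).comp (h3.comp (h2.comp h1))
  have h5 : (fun p : RTan n × ℝ => joinLast p.1 p.2) = WithLp.toLp 2 ∘
      (MeasurableEquiv.piFinSuccAbove (fun _ => ℝ) (Fin.last n)).symm ∘ Prod.swap ∘
        Prod.map WithLp.ofLp id := by
    funext p
    ext i
    refine Fin.lastCases ?_ (fun i => ?_) i <;> simp [MeasurableEquiv.piFinSuccAbove]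
  rw [h5]
  exact h4

theorem integral_eq_integral_joinLast {f : RSpace n → ℂ} (hf : Integrable f) :
    ∫ z, f z = ∫ x : RTan n, ∫ r : ℝ, f (joinLast x r) := by
  have hm := measurePreserving_joinLast (n := n)
  rw [← hm.integral_comp (joinLastEquiv n).measurableEmbedding f]
  refine integral_prod (fun p : RTan n × ℝ => f (joinLast p.1 p.2)) ?_
  exact (hm.integrable_comp_emb (joinLastEquiv n).measurableEmbedding).2 hf

end Split

/-! ### Functions with one-sided Fourier support -/

section OneSided

/-- As `l > 0`, one has `(2πv - il)⁻¹ = i ∫_0^∞ exp(-(l + 2πiv) t) dt`. Multiplication by this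
factor averages the Fourier integral over its values at `r + t`, `t ≥ 0`, all of which vanish. -/
theorem integral_exp_mul_inv_eq_zero {g : ℝ → ℂ} (hg : Integrable g) {l : ℝ} (hl : 0 < l)
    (h : ∀ r : ℝ, 0 ≤ r → ∫ v : ℝ, Complex.exp (-(2 * Real.pi * Complex.I * (r * v : ℝ))) * g v = 0)
    {r : ℝ} (hr : 0 ≤ r) :
    ∫ v : ℝ, Complex.exp (-(2 * Real.pi * Complex.I * (r * v : ℝ))) *
      (((2 * Real.pi * v : ℝ) - Complex.I * l : ℂ)⁻¹ * g v) = 0 := by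
  have hexp : ∀ v : ℝ, ((2 * Real.pi * v : ℝ) - Complex.I * l : ℂ)⁻¹
      = Complex.I * ∫ t in Set.Ioi (0 : ℝ), Complex.exp (-(l + 2 * Real.pi * v * Complex.I) * t) := by
    intro v
    have hre : (-(l + 2 * Real.pi * v * Complex.I) : ℂ).re < 0 := by simpa using hl
    rw [integral_exp_mul_complex_Ioi hre]
    have h1 : (l + 2 * Real.pi * v * Complex.I : ℂ) ≠ 0 := by
      intro h0
      rw [h0] at hre
      simp at hre
    have h2 : ((2 * Real.pi * v : ℝ) - Complex.I * l : ℂ)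
        = -Complex.I * (l + 2 * Real.pi * v * Complex.I) := by
      push_cast
      linear_combination (2 * (Real.pi : ℂ) * v) * Complex.I_mul_I
    have h3 : (-Complex.I)⁻¹ = Complex.I := by simp
    rw [h2, mul_inv, h3, Complex.ofReal_zero, mul_zero, Complex.exp_zero, neg_div_neg_eq, one_div]
  set G : ℝ × ℝ → ℂ := fun p =>
    Complex.exp (-(2 * Real.pi * Complex.I * ((r + p.2) * p.1 : ℝ))) * (g p.1 *
      Complex.exp (-(l * p.2 : ℝ))) with hG
  have hGi : Integrable G (volume.prod (volume.restrict (Set.Ioi (0 : ℝ)))) := by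
    have h1 : Integrable (fun t : ℝ => Complex.exp (-(l * t : ℝ)))
        (volume.restrict (Set.Ioi (0 : ℝ))) := by
      have := (exp_neg_integrableOn_Ioi 0 hl).ofReal (𝕜 := ℂ)
      refine this.congr (Eventually.of_forall fun t => ?_)
      simp
    have h2 := hg.mul_prod h1
    refine h2.bdd_mul (c := 1) (Continuous.aestronglyMeasurable (by fun_prop))
      (Eventually.of_forall fun p => ?_)
    rw [Complex.norm_exp]
    simp
  calc _ = ∫ v : ℝ, Complex.I * ∫ t in Set.Ioi (0 : ℝ), G (v, t) := by
        refine integral_congr_ae (Eventually.of_forall fun v => ?_)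
        simp only
        rw [hexp v, mul_assoc Complex.I, mul_left_comm]
        congr 1
        rw [← integral_mul_const, ← integral_const_mul]
        refine integral_congr_ae (Eventually.of_forall fun t => ?_)
        simp only [hG]
        rw [mul_comm _ (g v), mul_left_comm, mul_left_comm _ (g v), ← Complex.exp_add,
          ← Complex.exp_add]
        congr 2
        push_cast
        ring
    _ = Complex.I * ∫ t in Set.Ioi (0 : ℝ), ∫ v : ℝ, G (v, t) := by
        rw [integral_const_mul, integral_integral_swap hGi]
    _ = 0 := by
        rw [setIntegral_eq_zero_of_forall_eq_zero, mul_zero]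
        intro t ht
        simp only [hG, ← mul_assoc]
        rw [integral_mul_const, h (r + t) (add_nonneg hr (le_of_lt ht)), zero_mul]

theorem integral_exp_mul_inv_pow_eq_zero {g : ℝ → ℂ} (hg : Integrable g) {l : ℝ} (hl : 0 < l)
    (h : ∀ r : ℝ, 0 ≤ r → ∫ v : ℝ, Complex.exp (-(2 * Real.pi * Complex.I * (r * v : ℝ))) * g v = 0)
    (j : ℕ) {r : ℝ} (hr : 0 ≤ r) :
    ∫ v : ℝ, Complex.exp (-(2 * Real.pi * Complex.I * (r * v : ℝ))) *
      ((((2 * Real.pi * v : ℝ) - Complex.I * l : ℂ) ^ j)⁻¹ * g v) = 0 := by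
  have hy : ∀ v : ℝ, l ≤ ‖((2 * Real.pi * v : ℝ) - Complex.I * l : ℂ)‖ := by
    intro v
    have := Complex.abs_im_le_norm ((2 * Real.pi * v : ℝ) - Complex.I * l : ℂ)
    simpa [abs_of_pos hl] using this
  have hy0 : ∀ v : ℝ, ((2 * Real.pi * v : ℝ) - Complex.I * l : ℂ) ≠ 0 := fun v =>
    norm_pos_iff.1 (hl.trans_le (hy v))
  have hint : ∀ j : ℕ, Integrable fun v : ℝ =>
      (((2 * Real.pi * v : ℝ) - Complex.I * l : ℂ) ^ j)⁻¹ * g v := by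
    intro j
    refine hg.bdd_mul (c := (l ^ j)⁻¹) (Continuous.aestronglyMeasurable
      (Continuous.inv₀ (by fun_prop) fun v => pow_ne_zero _ (hy0 v)))
      (Eventually.of_forall fun v => ?_)
    rw [norm_inv, norm_pow]
    have := hy v
    gcongr
  induction j generalizing r with
  | zero => simpa using h r hr
  | succ j ih =>
    have := integral_exp_mul_inv_eq_zero (hint j) hl (fun r hr => ih hr) hr
    simp only [← mul_assoc, ← mul_inv] at this ⊢
    simpa only [← pow_succ'] using this

/-- Fourier inversion turns the vanishing of `H` on `[0, ∞)` into the hypothesis of the preceding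
lemma. -/
theorem integral_exp_mul_inv_pow_mul_fourierInv_eq_zero {H : ℝ → ℂ} (hc : Continuous H)
    (hi : Integrable H) (hFi : Integrable (𝓕⁻ H)) (hH : ∀ r, 0 ≤ r → H r = 0) {l : ℝ}
    (hl : 0 < l) (j : ℕ) {r : ℝ} (hr : 0 ≤ r) :
    ∫ v : ℝ, Complex.exp (-(2 * Real.pi * Complex.I * (r * v : ℝ))) *
      ((((2 * Real.pi * v : ℝ) - Complex.I * l : ℂ) ^ j)⁻¹ * 𝓕⁻ H v) = 0 := by
  have hF : Integrable (𝓕 H) := by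
    have : 𝓕 H = fun v => 𝓕⁻ H (-v) := by
      funext v; rw [Real.fourierInv_eq_fourier_neg, neg_neg]
    rw [this]
    exact hFi.comp_neg
  refine integral_exp_mul_inv_pow_eq_zero hFi hl (fun r hr => ?_) j hr
  have h1 : 𝓕 (𝓕⁻ H) r = H r := by rw [Continuous.fourier_fourierInv_eq hc hi hF]
  rw [hH r hr, Real.fourier_eq'] at h1
  rw [← h1]
  refine integral_congr_ae (Eventually.of_forall fun v => ?_)
  simp only [smul_eq_mul]
  congr 2
  simp only [RCLike.inner_apply, conj_trivial]
  push_cast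
  ring

end OneSided

/-! ### Operators whose kernel is supported on one side of the boundary -/

section Cutoff

variable {ι E : Type*} [NormedAddCommGroup E] [NormedSpace ℝ E] {K : Set E} {S : Set ι}
  {w : ι → ℝ} {f : ι → E → ℂ}

theorem DerivBound.mono_domain (hf : DerivBound K S w f) {K' : Set E} (hK : K' ⊆ K) :
    DerivBound K' S w f :=
  ⟨hf.1, fun i => (hf.2 i).imp fun _ hC p hp z hz => hC p hp z (hK hz)⟩

theorem DerivBound.of_isCompact (hK : IsCompact K) {χ : E → ℂ} (hχ : ContDiff ℝ ∞ χ) :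
    DerivBound K S (fun _ => 1) (fun _ => χ) := by
  refine ⟨fun _ => hχ, fun i => ?_⟩
  obtain ⟨C, hC⟩ := hK.exists_bound_of_continuousOn
    (hχ.continuous_iteratedFDeriv (m := i) (mod_cast le_top)).continuousOn
  exact ⟨C, fun _ _ z hz => by simpa using hC z hz⟩

theorem DerivBound.cutoff (hf : DerivBound K S w f) (hK : IsCompact K) (hw : ∀ p ∈ S, 0 ≤ w p)
    {χ : E → ℂ} (hχ : ContDiff ℝ ∞ χ) (hχK : ∀ z, z ∉ K → χ z = 0) :
    DerivBound Set.univ S w (fun p z => χ z * f p z) := by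
  have h := ((DerivBound.of_isCompact (S := S) hK hχ).mul hf).mono (A := 1) (w' := w) subset_rfl
    (fun p hp => by simpa using hw p hp) (fun p _ => by simp)
  refine ⟨h.1, fun i => ?_⟩
  obtain ⟨C, hC⟩ := h.2 i
  refine ⟨|C|, fun p hp z _ => ?_⟩
  by_cases hz : z ∈ K
  · exact (hC p hp z hz).trans (mul_le_mul_of_nonneg_right (le_abs_self C) (hw p hp))
  · rw [iteratedFDeriv_eq_zero_of_notMem hK.isClosed (fun z hz => by simp [hχK z hz]) i hz,
      norm_zero]
    exact mul_nonneg (abs_nonneg C) (hw p hp)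

end Cutoff

/-! ### Reduction to one normal variable by slicing -/

section Slice

variable {n : ℕ} {K : Set (RSpace n)}

theorem integral_eq_integral_joinLast_symm {f : RSpace n → ℂ} (hf : Integrable f) :
    ∫ z, f z = ∫ r : ℝ, ∫ x : RTan n, f (joinLast x r) := by
  have hm := measurePreserving_joinLast (n := n)
  rw [← hm.integral_comp (joinLastEquiv n).measurableEmbedding f]
  refine integral_prod_symm (fun p : RTan n × ℝ => f (joinLast p.1 p.2)) ?_
  exact (hm.integrable_comp_emb (joinLastEquiv n).measurableEmbedding).2 hf

/-- The partial inverse Fourier transform of `f` in the tangential variables. -/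
def tangentialSlice (f : RSpace n → ℂ) (v' : RTan n) (r : ℝ) : ℂ :=
  ∫ x : RTan n, f (joinLast x r) * Complex.exp (2 * Real.pi * Complex.I * (inner ℝ x v' : ℝ))

theorem fourierInv_eq_fourierInv_tangentialSlice {f : RSpace n → ℂ} (hf : Integrable f)
    (v' : RTan n) (t : ℝ) :
    𝓕⁻ f (joinLast v' t) = 𝓕⁻ (tangentialSlice f v') t := by
  rw [Real.fourierInv_eq', Real.fourierInv_eq', integral_eq_integral_joinLast_symm]
  · refine integral_congr_ae (Eventually.of_forall fun r => ?_)
    simp only [tangentialSlice, smul_eq_mul]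
    rw [← integral_const_mul]
    refine integral_congr_ae (Eventually.of_forall fun x => ?_)
    simp only
    rw [mul_left_comm, mul_comm, ← Complex.exp_add, inner_joinLast, tanPart_joinLast,
      joinLast_last]
    congr 2
    simp only [RCLike.inner_apply, conj_trivial]
    push_cast
    ring
  · refine hf.bdd_mul (c := 1) (Continuous.aestronglyMeasurable (by fun_prop))
      (Eventually.of_forall fun z => ?_)
    rw [Complex.norm_exp]
    simp

theorem tangentialSlice_eq_zero {f : RSpace n → ℂ} (hf : ∀ z, z ∉ K → f z = 0) {v' : RTan n}
    {r : ℝ} (hr : ∀ z ∈ K, z (Fin.last n) ≠ r) : tangentialSlice f v' r = 0 := by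
  refine integral_eq_zero_of_ae (Eventually.of_forall fun x => ?_)
  have : joinLast x r ∉ K := fun h => hr _ h (joinLast_last x r)
  simp [hf _ this]

theorem continuous_tangentialSlice (hK : IsCompact K) {f : RSpace n → ℂ} (hf : Continuous f)
    (hfK : ∀ z, z ∉ K → f z = 0) (v' : RTan n) : Continuous (tangentialSlice f v') := by
  have h1 : tangentialSlice f v' = fun r => ∫ x in tanPart '' K, f (joinLast x r) *
      Complex.exp (2 * Real.pi * Complex.I * (inner ℝ x v' : ℝ)) := by
    funext r
    rw [tangentialSlice, setIntegral_eq_integral_of_forall_compl_eq_zero]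
    intro x hx
    have : joinLast x r ∉ K := fun h => hx ⟨_, h, tanPart_joinLast x r⟩
    rw [hfK _ this, zero_mul]
  rw [h1]
  refine continuous_parametric_integral_of_continuous ?_ (hK.image continuous_tanPart)
  have h2 : Continuous fun p : ℝ × RTan n => f (joinLast p.2 p.1) :=
    hf.comp (continuous_joinLast.comp continuous_swap)
  exact h2.mul (by fun_prop)

/-- The one-dimensional inverse transform of the slice is the full one restricted to a line `ξ =
const`, so it inherits rapid decay; two powers suffice in one variable. -/
theorem integrable_fourierInv_tangentialSlice (hK : IsCompact K) {f : RSpace n → ℂ}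
    (hf : ContDiff ℝ ∞ f) (hfK : ∀ z, z ∉ K → f z = 0) (v' : RTan n) :
    Integrable (𝓕⁻ (tangentialSlice f v')) := by
  have hcs : HasCompactSupport f := HasCompactSupport.intro hK hfK
  have hfi : Integrable f := hf.continuous.integrable_of_hasCompactSupport hcs
  have hd : DerivBound Set.univ Set.univ (fun _ : RSpace n => (1 : ℝ)) (fun _ => f) := by
    have h := (DerivBound.const (K := K) (S := (Set.univ : Set (RSpace n))) (w := fun _ => (1 : ℝ))
      (c := fun _ => (1 : ℂ)) (A := 1) (by simp)).cutoff hK (by simp) hf hfK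
    simpa using h
  obtain ⟨C, hC⟩ := one_add_pow_mul_norm_fourier_le hd hK (fun _ => hfK) 2
  have hcH := continuous_tangentialSlice hK hf.continuous hfK v'
  have hHi : Integrable (tangentialSlice f v') := by
    refine hcH.integrable_of_hasCompactSupport (HasCompactSupport.intro
      (K := (fun z : RSpace n => z (Fin.last n)) '' K) (hK.image (by fun_prop)) fun r hr => ?_)
    exact tangentialSlice_eq_zero hfK fun z hz h => hr ⟨z, hz, h⟩
  have hm : Continuous (𝓕⁻ (tangentialSlice f v')) := by
    have : 𝓕⁻ (tangentialSlice f v') = fun t => 𝓕 (tangentialSlice f v') (-t) := by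
      funext t; rw [Real.fourierInv_eq_fourier_neg]
    rw [this]
    exact (continuous_fourier_of_integrable hHi).comp continuous_neg
  have hdom : Integrable fun t : ℝ => C * (1 + ‖t‖) ^ (-(2 : ℝ)) :=
    (integrable_one_add_norm (by simp)).const_mul C
  refine hdom.mono' hm.aestronglyMeasurable (Eventually.of_forall fun t => ?_)
  rw [← fourierInv_eq_fourierInv_tangentialSlice hfi, Real.fourierInv_eq_fourier_neg]
  have h1 := hC 0 (-joinLast v' t)
  rw [norm_neg, mul_one] at h1
  have h2 : |t| ≤ ‖joinLast v' t‖ := by simpa using abs_last_le_norm (joinLast v' t)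
  rw [Real.rpow_neg (by positivity), Real.rpow_ofNat, le_mul_inv_iff₀ (by positivity), mul_comm]
  refine le_trans ?_ h1
  rw [Real.norm_eq_abs]
  gcongr

/-- The Fourier transform of `(η - i l)^{-j} 𝓕⁻ β` vanishes on the upper half-space if `β` is
supported in the lower one. -/
theorem fourier_tangential_eq_zero (hK : IsCompact K) (hKl : K ⊆ lowerHalf n)
    {β : RTan n → RSpace n → ℂ} (hβ : ∀ v', ContDiff ℝ ∞ (β v'))
    (hβK : ∀ v' z, z ∉ K → β v' z = 0) {l : RTan n → ℝ} (hl : ∀ v', 0 < l v') (j : ℕ)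
    (hΦ : Integrable fun v : RSpace n =>
      (((2 * Real.pi * v (Fin.last n) : ℝ) - Complex.I * l (tanPart v) : ℂ) ^ j)⁻¹ *
        𝓕⁻ (β (tanPart v)) v) {z : RSpace n} (hz : 0 ≤ z (Fin.last n)) :
    𝓕 (fun v : RSpace n =>
      (((2 * Real.pi * v (Fin.last n) : ℝ) - Complex.I * l (tanPart v) : ℂ) ^ j)⁻¹ *
        𝓕⁻ (β (tanPart v)) v) z = 0 := by
  rw [Real.fourier_eq', integral_eq_integral_joinLast]
  swap
  · refine hΦ.bdd_mul (c := 1) (Continuous.aestronglyMeasurable (by fun_prop))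
      (Eventually.of_forall fun z => ?_)
    rw [Complex.norm_exp]
    simp
  refine integral_eq_zero_of_ae (Eventually.of_forall fun v' => ?_)
  have hβi : Integrable (β v') := (hβ v').continuous.integrable_of_hasCompactSupport
    (HasCompactSupport.intro hK (hβK v'))
  have hcH := continuous_tangentialSlice hK (hβ v').continuous (hβK v') v'
  have hHi : Integrable (tangentialSlice (β v') v') := by
    refine hcH.integrable_of_hasCompactSupport (HasCompactSupport.intro
      (K := (fun z : RSpace n => z (Fin.last n)) '' K) (hK.image (by fun_prop)) fun r hr => ?_)
    exact tangentialSlice_eq_zero (hβK v') fun z hz h => hr ⟨z, hz, h⟩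
  -- For each fixed `v'` the inner integral is a one-dimensional one, and the slice is supported in
  -- `r < 0`.
  have key := integral_exp_mul_inv_pow_mul_fourierInv_eq_zero hcH hHi
    (integrable_fourierInv_tangentialSlice hK (hβ v') (hβK v') v')
    (fun r hr => tangentialSlice_eq_zero (hβK v') fun z hz h => by
      have h1 : z (Fin.last n) < 0 := hKl hz
      linarith) (hl v') j hz
  have e : ∀ t : ℝ, Complex.exp (((-2 * Real.pi * inner ℝ (joinLast v' t) z : ℝ) : ℂ) * Complex.I) •
      ((((2 * Real.pi * (joinLast v' t) (Fin.last n) : ℝ) -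
        Complex.I * l (tanPart (joinLast v' t)) : ℂ) ^ j)⁻¹ *
        𝓕⁻ (β (tanPart (joinLast v' t))) (joinLast v' t))
      = Complex.exp (((-2 * Real.pi * inner ℝ v' (tanPart z) : ℝ) : ℂ) * Complex.I) *
        (Complex.exp (-(2 * Real.pi * Complex.I * (z (Fin.last n) * t : ℝ))) *
        ((((2 * Real.pi * t : ℝ) - Complex.I * l v' : ℂ) ^ j)⁻¹ *
          𝓕⁻ (tangentialSlice (β v') v') t)) := by
    intro t
    rw [tanPart_joinLast, joinLast_last, fourierInv_eq_fourierInv_tangentialSlice hβi,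
      smul_eq_mul, ← mul_assoc (Complex.exp _) (Complex.exp _), ← Complex.exp_add, inner_joinLast]
    congr 2
    push_cast
    ring
  simp only [e]
  rw [integral_const_mul, key, mul_zero]
  rfl

end Slice

/-! ### Vanishing of pairings with functions on the upper half-space -/

theorem decayKernel_le_one {V : Type*} [NormedAddCommGroup V] [InnerProductSpace ℝ V] (u : V) :
    decayKernel u ≤ 1 := by
  unfold decayKernel
  refine Real.rpow_le_one_of_one_le_of_nonpos ?_ ?_
  · simp
  · have : (0 : ℝ) ≤ Module.finrank ℝ V := Nat.cast_nonneg _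
    linarith

/-- The diagonal value `𝓕⁻ (b v) v` is `𝓕 (b v) (0 - v)`, so the kernel estimate at `θ = 0` bounds
it by `decayKernel v`. -/
theorem integrable_and_memLp_fourierInv_kernel {n : ℕ} {K : Set (RSpace n)} (hK : IsCompact K)
    {b : RSpace n → RSpace n → ℂ} (hb : DerivBound Set.univ Set.univ (fun _ => 1) b)
    (hsupp : ∀ v z, z ∉ K → b v z = 0)
    (hbc : Continuous fun p : RSpace n × RSpace n => b p.1 p.2) :
    Integrable (fun v => 𝓕⁻ (b v) v) ∧ MemLp (fun v => 𝓕⁻ (b v) v) 2 := by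
  set Φ : RSpace n → ℂ := fun v => 𝓕⁻ (b v) v with hΦ
  have hm : StronglyMeasurable Φ := by
    have h := (stronglyMeasurable_fourier_kernel hbc).comp_measurable
      (measurable_const.prodMk measurable_id : Measurable fun v : RSpace n => ((0 : RSpace n), v))
    have e : Φ = (fun p : RSpace n × RSpace n => 𝓕 (b p.2) (p.1 - p.2)) ∘
        fun v : RSpace n => ((0 : RSpace n), v) := by
      funext v
      simp [hΦ, Real.fourierInv_eq_fourier_neg]
    rw [e]
    exact h
  obtain ⟨C, hC⟩ := exists_fourier_kernel_le hb hK hsupp (s := 0) le_rfl (W := fun _ => 1) (A := 1)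
    (by simp) (by simp) (by simp)
  have hbd : ∀ v, ‖Φ v‖ ≤ C * decayKernel v := by
    intro v
    have := hC v 0
    simpa [hΦ, Real.fourierInv_eq_fourier_neg, decayKernel] using this
  have hint : Integrable Φ := (integrable_decayKernel.const_mul (C : ℝ)).mono'
    hm.aestronglyMeasurable (Eventually.of_forall hbd)
  have hmem : MemLp Φ 2 := by
    refine memLp_two_of_lintegral_lt_top hm.aestronglyMeasurable ?_
    refine lt_of_le_of_lt (lintegral_mono (g := fun v => ENNReal.ofReal ((C : ℝ) ^ 2) *
      ENNReal.ofReal (decayKernel v)) fun v => ?_) ?_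
    · beta_reduce
      rw [← ofReal_norm, ← ENNReal.ofReal_pow (norm_nonneg _), ← ENNReal.ofReal_mul (by positivity)]
      refine ENNReal.ofReal_le_ofReal ?_
      calc ‖Φ v‖ ^ 2 ≤ (C * decayKernel v) ^ 2 := by gcongr; exact hbd v
        _ = (C : ℝ) ^ 2 * (decayKernel v * decayKernel v) := by ring
        _ ≤ (C : ℝ) ^ 2 * (decayKernel v * 1) := by
          gcongr
          · exact decayKernel_nonneg v
          · exact decayKernel_le_one v
        _ = _ := by rw [mul_one]
    · rw [lintegral_const_mul' _ _ (by simp)]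
      exact ENNReal.mul_lt_top (by simp) lintegral_decayKernel_lt_top
  exact ⟨hint, hmem⟩

/-- Moving the Fourier transform from `g` to the other factor pairs two functions that live on
opposite sides of the boundary. -/
theorem integral_fourier_mul_fourierInv_eq_zero {n : ℕ} {K : Set (RSpace n)} (hK : IsCompact K)
    {b : RSpace n → RSpace n → ℂ} (hb : DerivBound Set.univ Set.univ (fun _ => 1) b)
    (hsupp : ∀ v z, z ∉ K → b v z = 0)
    (hbc : Continuous fun p : RSpace n × RSpace n => b p.1 p.2)
    (h0 : Integrable (fun v => 𝓕⁻ (b v) v) → ∀ z : RSpace n, 0 ≤ z (Fin.last n) →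
      𝓕 (fun v => 𝓕⁻ (b v) v) z = 0)
    {g : L2Full n} (hg : ∀ᵐ z, z ∈ lowerHalf n → g z = 0) :
    ∫ v, (𝓕 g : L2Full n) v * 𝓕⁻ (b v) v = 0 := by
  set Φ : RSpace n → ℂ := fun v => 𝓕⁻ (b v) v with hΦ
  obtain ⟨hint, hmem⟩ := integrable_and_memLp_fourierInv_kernel hK hb hsupp hbc
  have h1 := integral_fourier_mul g (hmem.toLp Φ)
  calc ∫ v, (𝓕 g : L2Full n) v * Φ v
      = ∫ v, (𝓕 g : L2Full n) v * (hmem.toLp Φ) v := by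
        refine integral_congr_ae ?_
        filter_upwards [hmem.coeFn_toLp] with v hv
        rw [hv]
    _ = ∫ z, g z * (𝓕 (hmem.toLp Φ) : L2Full n) z := h1
    _ = 0 := by
        refine integral_eq_zero_of_ae ?_
        filter_upwards [fourier_toLp_ae_eq hint hmem, hg] with z hz hgz
        rw [hz]
        rcases lt_or_ge (z (Fin.last n)) 0 with h | h
        · simp [hgz h]
        · rw [show 𝓕 (fun v => 𝓕⁻ (b v) v) z = 0 from h0 hint z h, mul_zero]
          rfl

/-! ### Tangential multipliers and the splitting of `ℝ^{n+1}` into two half-spaces -/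

section TangentialMultiplier

variable {n : ℕ} {M : RTan n → ℝ} {A : ℝ}

theorem memLp_tangentialMultiplier (hM : Continuous M) (hA : ∀ ξ, |M ξ| ≤ A) (g : L2Full n) :
    MemLp (fun v => (M (tanPart v) : ℂ) * (𝓕 g : L2Full n) v) 2 volume := by
  have hc : Continuous fun v : RSpace n => (M (tanPart v) : ℂ) :=
    Complex.continuous_ofReal.comp (hM.comp continuous_tanPart)
  refine (Lp.memLp (𝓕 g : L2Full n)).of_le_mul (c := A)
    (hc.aestronglyMeasurable.mul (Lp.aestronglyMeasurable _)) (Eventually.of_forall fun v => ?_)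
  rw [norm_mul]
  gcongr
  simpa using hA (tanPart v)

/-- A tangential Fourier multiplier does not move the support of a function across the boundary. -/
theorem integral_tangentialMultiplier_mul_fourierInv_eq_zero (hM : Continuous M)
    (hA : ∀ ξ, |M ξ| ≤ A) {g : L2Full n} (hg : ∀ᵐ z, z ∈ lowerHalf n → g z = 0)
    {φ : RSpace n → ℂ} (hφ : ContDiff ℝ ∞ φ) (hφc : HasCompactSupport φ)
    (hφl : tsupport φ ⊆ lowerHalf n) :
    ∫ v, (M (tanPart v) : ℂ) * (𝓕 g : L2Full n) v * 𝓕⁻ φ v = 0 := by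
  have hφ0 : ∀ z, z ∉ tsupport φ → φ z = 0 := fun z hz => image_eq_zero_of_notMem_tsupport hz
  have hb : DerivBound Set.univ Set.univ (fun _ => 1)
      (fun v z => φ z * (M (tanPart (v : RSpace n)) : ℂ)) := by
    refine DerivBound.cutoff (f := fun v _ => (M (tanPart v) : ℂ)) (K := tsupport φ)
      (DerivBound.const (A := A) fun v _ => ?_) hφc (by simp) hφ hφ0
    simpa using hA (tanPart v)
  have hbc : Continuous fun p : RSpace n × RSpace n => φ p.2 * (M (tanPart p.1) : ℂ) :=
    (hφ.continuous.comp continuous_snd).mul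
      (Complex.continuous_ofReal.comp (hM.comp (continuous_tanPart.comp continuous_fst)))
  have h := integral_fourier_mul_fourierInv_eq_zero hφc hb (fun v z hz => by simp [hφ0 z hz]) hbc
    (fun hi z hz => ?_) hg
  · rw [← h]
    refine integral_congr_ae (Eventually.of_forall fun v => ?_)
    have : 𝓕⁻ (fun z => φ z * (M (tanPart v) : ℂ)) v = (M (tanPart v) : ℂ) * 𝓕⁻ φ v := by
      rw [Real.fourierInv_eq', Real.fourierInv_eq', ← integral_const_mul]
      refine integral_congr_ae (Eventually.of_forall fun z => ?_)
      simp only [smul_eq_mul]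
      ring
    simp only [this]
    ring
  -- With exponent `0` the factor `η - il` disappears, and `l = 1` is arbitrary.
  · have := fourier_tangential_eq_zero hφc hφl (β := fun v' z => φ z * (M v' : ℂ))
      (fun v' => hφ.mul contDiff_const) (fun v' z hz => by simp [hφ0 z hz]) (l := fun _ => 1)
      (by simp) 0 (by simpa using hi) hz
    simpa using this

theorem fourierInv_tangentialMultiplier_eq_zero (hM : Continuous M) (hA : ∀ ξ, |M ξ| ≤ A)
    {g : L2Full n} (hg : ∀ᵐ z, z ∈ lowerHalf n → g z = 0) :
    ∀ᵐ z, z ∈ lowerHalf n →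
      (𝓕⁻ ((memLp_tangentialMultiplier hM hA g).toLp _) : L2Full n) z = 0 := by
  set G := (memLp_tangentialMultiplier hM hA g).toLp _ with hG
  have hopen : IsOpen (lowerHalf n) :=
    isOpen_lt (by fun_prop : Continuous fun z : RSpace n => z (Fin.last n)) continuous_const
  refine hopen.ae_eq_zero_of_integral_contDiff_smul_eq_zero
    (((Lp.memLp _).locallyIntegrable (p := 2) (by norm_num)).locallyIntegrableOn _) fun φ hφ hφc hφl => ?_
  have h1 : HasCompactSupport (fun x => (φ x : ℂ)) :=
    hφc.comp_left (g := fun r : ℝ => (r : ℂ)) Complex.ofReal_zero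
  have h2 : ContDiff ℝ ∞ (fun x => (φ x : ℂ)) := Complex.ofRealCLM.contDiff.comp hφ
  have h3 : tsupport (fun x => (φ x : ℂ)) ⊆ lowerHalf n := by
    refine (closure_mono fun x hx => ?_).trans hφl
    simpa using hx
  have h4 := integral_tangentialMultiplier_mul_fourierInv_eq_zero hM hA hg h2 h1 h3
  have h5 := integral_fourier_mul_schwartz (𝓕⁻ G : L2Full n)
    (𝓕⁻ (h1.toSchwartzMap h2) : SchwartzMap (RSpace n) ℂ)
  rw [FourierTransform.fourier_fourierInv_eq, FourierTransform.fourier_fourierInv_eq] at h5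
  calc ∫ z, φ z • (𝓕⁻ G : L2Full n) z = ∫ z, (𝓕⁻ G : L2Full n) z * (h1.toSchwartzMap h2) z := by
        refine integral_congr_ae (Eventually.of_forall fun z => ?_)
        simp [mul_comm]
    _ = _ := h5.symm
    _ = 0 := by
        rw [← h4, SchwartzMap.fourierInv_coe]
        refine integral_congr_ae ?_
        filter_upwards [(memLp_tangentialMultiplier hM hA g).coeFn_toLp] with v hv
        rw [hG, hv]
        rfl

/-- The multiplier keeps `g` on the upper side, while `h` lives on the lower one. -/
theorem inner_tangentialMultiplier_eq_zero (hM : Continuous M) (hA : ∀ ξ, |M ξ| ≤ A)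
    {g h : L2Full n} (hg : ∀ᵐ z, z ∈ lowerHalf n → g z = 0)
    (hh : ∀ᵐ z, z ∉ lowerHalf n → h z = 0) :
    inner ℂ ((memLp_tangentialMultiplier hM hA g).toLp _) (𝓕 h : L2Full n) = 0 := by
  have h1 := fourierInv_tangentialMultiplier_eq_zero hM hA hg
  set G := (memLp_tangentialMultiplier hM hA g).toLp _
  have h2 : inner ℂ G (𝓕 h : L2Full n) = inner ℂ (𝓕⁻ G : L2Full n) h := by
    rw [← Lp.inner_fourier_eq (𝓕⁻ G : L2Full n), FourierTransform.fourier_fourierInv_eq]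
  rw [h2, L2.inner_def]
  refine integral_eq_zero_of_ae ?_
  filter_upwards [h1, hh] with z hz1 hz2
  by_cases hz : z ∈ lowerHalf n
  · simp [hz1 hz]
  · simp [hz2 hz]

/-- This is Pythagoras for the semi-inner product with weight `M`: the cross term vanishes and the
contribution of `h` is nonnegative. -/
theorem lintegral_tangentialMultiplier_le (hM : Continuous M) (hM0 : ∀ ξ, 0 ≤ M ξ)
    (hA : ∀ ξ, M ξ ≤ A) {g h : L2Full n} (hg : ∀ᵐ z, z ∈ lowerHalf n → g z = 0)
    (hh : ∀ᵐ z, z ∉ lowerHalf n → h z = 0) :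
    ∫⁻ v, ENNReal.ofReal (M (tanPart v)) * ‖(𝓕 g : L2Full n) v‖ₑ ^ 2
      ≤ ∫⁻ v, ENNReal.ofReal (M (tanPart v)) * ‖(𝓕 (g + h) : L2Full n) v‖ₑ ^ 2 := by
  have hA' : ∀ ξ, |M ξ| ≤ A := fun ξ => by rw [abs_of_nonneg (hM0 ξ)]; exact hA ξ
  have hi : ∀ f : L2Full n,
      Integrable fun v => M (tanPart v) * ‖(𝓕 f : L2Full n) v‖ ^ 2 := fun f =>
    ((Lp.memLp (𝓕 f : L2Full n)).norm.integrable_sq).bdd_mul (c := A)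
      (hM.comp continuous_tanPart).aestronglyMeasurable
      (Eventually.of_forall fun v => by simpa using hA' (tanPart v))
  have hl : ∀ f : L2Full n, ∫⁻ v, ENNReal.ofReal (M (tanPart v)) * ‖(𝓕 f : L2Full n) v‖ₑ ^ 2
      = ENNReal.ofReal (∫ v, M (tanPart v) * ‖(𝓕 f : L2Full n) v‖ ^ 2) := by
    intro f
    rw [ofReal_integral_eq_lintegral_ofReal (hi f) (Eventually.of_forall fun v =>
      mul_nonneg (hM0 _) (by positivity))]
    refine lintegral_congr fun v => ?_
    rw [ENNReal.ofReal_mul (hM0 _), ENNReal.ofReal_pow (norm_nonneg _), ofReal_norm]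
  rw [hl, hl]
  refine ENNReal.ofReal_le_ofReal ?_
  have hz := inner_tangentialMultiplier_eq_zero hM hA' hg hh
  rw [L2.inner_def] at hz
  have hzi := L2.integrable_inner (𝕜 := ℂ)
    ((memLp_tangentialMultiplier hM hA' g).toLp _) (𝓕 h : L2Full n)
  have hzr : Integrable fun v =>
      (inner ℂ (((memLp_tangentialMultiplier hM hA' g).toLp _ : L2Full n) v)
        ((𝓕 h : L2Full n) v)).re := hzi.re
  have hre : ∫ v, (inner ℂ (((memLp_tangentialMultiplier hM hA' g).toLp _ : L2Full n) v)
      ((𝓕 h : L2Full n) v)).re = 0 := by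
    have := integral_re (𝕜 := ℂ) hzi
    rw [hz] at this
    simpa using this
  calc ∫ v, M (tanPart v) * ‖(𝓕 g : L2Full n) v‖ ^ 2
      = ∫ v, (M (tanPart v) * ‖(𝓕 g : L2Full n) v‖ ^ 2 +
          2 * (inner ℂ (((memLp_tangentialMultiplier hM hA' g).toLp _ : L2Full n) v)
            ((𝓕 h : L2Full n) v)).re) := by
        rw [integral_add (hi g) (hzr.const_mul 2), integral_const_mul, hre,
          mul_zero, add_zero]
    _ ≤ ∫ v, M (tanPart v) * ‖(𝓕 (g + h) : L2Full n) v‖ ^ 2 := by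
        refine integral_mono_ae ((hi g).add (hzr.const_mul 2)) (hi (g + h)) ?_
        rw [FourierAdd.fourier_add]
        filter_upwards [Lp.coeFn_add (𝓕 g : L2Full n) (𝓕 h),
          (memLp_tangentialMultiplier hM hA' g).coeFn_toLp] with v h1 h2
        rw [h1, h2, Pi.add_apply, norm_add_sq (𝕜 := ℂ)]
        have h3 : (inner ℂ ((M (tanPart v) : ℂ) * (𝓕 g : L2Full n) v) ((𝓕 h : L2Full n) v)).re
            = M (tanPart v) * (inner ℂ ((𝓕 g : L2Full n) v) ((𝓕 h : L2Full n) v)).re := by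
          simp only [RCLike.inner_apply, map_mul, Complex.conj_ofReal]
          rw [mul_left_comm, Complex.re_ofReal_mul]
        rw [h3]
        have h4 : 0 ≤ M (tanPart v) * ‖(𝓕 h : L2Full n) v‖ ^ 2 :=
          mul_nonneg (hM0 _) (by positivity)
        simp only [RCLike.re_eq_complex_re]
        linarith

/-- The tangential Sobolev norms of the part of a function in the upper half-space are controlled by
those of the whole function. -/
theorem lintegral_tangentialWeight_le {W : RTan n → ℝ} (hW : Continuous W) (hW0 : ∀ ξ, 0 ≤ W ξ)
    {g h : L2Full n} (hg : ∀ᵐ z, z ∈ lowerHalf n → g z = 0)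
    (hh : ∀ᵐ z, z ∉ lowerHalf n → h z = 0) :
    ∫⁻ v, (ENNReal.ofReal (W (tanPart v)) * ‖(𝓕 g : L2Full n) v‖ₑ) ^ 2
      ≤ ∫⁻ v, (ENNReal.ofReal (W (tanPart v)) * ‖(𝓕 (g + h) : L2Full n) v‖ₑ) ^ 2 := by
  -- The weight may be unbounded, so the bounded case is applied to `min (W ^ 2) N` and followed by
  -- monotone convergence.
  have hsup : ∀ r : ℝ, ⨆ N : ℕ, ENNReal.ofReal (min r N) = ENNReal.ofReal r := by
    intro r
    refine le_antisymm (iSup_le fun N => ENNReal.ofReal_le_ofReal (min_le_left _ _)) ?_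
    obtain ⟨N, hN⟩ := exists_nat_ge r
    exact le_iSup_of_le N (by rw [min_eq_left hN])
  have hmono : ∀ r : ℝ, Monotone fun N : ℕ => ENNReal.ofReal (min r N) := fun r N N' hN =>
    ENNReal.ofReal_le_ofReal (min_le_min le_rfl (by exact_mod_cast hN))
  have e : ∀ v, (ENNReal.ofReal (W (tanPart v)) * ‖(𝓕 g : L2Full n) v‖ₑ) ^ 2
      = ⨆ N : ℕ, ENNReal.ofReal (min (W (tanPart v) ^ 2) N) * ‖(𝓕 g : L2Full n) v‖ₑ ^ 2 := by
    intro v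
    rw [mul_pow, ← ENNReal.iSup_mul, hsup, ENNReal.ofReal_pow (hW0 _)]
  simp only [e]
  have hm : ∀ N : ℕ, Measurable fun v : RSpace n => ENNReal.ofReal (min (W (tanPart v) ^ 2) N) :=
    fun N => (((hW.comp continuous_tanPart).pow 2).min continuous_const).measurable.ennreal_ofReal
  rw [lintegral_iSup]
  · refine iSup_le fun N => (lintegral_tangentialMultiplier_le (A := N)
      (M := fun ξ => min (W ξ ^ 2) N) ((hW.pow 2).min continuous_const)
      (fun ξ => le_min (by positivity) (by positivity)) (fun ξ => min_le_right _ _) hg hh).trans ?_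
    refine lintegral_mono fun v => ?_
    rw [mul_pow, ← ENNReal.ofReal_pow (hW0 _)]
    gcongr
    exact min_le_left _ _
  · intro N
    exact (hm N).mul ((Lp.stronglyMeasurable _).enorm.pow_const 2)
  · intro N N' hN v
    exact mul_le_mul_left (hmono _ hN) _

end TangentialMultiplier

/-! ### The symbol as a family of rational functions of the normal frequency -/

section Symbol

theorem IsSymbol.derivBound {X Y : Type*} [NormedAddCommGroup X] [NormedSpace ℝ X]
    [NormedAddCommGroup Y] [NormedSpace ℝ Y] {m : ℝ} {a : X → Y → ℂ} (ha : IsSymbol m a)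
    {K : Set X} (hK : IsCompact K) :
    DerivBound K Set.univ (fun ζ => (1 + ‖ζ‖) ^ m) (fun ζ z => a z ζ) := by
  refine ⟨fun ζ => (ha.1 () trivial).comp (contDiff_id.prodMk contDiff_const), fun i => ?_⟩
  obtain ⟨C, hC⟩ := ha.2 K hK i 0
  refine ⟨C, fun ζ _ z hz => ?_⟩
  have h := hC () trivial z hz ζ
  have e : (fun z' => iteratedFDeriv ℝ 0 (fun ζ' => a z' ζ') ζ)
      = (continuousMultilinearCurryFin0 ℝ Y ℂ).symm ∘ fun z' => a z' ζ := by
    funext z'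
    rw [iteratedFDeriv_zero_eq_comp]
    rfl
  rw [e, LinearIsometryEquiv.norm_iteratedFDeriv_comp_left] at h
  simpa using h

theorem IsSymbol.continuous {X Y : Type*} [NormedAddCommGroup X] [NormedSpace ℝ X]
    [NormedAddCommGroup Y] [NormedSpace ℝ Y] {m : ℝ} {a : X → Y → ℂ} (ha : IsSymbol m a) :
    Continuous fun p : X × Y => a p.1 p.2 :=
  (ha.1 () trivial).continuous

variable {n : ℕ} {k : ℝ} {a : RSpace n → RSpace n → ℂ}

theorem norm_le_norm_joinLast (x : RTan n) (r : ℝ) : ‖x‖ ≤ ‖joinLast x r‖ := by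
  simpa using norm_tanPart_le (joinLast x r)

theorem tendsto_symbol_joinLast (ha : IsSymbol k a) (hk : k < 0) (z : RSpace n) (ξ : RTan n) :
    Tendsto (fun η : ℝ => a z (joinLast ξ η)) atTop (𝓝 0) := by
  obtain ⟨C, hC⟩ := (ha.derivBound (isCompact_singleton (x := z))).2 0
  refine squeeze_zero_norm' (a := fun η : ℝ => |C| * η ^ k) ?_ ?_
  · filter_upwards [eventually_gt_atTop 0] with η hη
    have h := hC (joinLast ξ η) trivial z rfl
    rw [norm_iteratedFDeriv_zero] at h
    refine h.trans ((mul_le_mul_of_nonneg_right (le_abs_self C) (by positivity)).trans ?_)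
    refine mul_le_mul_of_nonneg_left ?_ (abs_nonneg C)
    refine Real.rpow_le_rpow_of_nonpos hη ?_ hk.le
    have := abs_last_le_norm (joinLast ξ η)
    rw [joinLast_last] at this
    linarith [le_abs_self η]
  · have := (tendsto_rpow_neg_atTop (neg_pos.2 hk)).const_mul |C|
    simpa using this

/-- Negativity of `k` enters twice: `a → 0` as `η → ∞` gives degree less than `N`, and `|(ξ, η)| ≥
|ξ|` gives the bound `Λ^k`. -/
theorem HasEllipticPoles.exists_isRationalSymbol (ha : HasEllipticPoles n k a) (hk : k < 0)
    {K : Set (RSpace n)} (hK : IsCompact K) :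
    ∃ (N : ℕ) (q : Fin N → RTan n → RSpace n → ℂ),
      IsRationalSymbol K (fun ξ => 1 + ‖ξ‖) q k (fun p z => a z (joinLast p.1 p.2)) ∧
      (∀ m, DerivBound K Set.univ (fun ξ => 1 + ‖ξ‖) (q m)) ∧
      ∀ m, Continuous fun x : RTan n × RSpace n => q m x.1 x.2 := by
  obtain ⟨hs, N, q, b, hb, hmer, hq, -, -⟩ := ha
  have hac : Continuous fun x : (RTan n × ℝ) × RSpace n => a x.2 (joinLast x.1.1 x.1.2) :=
    hs.continuous.comp (continuous_snd.prodMk (continuous_joinLast.comp continuous_fst))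
  refine ⟨N, fun m ξ z => q m z ξ, ⟨fun T => ?_, fun ξ z => ?_, hac⟩, fun m => ?_, fun m => ?_⟩
  · refine ((hs.derivBound hK).comp_param (fun p : RTan n × ℝ => joinLast p.1 p.2)
      (S' := {p | |p.2| ≤ T * (1 + ‖p.1‖)}) (fun _ _ => trivial)).mono (A := 1) subset_rfl
      (fun p _ => by positivity) fun p _ => ?_
    rw [one_mul]
    exact Real.rpow_le_rpow_of_nonpos (by positivity)
      (by linarith [norm_le_norm_joinLast p.1 p.2]) hk.le
  · have hc : Continuous fun η : ℝ => b z ξ η := by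
      simp only [hb]
      exact hac.comp (f := fun η : ℝ => ((ξ, η), z)) (by fun_prop)
    have h0 : Tendsto (fun η : ℝ => b z ξ η) atTop (𝓝 0) := by
      simp only [hb]
      exact tendsto_symbol_joinLast hs hk z ξ
    obtain ⟨P, hP, hP'⟩ := (hmer z ξ).exists_polynomial hc h0
    exact ⟨P, hP, fun η => by rw [← hP', hb]⟩
  · simpa using (hq m).derivBound hK
  · exact (hq m).continuous.comp continuous_swap

end Symbol

/-! ### Removing the one-sided part of the symbol -/

section Reduction

variable {n : ℕ}

/-- The factor `η - i (1 + |ξ|)` at the frequency `(ξ, η) = 2πv`. -/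
def normalFactor (v : RSpace n) : ℂ :=
  (2 * Real.pi * v (Fin.last n) : ℝ) - Complex.I * ((1 + ‖(2 * Real.pi) • tanPart v‖ : ℝ) : ℂ)

theorem continuous_normalFactor : Continuous (normalFactor : RSpace n → ℂ) := by
  unfold normalFactor
  have := continuous_tanPart (n := n)
  fun_prop

theorem tangentialWeight_le_norm_normalFactor (v : RSpace n) :
    1 + ‖(2 * Real.pi) • tanPart v‖ ≤ ‖normalFactor v‖ := by
  have h := Complex.abs_im_le_norm (normalFactor v)
  have e : (normalFactor v).im = -(1 + ‖(2 * Real.pi) • tanPart v‖) := by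
    simp only [normalFactor, Complex.sub_im, Complex.ofReal_im, Complex.I_mul_im, Complex.ofReal_re]
    ring
  rw [e, abs_neg, abs_of_nonneg (by positivity)] at h
  exact h

theorem normalFactor_ne_zero (v : RSpace n) : normalFactor v ≠ 0 := by
  have h := tangentialWeight_le_norm_normalFactor v
  rw [← norm_pos_iff]
  linarith [norm_nonneg ((2 * Real.pi) • tanPart v)]

theorem sobolevWeight_le_norm_normalFactor_sq (v : RSpace n) :
    1 + ‖(2 * Real.pi) • v‖ ^ 2 ≤ ‖normalFactor v‖ ^ 2 := by
  rw [norm_sq_eq_tanPart, tanPart_smul, Complex.sq_norm, Complex.normSq_apply]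
  simp only [normalFactor, Complex.sub_re, Complex.sub_im, Complex.ofReal_im, Complex.I_mul_im,
    Complex.I_mul_re, Complex.ofReal_re, PiLp.smul_apply, smul_eq_mul]
  nlinarith [norm_nonneg ((2 * Real.pi) • tanPart v)]

theorem fourierInv_eq_integral_mul_exp (f : RSpace n → ℂ) (v : RSpace n) :
    𝓕⁻ f v = ∫ z, f z * Complex.exp (2 * Real.pi * Complex.I * (inner ℝ z v : ℝ)) := by
  rw [Real.fourierInv_eq']
  refine integral_congr_ae (Eventually.of_forall fun z => ?_)
  simp only [smul_eq_mul]
  rw [mul_comm]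
  congr 2
  push_cast
  ring

theorem fourierInv_sum_add {ι : Type*} (S : Finset ι) {f : ι → RSpace n → ℂ} {g : RSpace n → ℂ}
    (hf : ∀ i ∈ S, Integrable (f i)) (hg : Integrable g) (v : RSpace n) :
    𝓕⁻ (fun z => ∑ i ∈ S, f i z + g z) v = ∑ i ∈ S, 𝓕⁻ (f i) v + 𝓕⁻ g v := by
  have h : ∀ f : RSpace n → ℂ, Integrable f → Integrable fun z =>
      f z * Complex.exp (2 * Real.pi * Complex.I * (inner ℝ z v : ℝ)) := fun f hf =>
    hf.mul_bdd (c := 1) (Continuous.aestronglyMeasurable (by fun_prop))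
      (Eventually.of_forall fun z => by rw [Complex.norm_exp]; simp)
  simp only [fourierInv_eq_integral_mul_exp, add_mul, Finset.sum_mul]
  rw [integral_add (integrable_finsetSum _ fun i hi => h _ (hf i hi)) (h _ hg),
    integral_finsetSum _ fun i hi => h _ (hf i hi)]

variable {k : ℝ} {a : RSpace n → RSpace n → ℂ} {χ : RSpace n → ℂ}

theorem opPairing_cutoff_eq (F : L2Full n) (φ : RSpace n → ℂ) :
    opPairing a F (fun z => χ z * φ z) = ∫ v, (𝓕 F : L2Full n) v *
      𝓕⁻ (fun z => χ z * φ z * a z ((2 * Real.pi) • v)) v := by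
  simp only [opPairing, fourierInv_eq_integral_mul_exp]

theorem rpow_neg_mul_rpow_add_le_one {l k : ℝ} (hl : 1 ≤ l) (hk : k ≤ 0) (j : ℕ) :
    (l ^ j)⁻¹ * l ^ (k + j) ≤ 1 := by
  have h0 : 0 < l := zero_lt_one.trans_le hl
  rw [Real.rpow_add h0, Real.rpow_natCast, mul_comm, mul_assoc, mul_inv_cancel₀ (by positivity),
    mul_one]
  exact Real.rpow_le_one_of_one_le_of_nonpos hl hk

theorem DerivBound.normalFactor_inv_pow_mul {K : Set (RSpace n)} {f : RSpace n → RSpace n → ℂ}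
    {w : RSpace n → ℝ} (hf : DerivBound K Set.univ w f) (j : ℕ) :
    DerivBound K Set.univ (fun v => (‖normalFactor v‖ ^ j)⁻¹ * w v)
      (fun v z => (normalFactor v ^ j)⁻¹ * f v z) :=
  (DerivBound.const (c := fun v => (normalFactor v ^ j)⁻¹) (w := fun v => (‖normalFactor v‖ ^ j)⁻¹)
    (A := 1) fun v _ => by simp).mul hf

theorem norm_normalFactor_inv_pow_mul_le_one (hk : k ≤ 0) (j : ℕ) (v : RSpace n) :
    (‖normalFactor v‖ ^ j)⁻¹ * (1 + ‖(2 * Real.pi) • tanPart v‖) ^ (k + j) ≤ 1 := by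
  refine le_trans ?_ (rpow_neg_mul_rpow_add_le_one (l := 1 + ‖(2 * Real.pi) • tanPart v‖)
    (by simp) hk j)
  gcongr
  exact tangentialWeight_le_norm_normalFactor v

/-- For functions supported in the upper half-space, and tested on the lower one, the symbol `χ a` can
be replaced by one which decays to any given order in the normal frequency. -/
theorem HasEllipticPoles.exists_reduced_symbol (ha : HasEllipticPoles n k a) (hk : k < 0)
    (hχ : ContDiff ℝ ∞ χ) (hχc : HasCompactSupport χ) (m : ℕ) :
    ∃ e : RSpace n → RSpace n → ℂ,
      DerivBound Set.univ Set.univ (fun v => (‖normalFactor v‖ ^ m)⁻¹ *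
        (1 + ‖(2 * Real.pi) • tanPart v‖) ^ (k + m)) e ∧
      (∀ v z, z ∉ tsupport χ → e v z = 0) ∧
      (Continuous fun p : RSpace n × RSpace n => e p.1 p.2) ∧
      ∀ g : L2Full n, (∀ᵐ z, z ∈ lowerHalf n → g z = 0) → ∀ φ : RSpace n → ℂ,
        ContDiff ℝ ∞ φ → HasCompactSupport φ → tsupport φ ⊆ lowerHalf n →
        opPairing a g (fun z => χ z * φ z) = ∫ v, (𝓕 g : L2Full n) v * ∫ z, e v z * φ z *
          Complex.exp (2 * Real.pi * Complex.I * (inner ℝ z v : ℝ)) := by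
  have hχ0 : ∀ z, z ∉ tsupport χ → χ z = 0 := fun z hz => image_eq_zero_of_notMem_tsupport hz
  obtain ⟨N, q, haq, hq, hqc⟩ := ha.exists_isRationalSymbol hk (K := tsupport χ) hχc
  obtain ⟨c, r, hc, hcc, hr, hrc, hexp⟩ := haq.exists_expansion (fun ξ => by simp)
    (by fun_prop) hq hqc m
  have htan : Continuous (tanPart : RSpace n → RTan n) := continuous_tanPart
  have hinv : ∀ j : ℕ, Continuous fun v : RSpace n => (normalFactor v ^ j)⁻¹ := fun j =>
    (continuous_normalFactor.pow j).inv₀ fun v => pow_ne_zero _ (normalFactor_ne_zero v)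
  set e : RSpace n → RSpace n → ℂ := fun v z => χ z * ((normalFactor v ^ m)⁻¹ *
    r ((2 * Real.pi) • tanPart v, 2 * Real.pi * v (Fin.last n)) z) with he
  have hed : DerivBound Set.univ Set.univ (fun v => (‖normalFactor v‖ ^ m)⁻¹ *
      (1 + ‖(2 * Real.pi) • tanPart v‖) ^ (k + m)) e :=
    ((hr.comp_param (fun v : RSpace n =>
      ((2 * Real.pi) • tanPart v, 2 * Real.pi * v (Fin.last n))) (S' := Set.univ)
      (fun _ _ => trivial)).normalFactor_inv_pow_mul m).cutoff hχc (fun v _ => by positivity) hχ hχ0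
  have hes : ∀ v z, z ∉ tsupport χ → e v z = 0 := fun v z hz => by simp [he, hχ0 z hz]
  have hec : Continuous fun p : RSpace n × RSpace n => e p.1 p.2 := by
    refine (hχ.continuous.comp continuous_snd).mul (((hinv m).comp continuous_fst).mul ?_)
    exact hrc.comp (f := fun p : RSpace n × RSpace n =>
      (((2 * Real.pi) • tanPart p.1, 2 * Real.pi * p.1 (Fin.last n)), p.2)) (by fun_prop)
  refine ⟨e, hed, hes, hec, fun g hg φ hφ hφc hφl => ?_⟩
  have hφ0 : ∀ z, z ∉ tsupport φ → φ z = 0 := fun z hz => image_eq_zero_of_notMem_tsupport hz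
  have hχφ0 : ∀ z, z ∉ tsupport χ → χ z * φ z = 0 := fun z hz => by simp [hχ0 z hz]
  set β : ℕ → RTan n → RSpace n → ℂ := fun j v' z => χ z * φ z * c j ((2 * Real.pi) • v') z with hβ
  set b : ℕ → RSpace n → RSpace n → ℂ := fun j v z =>
    χ z * φ z * ((normalFactor v ^ (j + 1))⁻¹ * c j ((2 * Real.pi) • tanPart v) z) with hb
  have hbd : ∀ j, DerivBound Set.univ Set.univ (fun _ => 1) (b j) := by
    intro j
    refine DerivBound.cutoff (K := tsupport χ) (f := fun v z => (normalFactor v ^ (j + 1))⁻¹ *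
      c j ((2 * Real.pi) • tanPart v) z) ?_ hχc (by simp) (hχ.mul hφ) hχφ0
    refine (((hc j).comp_param (fun v : RSpace n => (2 * Real.pi) • tanPart v)
      (S' := Set.univ) (fun _ _ => trivial)).normalFactor_inv_pow_mul (j + 1)).mono (A := 1)
      subset_rfl (fun v _ => by positivity) fun v _ => ?_
    rw [one_mul]
    have := norm_normalFactor_inv_pow_mul_le_one hk.le (j + 1) v
    push_cast at this
    exact this
  have hbs : ∀ j v z, z ∉ tsupport φ → b j v z = 0 := fun j v z hz => by simp [hb, hφ0 z hz]
  have hbc : ∀ j, Continuous fun p : RSpace n × RSpace n => b j p.1 p.2 := by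
    intro j
    refine ((hχ.mul hφ).continuous.comp continuous_snd).mul
      (((hinv (j + 1)).comp continuous_fst).mul ?_)
    exact (hcc j).comp (f := fun p : RSpace n × RSpace n => ((2 * Real.pi) • tanPart p.1, p.2))
      (by fun_prop)
  have hbi : ∀ j v, Integrable (b j v) := fun j v =>
    ((hbd j).1 v).continuous.integrable_of_hasCompactSupport (HasCompactSupport.intro hφc (hbs j v))
  have hbz : ∀ j, ∫ v, (𝓕 g : L2Full n) v * 𝓕⁻ (b j v) v = 0 := by
    intro j
    -- Each term of the expansion is one-sided: its `η`-dependence is a power of `(η - iΛ)⁻¹`, which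
    -- comes out of the `z`-integral.
    refine integral_fourier_mul_fourierInv_eq_zero hφc (hbd j) (hbs j) (hbc j) ?_ hg
    have hbβ : ∀ v, 𝓕⁻ (b j v) v = (normalFactor v ^ (j + 1))⁻¹ * 𝓕⁻ (β j (tanPart v)) v := by
      intro v
      rw [fourierInv_eq_integral_mul_exp, fourierInv_eq_integral_mul_exp, ← integral_const_mul]
      refine integral_congr_ae (Eventually.of_forall fun z => ?_)
      simp only [hb, hβ]
      ring
    simp only [hbβ]
    intro hi z hz
    exact fourier_tangential_eq_zero hφc hφl (β := β j)
      (fun v' => (hχ.mul hφ).mul ((hc j).1 _)) (fun v' z hz => by simp [hβ, hφ0 z hz])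
      (l := fun v' => 1 + ‖(2 * Real.pi) • v'‖) (fun v' => by positivity) (j + 1) hi hz
  have hφe : DerivBound Set.univ Set.univ (fun _ => 1) (fun v z => φ z * e v z) :=
    ((hed.mono (A := 1) (w' := fun _ => 1) subset_rfl (fun v _ => by positivity) fun v _ => by
      rw [one_mul]
      exact norm_normalFactor_inv_pow_mul_le_one hk.le m v).mono_domain
        (Set.subset_univ (tsupport φ))).cutoff hφc (by simp) hφ hφ0
  have hφes : ∀ v z, z ∉ tsupport φ → φ z * e v z = 0 := fun v z hz => by simp [hφ0 z hz]
  have hφei : ∀ v, Integrable fun z => φ z * e v z := fun v =>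
    (hφe.1 v).continuous.integrable_of_hasCompactSupport (HasCompactSupport.intro hφc (hφes v))
  have hsplit : ∀ v, 𝓕⁻ (fun z => χ z * φ z * a z ((2 * Real.pi) • v)) v
      = ∑ j ∈ Finset.range m, 𝓕⁻ (b j v) v + 𝓕⁻ (fun z => φ z * e v z) v := by
    intro v
    rw [← fourierInv_sum_add _ (fun j _ => hbi j v) (hφei v)]
    refine congrArg (fun f : RSpace n → ℂ => 𝓕⁻ f v) ?_
    funext z
    have h := hexp ((2 * Real.pi) • tanPart v, 2 * Real.pi * v (Fin.last n)) z
    have hj : joinLast ((2 * Real.pi) • tanPart v) (2 * Real.pi * v (Fin.last n))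
        = (2 * Real.pi) • v := by
      rw [← joinLast_tanPart ((2 * Real.pi) • v), tanPart_smul]
      rfl
    simp only [hj] at h
    simp only [h, hb, he, mul_add, Finset.mul_sum]
    congr 1
    unfold normalFactor
    ring
  rw [opPairing_cutoff_eq]
  have hgL : MemLp ((𝓕 g : L2Full n) : RSpace n → ℂ) 2 volume := Lp.memLp _
  have hib : ∀ j, Integrable fun v => (𝓕 g : L2Full n) v * 𝓕⁻ (b j v) v := fun j =>
    hgL.integrable_mul (integrable_and_memLp_fourierInv_kernel hφc (hbd j) (hbs j) (hbc j)).2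
  have hie : Integrable fun v => (𝓕 g : L2Full n) v * 𝓕⁻ (fun z => φ z * e v z) v :=
    hgL.integrable_mul (integrable_and_memLp_fourierInv_kernel hφc hφe hφes
      ((hφ.continuous.comp continuous_snd).mul hec)).2
  simp only [hsplit, mul_add, Finset.mul_sum]
  rw [integral_add (integrable_finsetSum _ fun j _ => hib j) hie,
    integral_finsetSum _ fun j _ => hib j, Finset.sum_eq_zero fun j _ => hbz j, zero_add]
  refine integral_congr_ae (Eventually.of_forall fun v => ?_)
  simp only [fourierInv_eq_integral_mul_exp]
  congr 2
  funext z
  ring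

end Reduction

/-! ### Sobolev bounds on the half-space -/

section HalfSpace

variable {n : ℕ} {k s : ℝ} {a : RSpace n → RSpace n → ℂ} {χ : RSpace n → ℂ}

theorem isOpen_lowerHalf (n : ℕ) : IsOpen (lowerHalf n) :=
  isOpen_lt (by fun_prop : Continuous fun z : RSpace n => z (Fin.last n)) continuous_const

/-- Restriction to the lower half-space. -/
def restrictLower (U : L2Full n) : L2Half n := ((Lp.memLp U).restrict (lowerHalf n)).toLp _

theorem restrictLower_ae_eq (U : L2Full n) :
    (U : RSpace n → ℂ) =ᵐ[volume.restrict (lowerHalf n)] restrictLower U :=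
  (MemLp.coeFn_toLp _).symm

theorem halfNorm_restrictLower_le (hs : 0 ≤ s) (U : L2Full n) :
    halfNorm s (restrictLower U) ≤ sobolevNorm s U := by
  rw [halfNorm, if_pos hs]
  exact iInf₂_le U (restrictLower_ae_eq U)

theorem integral_restrictLower_mul (U : L2Full n) {φ : RSpace n → ℂ}
    (hφ : tsupport φ ⊆ lowerHalf n) :
    ∫ z in lowerHalf n, restrictLower U z * φ z = ∫ z, U z * φ z := by
  rw [← setIntegral_eq_integral_of_forall_compl_eq_zero (s := lowerHalf n) (f := fun z => U z * φ z)]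
  · refine integral_congr_ae ?_
    filter_upwards [restrictLower_ae_eq U] with z hz
    rw [hz]
  · intro z hz
    rw [image_eq_zero_of_notMem_tsupport fun h => hz (hφ h), mul_zero]

/-- Test functions on the open half-space determine `u`. This makes the image independent of the
extension used to construct it. -/
theorem IsCutoffImage.unique {f u u' : L2Half n} (h : IsCutoffImage a χ f u)
    (h' : IsCutoffImage a χ f u') : u = u' := by
  have hm := measurableSet_lowerHalf n
  have hl : ∀ w : L2Half n, LocallyIntegrableOn (w : RSpace n → ℂ) (lowerHalf n) := fun w =>
    locallyIntegrableOn_of_locallyIntegrable_restrict ((Lp.memLp w).locallyIntegrable (by norm_num))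
  have key : ∀ᵐ z, z ∈ lowerHalf n → (u - u' : RSpace n → ℂ) z = 0 := by
    refine (isOpen_lowerHalf n).ae_eq_zero_of_integral_contDiff_smul_eq_zero
      ((hl u).sub (hl u')) fun φ hφ hφc hφl => ?_
    have h1 : HasCompactSupport (fun x => (φ x : ℂ)) :=
      hφc.comp_left (g := fun r : ℝ => (r : ℂ)) Complex.ofReal_zero
    have h2 : ContDiff ℝ ∞ (fun x => (φ x : ℂ)) := Complex.ofRealCLM.contDiff.comp hφ
    have h3 : tsupport (fun x => (φ x : ℂ)) ⊆ lowerHalf n := by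
      refine (closure_mono fun x hx => ?_).trans hφl
      simpa using hx
    have hφ2 : MemLp (fun x => (φ x : ℂ)) 2 (volume.restrict (lowerHalf n)) :=
      (h2.continuous.memLp_of_hasCompactSupport h1).restrict _
    have hi : ∀ w : L2Half n, Integrable (fun z => w z * (φ z : ℂ)) (volume.restrict (lowerHalf n)) :=
      fun w => (Lp.memLp w).integrable_mul hφ2
    rw [← setIntegral_eq_integral_of_forall_compl_eq_zero (s := lowerHalf n)]
    · have e : ∀ z, φ z • (u - u' : RSpace n → ℂ) z = u z * (φ z : ℂ) - u' z * (φ z : ℂ) := by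
        intro z
        rw [Pi.sub_apply, Complex.real_smul]
        ring
      simp only [e]
      rw [integral_sub (hi u) (hi u'), ← h _ h2 h1 h3, ← h' _ h2 h1 h3, sub_self]
    · intro z hz
      rw [image_eq_zero_of_notMem_tsupport fun h => hz (hφl h), zero_smul]
  refine Lp.ext ?_
  filter_upwards [(ae_restrict_iff' hm).2 key] with z hz
  exact sub_eq_zero.1 hz

theorem sobolevNorm_eq (s : ℝ) (U : L2Full n) :
    sobolevNorm s U = (∫⁻ v, (ENNReal.ofReal ((1 + ‖(2 * Real.pi) • v‖ ^ 2) ^ (s / 2)) *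
      ‖(𝓕 U : L2Full n) v‖ₑ) ^ 2) ^ (1 / 2 : ℝ) := by
  rw [sobolevNorm]
  congr 1
  refine lintegral_congr fun v => ?_
  rw [mul_pow, ofReal_sobolevWeight_sq]

theorem sobolevNorm_mono {s t : ℝ} (h : s ≤ t) (U : L2Full n) :
    sobolevNorm s U ≤ sobolevNorm t U := by
  unfold sobolevNorm
  gcongr
  simp

theorem fourier_sub_eq (U V : L2Full n) : (𝓕 (U - V) : L2Full n) = 𝓕 U - 𝓕 V := by
  refine eq_sub_of_add_eq ?_
  rw [← FourierAdd.fourier_add, sub_add_cancel]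

theorem sobolevNorm_sub_le (s : ℝ) (U V : L2Full n) :
    sobolevNorm s (U - V) ≤ sobolevNorm s U + sobolevNorm s V := by
  have hW : Measurable fun v : RSpace n =>
      ENNReal.ofReal ((1 + ‖(2 * Real.pi) • v‖ ^ 2) ^ (s / 2)) := by fun_prop
  have hm : ∀ F : L2Full n, AEMeasurable fun v =>
      ENNReal.ofReal ((1 + ‖(2 * Real.pi) • v‖ ^ 2) ^ (s / 2)) * ‖(𝓕 F : L2Full n) v‖ₑ := fun F =>
    (hW.mul (Lp.stronglyMeasurable _).enorm).aemeasurable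
  have h := ENNReal.lintegral_Lp_add_le (p := 2) (hm U) (hm V) (by norm_num)
  simp only [ENNReal.rpow_ofNat, Pi.add_apply] at h
  rw [sobolevNorm_eq, sobolevNorm_eq, sobolevNorm_eq]
  refine le_trans (ENNReal.rpow_le_rpow (lintegral_mono_ae ?_) (by norm_num)) h
  have e : (𝓕 (U - V) : L2Full n) = 𝓕 U - 𝓕 V := fourier_sub_eq U V
  rw [e]
  filter_upwards [Lp.coeFn_sub (𝓕 U : L2Full n) (𝓕 V)] with v hv
  rw [hv, Pi.sub_apply, ← mul_add]
  gcongr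
  exact enorm_sub_le

theorem sobolevNorm_lt_top_of_nonpos {s : ℝ} (hs : s ≤ 0) (U : L2Full n) :
    sobolevNorm s U < ⊤ := by
  refine (sobolevNorm_mono hs U).trans_lt ?_
  have := lintegral_enorm_sq_lt_top (Lp.memLp (𝓕 U : L2Full n))
  simp only [sobolevNorm, Real.rpow_zero, ENNReal.ofReal_one, one_mul]
  exact ENNReal.rpow_lt_top_of_nonneg (by norm_num) this.ne

theorem halfNorm_mono {s t : ℝ} (hs : 0 ≤ s) (h : s ≤ t) (f : L2Half n) :
    halfNorm s f ≤ halfNorm t f := by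
  rw [halfNorm, halfNorm, if_pos hs, if_pos (hs.trans h)]
  exact iInf₂_mono fun U _ => sobolevNorm_mono h U

theorem lintegral_lt_top_of_sobolevNorm_lt_top {U : L2Full n} (h : sobolevNorm s U < ⊤) :
    ∫⁻ v, (ENNReal.ofReal ((1 + ‖(2 * Real.pi) • v‖ ^ 2) ^ (s / 2)) *
      ‖(𝓕 U : L2Full n) v‖ₑ) ^ 2 < ⊤ := by
  rw [sobolevNorm_eq] at h
  by_contra h'
  rw [not_lt_top_iff] at h'
  rw [h', ENNReal.top_rpow_of_pos (by norm_num)] at h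
  exact lt_irrefl _ h

theorem one_add_rpow_le_sobolevWeight (hk : k ≤ 0) {t : ℝ} (ht : 0 ≤ t) :
    (1 + t) ^ k ≤ (1 + t ^ 2) ^ (k / 2) := by
  have h : (1 + t ^ 2) ^ (1 / 2 : ℝ) ≤ 1 + t := by
    rw [← Real.sqrt_eq_rpow]
    exact Real.sqrt_le_iff.2 ⟨by positivity, by nlinarith⟩
  calc (1 + t) ^ k ≤ ((1 + t ^ 2) ^ (1 / 2 : ℝ)) ^ k :=
        Real.rpow_le_rpow_of_nonpos (by positivity) h hk
    _ = _ := by rw [← Real.rpow_mul (by positivity)]; congr 1; ring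

/-- The operator `χ Op(a)` maps `W^{s+k}(ℝ^{n+1})` to `W^s(ℝ^{n+1})`. -/
theorem IsSymbol.exists_cutoff_image (ha : IsSymbol k a) (hk : k ≤ 0) (hs : 0 ≤ s)
    (hχ : ContDiff ℝ ∞ χ) (hχc : HasCompactSupport χ) :
    ∃ C : ℝ≥0, ∀ F : L2Full n, sobolevNorm (s + k) F < ⊤ → ∃ U : L2Full n,
      (∀ φ : RSpace n → ℂ, ContDiff ℝ ∞ φ → HasCompactSupport φ →
        opPairing a F (fun z => χ z * φ z) = ∫ z, U z * φ z) ∧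
      sobolevNorm s U ≤ C * sobolevNorm (s + k) F := by
  have hχ0 : ∀ z, z ∉ tsupport χ → χ z = 0 := fun z hz => image_eq_zero_of_notMem_tsupport hz
  have hb : DerivBound Set.univ Set.univ (fun v => (1 + ‖(2 * Real.pi) • v‖) ^ k)
      (fun (v : RSpace n) z => χ z * a z ((2 * Real.pi) • v)) :=
    DerivBound.cutoff (((ha.derivBound (K := tsupport χ) hχc).comp_param
      (fun v : RSpace n => (2 * Real.pi) • v) (S' := Set.univ) (fun _ _ => trivial))) hχc
      (fun v _ => by positivity) hχ hχ0
  obtain ⟨C, hC⟩ := exists_op_image hb hχc (fun v z hz => by simp [hχ0 z hz])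
    ((hχ.continuous.comp continuous_snd).mul (ha.continuous.comp
      (f := fun p : RSpace n × RSpace n => (p.2, (2 * Real.pi) • p.1)) (by fun_prop))) hs
    (W := fun v => (1 + ‖(2 * Real.pi) • v‖ ^ 2) ^ ((s + k) / 2)) (A := 1)
    (fun v => by positivity) (by fun_prop) (fun v => by positivity) (fun v => by
      rw [one_mul, add_div, Real.rpow_add (by positivity), mul_comm]
      gcongr
      exact one_add_rpow_le_sobolevWeight hk (norm_nonneg _))
  refine ⟨C, fun F hF => ?_⟩
  obtain ⟨U, hU, hUn⟩ := hC F (lintegral_lt_top_of_sobolevNorm_lt_top hF)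
  refine ⟨U, fun φ hφ hφc => ?_, by rwa [sobolevNorm_eq (s + k)]⟩
  rw [← hU φ hφ hφc, opPairing]
  refine integral_congr_ae (Eventually.of_forall fun v => ?_)
  simp only
  congr 2
  funext z
  ring

/-- Here `y = |η - iΛ|`, `l = Λ` and `r = 1 + |ζ|^2`. The Sobolev weight costs at most `y^s`, and
since `s - m ≤ 0` and `l ≤ y`, what is left of `y` is bounded by `l^{s-m}`. -/
theorem reducedWeight_le {l y r : ℝ} {m : ℕ} (hl : 1 ≤ l) (hly : l ≤ y) (hry : r ≤ y ^ 2)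
    (hr : 0 ≤ r) (hs : 0 ≤ s) (hm : s ≤ m) :
    (y ^ m)⁻¹ * l ^ (k + m) * r ^ (s / 2) ≤ l ^ (s + k) := by
  have hl0 : 0 < l := zero_lt_one.trans_le hl
  have hy0 : 0 < y := hl0.trans_le hly
  have h1 : r ^ (s / 2) ≤ y ^ s := by
    calc r ^ (s / 2) ≤ (y ^ 2) ^ (s / 2) := Real.rpow_le_rpow hr hry (by positivity)
      _ = y ^ s := by rw [← Real.rpow_natCast, ← Real.rpow_mul hy0.le]; congr 1; push_cast; ring
  calc (y ^ m)⁻¹ * l ^ (k + m) * r ^ (s / 2) ≤ (y ^ m)⁻¹ * l ^ (k + m) * y ^ s := by gcongr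
    _ = y ^ (s - m) * l ^ (k + m) := by
        rw [Real.rpow_sub hy0, Real.rpow_natCast]; field_simp
    _ ≤ l ^ (s - m) * l ^ (k + m) := by
        gcongr ?_ * _
        exact Real.rpow_le_rpow_of_nonpos hl0 hly (by linarith)
    _ = l ^ (s + k) := by rw [← Real.rpow_add hl0]; congr 1; ring

theorem one_add_rpow_le {σ t : ℝ} (hσ : 0 ≤ σ) (ht : 0 ≤ t) :
    (1 + t) ^ σ ≤ 2 ^ (σ / 2) * (1 + t ^ 2) ^ (σ / 2) := by
  rw [← Real.mul_rpow (by positivity) (by positivity)]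
  calc (1 + t) ^ σ = ((1 + t) ^ 2) ^ (σ / 2) := by
        rw [← Real.rpow_natCast, ← Real.rpow_mul (by positivity)]; congr 1; push_cast; ring
    _ ≤ _ := Real.rpow_le_rpow (by positivity) (by nlinarith [sq_nonneg (1 - t)]) (by positivity)

/-- On functions supported in the upper half-space, `χ Op(a)` followed by restriction to the lower
half-space is bounded by a tangential Sobolev norm only. -/
theorem HasEllipticPoles.exists_cutoff_image_of_upper (ha : HasEllipticPoles n k a) (hk : k < 0)
    (hs : 0 ≤ s) (hsk : 0 ≤ s + k) (hχ : ContDiff ℝ ∞ χ) (hχc : HasCompactSupport χ) :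
    ∃ C : ℝ≥0, ∀ g h : L2Full n, (∀ᵐ z, z ∈ lowerHalf n → g z = 0) →
      (∀ᵐ z, z ∉ lowerHalf n → h z = 0) → sobolevNorm (s + k) (g + h) < ⊤ → ∃ U : L2Full n,
        (∀ φ : RSpace n → ℂ, ContDiff ℝ ∞ φ → HasCompactSupport φ → tsupport φ ⊆ lowerHalf n →
          opPairing a g (fun z => χ z * φ z) = ∫ z, U z * φ z) ∧
        sobolevNorm s U ≤ C * sobolevNorm (s + k) (g + h) := by
  obtain ⟨m, hm⟩ := exists_nat_ge s
  obtain ⟨e, hed, hes, hec, he⟩ := ha.exists_reduced_symbol hk hχ hχc m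
  have htan : Continuous (tanPart : RSpace n → RTan n) := continuous_tanPart
  set W : RTan n → ℝ := fun ξ => (1 + ‖(2 * Real.pi) • ξ‖ ^ 2) ^ ((s + k) / 2) with hW
  have hWc : Continuous W := by
    refine Continuous.rpow_const (by fun_prop) fun ξ => Or.inr (by positivity)
  obtain ⟨C, hC⟩ := exists_op_image hed hχc hes hec hs (W := fun v => W (tanPart v))
    (A := 2 ^ ((s + k) / 2)) (fun v => by positivity) (hWc.comp htan).measurable
    (fun v => by positivity) (fun v => by
      refine (reducedWeight_le (by simp) (tangentialWeight_le_norm_normalFactor v)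
        (sobolevWeight_le_norm_normalFactor_sq v) (by positivity) hs hm).trans ?_
      exact one_add_rpow_le hsk (norm_nonneg _))
  refine ⟨C, fun g h hg hh hgh => ?_⟩
  -- Orthogonality removes `h`; then `s + k ≥ 0` lets the full weight dominate the tangential one.
  have hle : ∫⁻ v, (ENNReal.ofReal (W (tanPart v)) * ‖(𝓕 g : L2Full n) v‖ₑ) ^ 2
      ≤ ∫⁻ v, (ENNReal.ofReal ((1 + ‖(2 * Real.pi) • v‖ ^ 2) ^ ((s + k) / 2)) *
        ‖(𝓕 (g + h) : L2Full n) v‖ₑ) ^ 2 := by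
    refine (lintegral_tangentialWeight_le hWc (fun ξ => by positivity) hg hh).trans ?_
    refine lintegral_mono fun v => ?_
    simp only [hW]
    rw [← tanPart_smul]
    gcongr
    exact norm_tanPart_le _
  obtain ⟨U, hU, hUn⟩ := hC g (hle.trans_lt (lintegral_lt_top_of_sobolevNorm_lt_top hgh))
  refine ⟨U, fun φ hφ hφc hφl => ?_, hUn.trans ?_⟩
  · rw [he g hg φ hφ hφc hφl, hU φ hφ hφc]
  · rw [sobolevNorm_eq (s + k)]
    gcongr

theorem opPairing_sub (ha : IsSymbol k a) (hk : k ≤ 0) (hχ : ContDiff ℝ ∞ χ)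
    (hχc : HasCompactSupport χ) (F G : L2Full n) {φ : RSpace n → ℂ} (hφ : ContDiff ℝ ∞ φ) :
    opPairing a (F - G) (fun z => χ z * φ z)
      = opPairing a F (fun z => χ z * φ z) - opPairing a G (fun z => χ z * φ z) := by
  have hχ0 : ∀ z, z ∉ tsupport χ → χ z * φ z = 0 := fun z hz => by
    rw [image_eq_zero_of_notMem_tsupport hz, zero_mul]
  have hb : DerivBound Set.univ Set.univ (fun _ => 1)
      (fun (v : RSpace n) z => χ z * φ z * a z ((2 * Real.pi) • v)) := by
    refine DerivBound.cutoff (((ha.derivBound (K := tsupport χ) hχc).comp_param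
      (fun v : RSpace n => (2 * Real.pi) • v) (S' := Set.univ) (fun _ _ => trivial)).mono (A := 1)
      subset_rfl (fun v _ => by positivity) fun v _ => ?_) hχc (by simp) (hχ.mul hφ) hχ0
    rw [one_mul]
    exact Real.rpow_le_one_of_one_le_of_nonpos (by simp) hk
  have hL := (integrable_and_memLp_fourierInv_kernel hχc hb
    (fun v z hz => by simp [hχ0 z hz]) (((hχ.mul hφ).continuous.comp continuous_snd).mul
      (ha.continuous.comp (f := fun p : RSpace n × RSpace n => (p.2, (2 * Real.pi) • p.1))
        (by fun_prop)))).2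
  have hi : ∀ F : L2Full n, Integrable fun v => (𝓕 F : L2Full n) v *
      𝓕⁻ (fun z => χ z * φ z * a z ((2 * Real.pi) • v)) v := fun F =>
    (Lp.memLp (𝓕 F : L2Full n)).integrable_mul hL
  rw [opPairing_cutoff_eq, opPairing_cutoff_eq, opPairing_cutoff_eq,
    ← integral_sub (hi F) (hi G)]
  have e : (𝓕 (F - G) : L2Full n) = 𝓕 F - 𝓕 G := fourier_sub_eq F G
  rw [e]
  refine integral_congr_ae ?_
  filter_upwards [Lp.coeFn_sub (𝓕 F : L2Full n) (𝓕 G)] with v hv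
  rw [hv, Pi.sub_apply, sub_mul]

theorem zeroExt_ae_eq (f : L2Half n) :
    (zeroExt f : RSpace n → ℂ) =ᵐ[volume] (lowerHalf n).indicator f :=
  (memLp_zeroExt f).coeFn_toLp

/-- The bound in terms of an arbitrary extension of `f`. -/
theorem HasEllipticPoles.exists_cutoff_image (ha : HasEllipticPoles n k a) (hk : k < 0)
    (hs : 0 ≤ s) (hsk : 0 ≤ s + k) (hχ : ContDiff ℝ ∞ χ) (hχc : HasCompactSupport χ) :
    ∃ C : ℝ≥0, ∀ (f : L2Half n) (F : L2Full n),
      (F : RSpace n → ℂ) =ᵐ[volume.restrict (lowerHalf n)] f → sobolevNorm (s + k) F < ⊤ →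
      ∃ u : L2Half n, IsCutoffImage a χ f u ∧ halfNorm s u ≤ C * sobolevNorm (s + k) F := by
  obtain ⟨C, hC⟩ := ha.1.exists_cutoff_image hk.le hs hχ hχc
  obtain ⟨D, hD⟩ := ha.exists_cutoff_image_of_upper hk hs hsk hχ hχc
  refine ⟨C + D, fun f F hFf hF => ?_⟩
  have hFf' := (ae_restrict_iff' (measurableSet_lowerHalf n)).1 hFf
  obtain ⟨U, hU, hUn⟩ := hC F hF
  -- The error of the extension, `F - zeroExt f`, lives on the upper side, and `A f = A F - A (F -
  -- f)`.
  have hg : ∀ᵐ z, z ∈ lowerHalf n → (F - zeroExt f : L2Full n) z = 0 := by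
    filter_upwards [Lp.coeFn_sub F (zeroExt f), zeroExt_ae_eq f, hFf'] with z h1 h2 h3 hz
    rw [h1, Pi.sub_apply, h2, Set.indicator_of_mem hz, h3 hz, sub_self]
  have hh : ∀ᵐ z, z ∉ lowerHalf n → (zeroExt f : L2Full n) z = 0 := by
    filter_upwards [zeroExt_ae_eq f] with z h2 hz
    rw [h2, Set.indicator_of_notMem hz]
  obtain ⟨V, hV, hVn⟩ := hD _ _ hg hh (by rwa [sub_add_cancel])
  rw [sub_add_cancel] at hVn
  refine ⟨restrictLower (U - V), fun φ hφ hφc hφl => ?_, ?_⟩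
  · rw [integral_restrictLower_mul _ hφl]
    have h1 := opPairing_sub ha.1 hk.le hχ hχc F (F - zeroExt f) hφ
    rw [sub_sub_cancel] at h1
    have hφ2 : MemLp φ 2 volume := hφ.continuous.memLp_of_hasCompactSupport hφc
    have hi : ∀ U : L2Full n, Integrable fun z => U z * φ z := fun U =>
      (Lp.memLp U).integrable_mul hφ2
    rw [h1, hU φ hφ hφc, hV φ hφ hφc hφl, ← integral_sub (hi U) (hi V)]
    refine integral_congr_ae ?_
    filter_upwards [Lp.coeFn_sub U V] with z hz
    rw [hz, Pi.sub_apply, sub_mul]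
  · calc halfNorm s (restrictLower (U - V)) ≤ sobolevNorm s (U - V) :=
          halfNorm_restrictLower_le hs _
      _ ≤ sobolevNorm s U + sobolevNorm s V := sobolevNorm_sub_le s U V
      _ ≤ C * sobolevNorm (s + k) F + D * sobolevNorm (s + k) F := add_le_add hUn hVn
      _ = _ := by rw [ENNReal.coe_add, add_mul]

end HalfSpace

/-! ### Main theorem -/

theorem mainTheorem2 (n : ℕ) (k : ℝ) (hk : k ≤ -1)
    (a : RSpace n → RSpace n → ℂ) (ha : HasEllipticPoles n k a)
    (s : ℝ) (hs : 0 ≤ s)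
    (χ : RSpace n → ℂ) (hχ : ContDiff ℝ ∞ χ) (hχc : HasCompactSupport χ) :
    ∃ C : ℝ≥0, ∀ f : L2Half n, halfNorm s f < ⊤ →
      ∃ u : L2Half n, IsCutoffImage a χ f u ∧ halfNorm s u < ⊤ ∧
        halfNorm s u ≤ C * halfNorm (s + k) f := by
  rcases lt_or_ge (s + k) 0 with hsk | hsk
  · obtain ⟨C, hC⟩ := ha.1.exists_cutoff_image (by linarith) hs hχ hχc
    refine ⟨C, fun f _ => ?_⟩
    have hf := sobolevNorm_lt_top_of_nonpos hsk.le (zeroExt f)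
    obtain ⟨U, hU, hUn⟩ := hC (zeroExt f) hf
    have hle : halfNorm s (restrictLower U) ≤ C * halfNorm (s + k) f := by
      have : halfNorm (s + k) f = sobolevNorm (s + k) (zeroExt f) := if_neg hsk.not_ge
      rw [this]
      exact (halfNorm_restrictLower_le hs U).trans hUn
    refine ⟨restrictLower U, fun φ hφ hφc hφl => ?_, hle.trans_lt ?_, hle⟩
    · rw [integral_restrictLower_mul _ hφl, hU φ hφ hφc]
    · rw [halfNorm, if_neg hsk.not_ge]
      exact ENNReal.mul_lt_top ENNReal.coe_lt_top hf
  · obtain ⟨C, hC⟩ := ha.exists_cutoff_image (by linarith) hs hsk hχ hχc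
    -- A nonzero constant is needed to divide by it, and to make the bound trivial for extensions of
    -- infinite norm.
    refine ⟨C + 1, fun f hf => ?_⟩
    have hf' : halfNorm (s + k) f < ⊤ := (halfNorm_mono hsk (by linarith) f).trans_lt hf
    have hf'' := hf'
    rw [halfNorm, if_pos hsk] at hf''
    obtain ⟨F₀, hF₀, hF₀n⟩ := by simpa only [iInf_lt_iff] using hf''
    -- One extension fixes `u`; uniqueness then transfers the bound from every other extension to
    -- this `u`.
    obtain ⟨u, hu, -⟩ := hC f F₀ hF₀ hF₀n
    have hle : halfNorm s u ≤ (C + 1 : ℝ≥0) * halfNorm (s + k) f := by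
      have hC0 : ((C + 1 : ℝ≥0) : ℝ≥0∞) ≠ 0 := by simp
      have hd : halfNorm (s + k) f = ⨅ (U : L2Full n)
          (_ : (U : RSpace n → ℂ) =ᵐ[volume.restrict (lowerHalf n)] f), sobolevNorm (s + k) U :=
        if_pos hsk
      rw [← ENNReal.div_le_iff' hC0 ENNReal.coe_ne_top, hd]
      refine le_iInf₂ fun F hF => ?_
      rw [ENNReal.div_le_iff' hC0 ENNReal.coe_ne_top]
      rcases eq_or_ne (sobolevNorm (s + k) F) ⊤ with h | h
      · rw [h, ENNReal.mul_top hC0]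
        exact le_top
      · obtain ⟨u', hu', hn⟩ := hC f F hF (lt_top_iff_ne_top.2 h)
        rw [hu.unique hu']
        refine hn.trans ?_
        gcongr
        simp
    exact ⟨u, hu, hle.trans_lt (ENNReal.mul_lt_top ENNReal.coe_lt_top hf'), hle⟩

end
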